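/- Setting. Let $\mathbb F$ be a finite field with $q$ elements, $C$ a smooth projective geometrically irreducible curve over $\mathbb F$ with function field $K$, $\infty\in C$ a closed point and $A=H^0(C\setminus\{\infty\},\mathcal O_C)\subset K$. Let $\mathbb C_\infty$ be the completion of an algebraic closure of $K$ with respect to a non-archimedean absolute value $|\cdot|$ whose restriction to $K$ has valuation ring $\mathcal O_{C,\infty}$, let $K\subseteq L\subseteq\mathbb C_\infty$ be an intermediate field, and $\ell:K\to L$ the inclusion. Unlabeled tensor products are over $\mathbb F$. An Anderson $A$-module $E$ of dimension $d\ge 1$ over $L$ is an $\mathbb F$-vector space scheme over $L$ isomorphic to $\mathbb G_{a,L}^d$, with an $\mathbb F$-algebra homomorphism $\phi:A\to\operatorname{End}_{\mathbb F,L}(E)$ such that $\partial\phi_a-\ell(a)$ is nilpotent on $\operatorname{Lie}_E(L)$ for every $a\in A$. Its exponential $\exp_E:\operatorname{Lie}_E(\mathbb C_\infty)\to E(\mathbb C_\infty)$ is the unique $\mathbb F$-linear map with $\exp_E(\partial\phi_a(x))=\phi_a(\exp_E(x))$ for all $a\in A$ which, for every isomorphism $\kappa:E\cong\mathbb G_{a,L}^d$,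 is given in the coordinates $\partial\kappa,\kappa$ by an everywhere convergent series $x\mapsto\sum_{n\ge0}e_n^\kappa\,\tau^n(x)$ with matrices $e_n^\kappa\in\mathbb C_\infty^{d\times d}$, $e_0^\kappa=1$, where $\tau$ raises coordinates to the $q$-th power. Let $\Lambda_E=\ker\exp_E$, an $A$-module via $\partial\phi$. For a normed $\mathbb F$-vector space $V$ let $A\hat\otimes V$ be the completion of $A\otimes V$ for the norm $\|x\|=\inf\max_i|v_i|$, the infimum over all representations $x=\sum_i b_i\otimes v_i$. Put $E(\mathbb T)=A\hat\otimes E(\mathbb C_\infty)$ and $\operatorname{Lie}_E(\mathbb T)=A\hat\otimes\operatorname{Lie}_E(\mathbb C_\infty)$, for the maximum norms in any coordinate system $\kappa$. They carry two $A$-actions each: $a\otimes1$ by multiplication on $A$, and $1\otimes a$ by $\phi_a$ on $E(\mathbb C_\infty)$, respectively $1\otimes\partial a$ by $\partial\phi_a$ on $\operatorname{Lie}_E(\mathbb C_\infty)$. Let $\operatorname{id}\hat\otimes\exp_E:\operatorname{Lie}_E(\mathbb T)\to E(\mathbb T)$ be the continuous extension of $\operatorname{id}\otimes\exp_E$. The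 $A$-module of special functions is $$\mathfrak{sf}(E)=\{\omega\in E(\mathbb T)\mid (a\otimes1)\omega=(1\otimes a)\omega\ \text{ for all } a\in A\}.$$ Theorem. Let $u\in A$ be separating, i.e. $K/\mathbb F(u)$ is finite and separable. Let $\mathfrak d_{A/\mathbb F[u]}\subseteq A$ be the relative different, the inverse of the fractional ideal $\{x\in K\mid \operatorname{tr}_{K/\mathbb F(u)}(xy)\in\mathbb F[u]\ \text{ for all } y\in A\}$. Then: 1. $1\otimes\partial u-u\otimes1$ is bijective on $\operatorname{Lie}_E(\mathbb T)$, and $$\tilde\delta_u(x)=(\operatorname{id}\hat\otimes\exp_E)\bigl((1\otimes\partial u-u\otimes1)^{-1}x\bigr),\qquad x\in A\otimes\Lambda_E,$$ induces a well-defined map $\tilde\delta_u:A\otimes_{\mathbb F[u]}\Lambda_E\to\{\omega\in E(\mathbb T)\mid(u\otimes1)\omega=(1\otimes u)\omega\}$ that is linear for both $A$-actions. 2. The multiplication map $A\otimes_{\mathbb F[u]}\Lambda_E\to\Lambda_E$, $a\otimes\lambda\mapsto\partial\phi_a(\lambda)$, restricts to a bijection $m$ from $\{x\in A\otimes_{\mathbb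 F[u]}\Lambda_E\mid(a\otimes1)x=(1\otimes a)x\ \text{ for all } a\in A\}$ onto $\mathfrak d_{A/\mathbb F[u]}\cdot\Lambda_E$, and $\delta_u:=\tilde\delta_u\circ m^{-1}$ is an isomorphism of $A$-modules $$\delta_u:\mathfrak d_{A/\mathbb F[u]}\cdot\Lambda_E\xrightarrow{\ \cong\ }\mathfrak{sf}(E).$$ -/

import Mathlib

open CategoryTheory TensorProduct

universe w u

noncomputable section

namespace AndersonModules

/-! ### The curve, the place at infinity and the ring `A` -/

/-- `K` is the function field of a smooth projective geometrically irreducible curve over `𝔽`: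
it is a finitely generated extension of `𝔽` of transcendence degree one in which `𝔽` is
algebraically closed. (For a finite, hence perfect, field `𝔽` such curves and such fields `K`
correspond to each other.) -/
structure IsCurveFunctionField (𝔽 : Type w) (K : Type u) [Field 𝔽] [Field K] [Algebra 𝔽 K] :
    Prop where
  fg : (⊤ : IntermediateField 𝔽 K).FG
  trdeg_eq_one : Algebra.trdeg 𝔽 K = 1
  exact_constants : ∀ x : K, IsAlgebraic 𝔽 x → x ∈ Set.range (algebraMap 𝔽 K)

/-- A place of `K / 𝔽`, that is, a closed point of the smooth projective curve with function
field `K`, given by its local ring: a valuation ring of `K`, different from `K`,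
containing `𝔽`. -/
structure Place (𝔽 : Type w) (K : Type u) [Field 𝔽] [Field K] [Algebra 𝔽 K] where
  localRing : ValuationSubring K
  algebraMap_mem : ∀ c : 𝔽, algebraMap 𝔽 K c ∈ localRing
  ne_top : localRing ≠ ⊤

/-- The ring of the elements of `K` that are regular at every closed point other than `P`. -/
def Place.regularAway {𝔽 : Type w} {K : Type u} [Field 𝔽] [Field K] [Algebra 𝔽 K]
    (P : Place 𝔽 K) : Subalgebra 𝔽 K where
  carrier := {x | ∀ Q : Place 𝔽 K, Q ≠ P → x ∈ Q.localRing}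
  mul_mem' hx hy Q hQ := mul_mem (hx Q hQ) (hy Q hQ)
  add_mem' hx hy Q hQ := add_mem (hx Q hQ) (hy Q hQ)
  algebraMap_mem' c Q _ := Q.algebraMap_mem c

/-- The real absolute value `v` on an extension `Kbar` of `K` is a place above `P`: it is
non-archimedean and its valuation ring meets `K` in the local ring of `P`. -/
structure Place.IsAbove {𝔽 : Type w} {K : Type u} [Field 𝔽] [Field K] [Algebra 𝔽 K]
    (P : Place 𝔽 K) {Kbar : Type u} [Field Kbar] [Algebra K Kbar] (v : AbsoluteValue Kbar ℝ) :
    Prop where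
  nonarchimedean : IsNonarchimedean v
  le_one_iff : ∀ x : K, v (algebraMap K Kbar x) ≤ 1 ↔ x ∈ P.localRing

/-- `u` is separating: `K / 𝔽(u)` is finite and separable. -/
def IsSeparating (𝔽 : Type w) {K : Type u} [Field 𝔽] [Field K] [Algebra 𝔽 K] (u : K) : Prop :=
  FiniteDimensional (IntermediateField.adjoin 𝔽 {u}) K ∧
    Algebra.IsSeparable (IntermediateField.adjoin 𝔽 {u}) K

/-- The relative different of `A / 𝔽[u]`, for `A ⊆ K`: the inverse of the fractional ideal
`{x ∈ K | ∀ y ∈ A, tr (x y) ∈ 𝔽[u]}`, where `tr` is the trace of `K / 𝔽(u)`. The inverse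
`{a ∈ K | ∀ x in that fractional ideal, a x ∈ A}` is contained in `A`. -/
def relativeDifferent {𝔽 : Type w} {K : Type u} [Field 𝔽] [Field K] [Algebra 𝔽 K]
    (A : Subalgebra 𝔽 K) (u : K) : Ideal A where
  carrier := {a | ∀ x : K,
    (∀ y : A, ((Algebra.trace (IntermediateField.adjoin 𝔽 {u}) K (x * (y : K)) :
      IntermediateField.adjoin 𝔽 {u}) : K) ∈ Algebra.adjoin 𝔽 {u}) → (a : K) * x ∈ A}
  add_mem' {a b} ha hb x hx := by
    have := A.add_mem (ha x hx) (hb x hx)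
    rwa [← add_mul] at this
  zero_mem' x _ := by simp
  smul_mem' c a ha x hx := by
    have := A.mul_mem c.2 (ha x hx)
    rwa [← mul_assoc] at this

/-! ### Gauss norms and completed tensor products -/

section Gauss

variable (𝔽 : Type w) (B : Type*) (V : Type*) [Field 𝔽] [CommRing B] [Algebra 𝔽 B]
  [SeminormedAddCommGroup V] [Module 𝔽 V]

/-- `B ⊗ V`, to be equipped with the Gauss norm. -/
def GaussTensor : Type _ := B ⊗[𝔽] V

instance : AddCommGroup (GaussTensor 𝔽 B V) := inferInstanceAs (AddCommGroup (B ⊗[𝔽] V))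

instance : Module B (GaussTensor 𝔽 B V) := inferInstanceAs (Module B (B ⊗[𝔽] V))

variable {𝔽 B V}

/-- The Gauss norm: the infimum of `max ‖v i‖` over all representations `x = ∑ b i ⊗ v i`
(the norm of `v : Fin n → V` is the maximum norm). -/
def gaussNorm (x : B ⊗[𝔽] V) : ℝ :=
  sInf {r : ℝ | ∃ (n : ℕ) (b : Fin n → B) (v : Fin n → V), x = ∑ i, b i ⊗ₜ[𝔽] v i ∧ r = ‖v‖}

lemma gaussNorm_le {x : B ⊗[𝔽] V} {n : ℕ} (b : Fin n → B) (v : Fin n → V)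
    (h : x = ∑ i, b i ⊗ₜ[𝔽] v i) : gaussNorm x ≤ ‖v‖ :=
  csInf_le ⟨0, by rintro _ ⟨n, b, v, -, rfl⟩; exact norm_nonneg v⟩ ⟨n, b, v, h, rfl⟩

lemma exists_representation (x : B ⊗[𝔽] V) :
    ∃ (n : ℕ) (b : Fin n → B) (v : Fin n → V), x = ∑ i, b i ⊗ₜ[𝔽] v i := by
  induction x with
  | zero => exact ⟨0, Fin.elim0, Fin.elim0, by simp⟩
  | tmul b v => exact ⟨1, fun _ => b, fun _ => v, by simp⟩
  | add x y hx hy =>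
    obtain ⟨n, b, v, rfl⟩ := hx
    obtain ⟨m, c, w, rfl⟩ := hy
    exact ⟨n + m, Fin.append b c, Fin.append v w, by simp [Fin.sum_univ_add]⟩

lemma exists_of_gaussNorm_lt {x : B ⊗[𝔽] V} {r : ℝ} (h : gaussNorm x < r) :
    ∃ (n : ℕ) (b : Fin n → B) (v : Fin n → V), x = ∑ i, b i ⊗ₜ[𝔽] v i ∧ ‖v‖ < r := by
  obtain ⟨n, b, v, hx⟩ := exists_representation x
  obtain ⟨r', hr', hlt⟩ := exists_lt_of_csInf_lt (Set.nonempty_of_mem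
    (show ‖v‖ ∈ {r : ℝ | ∃ (n : ℕ) (b : Fin n → B) (v : Fin n → V),
      x = ∑ i, b i ⊗ₜ[𝔽] v i ∧ r = ‖v‖} from ⟨n, b, v, hx, rfl⟩)) h
  obtain ⟨n, b, v, hx, rfl⟩ := hr'
  exact ⟨n, b, v, hx, hlt⟩

lemma gaussNorm_nonneg (x : B ⊗[𝔽] V) : 0 ≤ gaussNorm x :=
  Real.sInf_nonneg (by rintro _ ⟨n, b, v, -, rfl⟩; exact norm_nonneg v)

lemma gaussNorm_zero : gaussNorm (0 : B ⊗[𝔽] V) = 0 := by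
  refine le_antisymm ?_ (gaussNorm_nonneg _)
  refine (gaussNorm_le (n := 0) Fin.elim0 Fin.elim0 (by simp)).trans ?_
  exact (pi_norm_le_iff_of_nonneg le_rfl).2 fun i => i.elim0

lemma gaussNorm_add_le (x y : B ⊗[𝔽] V) : gaussNorm (x + y) ≤ gaussNorm x + gaussNorm y := by
  refine le_of_forall_pos_le_add fun ε hε => ?_
  obtain ⟨n, b, v, hx, hv⟩ := exists_of_gaussNorm_lt (lt_add_of_pos_right (gaussNorm x) (half_pos hε))
  obtain ⟨m, c, w, hy, hw⟩ := exists_of_gaussNorm_lt (lt_add_of_pos_right (gaussNorm y) (half_pos hε))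
  have h1 := gaussNorm_le (x := x + y) (Fin.append b c) (Fin.append v w)
    (by rw [Fin.sum_univ_add]; simp only [Fin.append_left, Fin.append_right]; rw [← hx, ← hy])
  have h2 : ‖Fin.append v w‖ ≤ ‖v‖ + ‖w‖ := by
    refine (pi_norm_le_iff_of_nonneg (by positivity)).2 fun i => ?_
    refine Fin.addCases (fun i => ?_) (fun i => ?_) i
    · rw [Fin.append_left]
      exact (norm_le_pi_norm v i).trans (le_add_of_nonneg_right (norm_nonneg w))
    · rw [Fin.append_right]
      exact (norm_le_pi_norm w i).trans (le_add_of_nonneg_left (norm_nonneg v))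
  linarith

lemma gaussNorm_smul_le (c : B) (x : B ⊗[𝔽] V) : gaussNorm (c • x) ≤ gaussNorm x := by
  refine le_of_forall_pos_le_add fun ε hε => ?_
  obtain ⟨n, b, v, hx, hv⟩ := exists_of_gaussNorm_lt (lt_add_of_pos_right (gaussNorm x) hε)
  have := gaussNorm_le (x := c • x) (fun i => c * b i) v
    (by rw [hx, Finset.smul_sum]; simp [TensorProduct.smul_tmul'])
  exact this.trans hv.le

variable (𝔽 B V) in
/-- The Gauss norm as a seminorm on the additive group `B ⊗ V`. -/
def gaussSeminorm : AddGroupSeminorm (GaussTensor 𝔽 B V) where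
  toFun := gaussNorm (𝔽 := 𝔽) (B := B) (V := V)
  map_zero' := gaussNorm_zero
  add_le' := gaussNorm_add_le
  neg' := by
    have key : ∀ x : B ⊗[𝔽] V, gaussNorm (-x) ≤ gaussNorm x := fun x => by
      rw [← neg_one_smul B x]; exact gaussNorm_smul_le (-1 : B) x
    have key' : ∀ x : B ⊗[𝔽] V, gaussNorm (-x) = gaussNorm x := fun x =>
      le_antisymm (key x) (by have := key (-x); rwa [neg_neg] at this)
    exact key'

instance : SeminormedAddCommGroup (GaussTensor 𝔽 B V) :=
  (gaussSeminorm 𝔽 B V).toSeminormedAddCommGroup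

instance : UniformContinuousConstSMul B (GaussTensor 𝔽 B V) where
  uniformContinuous_const_smul c :=
    AddMonoidHomClass.uniformContinuous_of_bound
      (DistribSMul.toAddMonoidHom (GaussTensor 𝔽 B V) c) 1 fun x => by
        rw [one_mul]; exact gaussNorm_smul_le (𝔽 := 𝔽) c x

variable {W : Type*} [SeminormedAddCommGroup W] [Module 𝔽 W]

variable (B) in
/-- `id ⊗ f : B ⊗ V → B ⊗ W` for a continuous `𝔽`-linear map `f : V → W`. -/
def GaussTensor.map (f : V →L[𝔽] W) : GaussTensor 𝔽 B V →L[B] GaussTensor 𝔽 B W where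
  toLinearMap := LinearMap.baseChange B (f : V →ₗ[𝔽] W)
  cont := by
    let g : GaussTensor 𝔽 B V →+ GaussTensor 𝔽 B W :=
      (LinearMap.baseChange B (f : V →ₗ[𝔽] W)).toAddMonoidHom
    refine continuous_of_continuousAt_zero g ?_
    rw [ContinuousAt, map_zero, Metric.tendsto_nhds_nhds]
    intro ε hε
    obtain ⟨δ, hδ, H⟩ := Metric.tendsto_nhds_nhds.1
      (show Filter.Tendsto f (nhds 0) (nhds 0) by simpa using f.continuous.tendsto 0) (ε / 2)
      (half_pos hε)
    refine ⟨δ, hδ, fun {x} hx => ?_⟩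
    rw [dist_zero_right] at hx ⊢
    obtain ⟨n, b, v, hx, hv⟩ := exists_of_gaussNorm_lt (𝔽 := 𝔽) (B := B) (V := V) (x := x) hx
    refine lt_of_le_of_lt (b := ε / 2) ?_ (half_lt_self hε)
    refine (gaussNorm_le (𝔽 := 𝔽) b (fun i => f (v i)) ?_).trans ?_
    · rw [hx]; exact map_sum (LinearMap.baseChange B (f : V →ₗ[𝔽] W)) _ _
    · refine (pi_norm_le_iff_of_nonneg (half_pos hε).le).2 fun i => ?_
      have := H (x := v i) (by rw [dist_zero_right]; exact (norm_le_pi_norm v i).trans_lt hv)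
      rw [dist_zero_right] at this
      exact this.le

variable (𝔽 B V) in
/-- The completed tensor product of `B` and `V`, the completion of `B ⊗ V` with respect to the
Gauss norm, as a module over `B` (acting on the left factor). -/
abbrev HatTensor : Type _ := UniformSpace.Completion (GaussTensor 𝔽 B V)

variable (B) in
/-- The continuous extension of `id ⊗ f` to the completed tensor products. -/
def hatMap (f : V →L[𝔽] W) : HatTensor 𝔽 B V →L[B] HatTensor 𝔽 B W :=
  (GaussTensor.map B f).completion

end Gauss

/-! ### Vector space schemes and Anderson modules -/

section Schemes

variable (𝔽 : Type w) (L : Type u) [Field 𝔽] [Field L]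

/-- Functors from commutative `L`-algebras to `𝔽`-vector spaces. An `𝔽`-vector space scheme over
`L` is given by its functor of points; it is affine in the case of interest, where it is
isomorphic to a power of the additive group, and representability is then automatic. By the
Yoneda lemma, morphisms of vector space schemes are the natural transformations. -/
abbrev VectorFunctor : Type _ := CommAlgCat.{u} L ⥤ ModuleCat.{u} 𝔽

/-- The `d`-th power of the additive group over `L`, as an `𝔽`-vector space scheme:
its `R`-points are `R ^ d`. -/
def gaPow [Algebra 𝔽 L] (d : ℕ) : VectorFunctor.{w, u} 𝔽 L where
  obj R := (ModuleCat.restrictScalars (algebraMap 𝔽 L)).obj (ModuleCat.of L (Fin d → R))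
  map f := (ModuleCat.restrictScalars (algebraMap 𝔽 L)).map
    (ModuleCat.ofHom (f.hom.toLinearMap.compLeft (Fin d)))
  map_id R := by ext; rfl
  map_comp f g := by ext; rfl

variable {𝔽 L}

/-- The `R`-points of a vector space scheme. -/
abbrev points (E : VectorFunctor.{w, u} 𝔽 L) (R : Type u) [CommRing R] [Algebra L R] : Type u :=
  E.obj (CommAlgCat.of L R)

/-- The map on `R`-points of a morphism. -/
abbrev pointsMap {E E' : VectorFunctor.{w, u} 𝔽 L} (f : E ⟶ E') (R : Type u) [CommRing R]
    [Algebra L R] : points E R →ₗ[𝔽] points E' R :=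
  (f.app (CommAlgCat.of L R)).hom

/-- The Lie algebra, on `R`-points: the kernel of `E(R[ε]) → E(R)`, `ε ↦ 0`. -/
def lie (E : VectorFunctor.{w, u} 𝔽 L) (R : Type u) [CommRing R] [Algebra L R] :
    Submodule 𝔽 (points E (DualNumber R)) :=
  LinearMap.ker (E.map (CommAlgCat.ofHom (TrivSqZeroExt.fstHom L R R))).hom

/-- The differential `∂f` of a morphism `f`. -/
def lieMap {E E' : VectorFunctor.{w, u} 𝔽 L} (f : E ⟶ E') (R : Type u) [CommRing R]
    [Algebra L R] : lie E R →ₗ[𝔽] lie E' R :=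
  (pointsMap f (DualNumber R)).restrict fun x hx => by
    have h := congrArg (fun g => g.hom x)
      (f.naturality (CommAlgCat.ofHom (TrivSqZeroExt.fstHom L R R)))
    have hx' : (E.map (CommAlgCat.ofHom (TrivSqZeroExt.fstHom L R R))).hom x = 0 := hx
    change (E'.map (CommAlgCat.ofHom (TrivSqZeroExt.fstHom L R R))).hom _ = 0
    refine h.symm.trans ?_
    change (f.app _).hom ((E.map _).hom x) = 0
    rw [hx', map_zero]

/-- The `L`-algebra endomorphism `ε ↦ c ε` of `R[ε]`. -/
def dualScale (L : Type u) [Field L] {R : Type u} [CommRing R] [Algebra L R] (c : R) :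
    DualNumber R →ₐ[L] DualNumber R :=
  (TrivSqZeroExt.map (c • (LinearMap.id : R →ₗ[R] R))).restrictScalars L

/-- Multiplication by the scalar `c` on the Lie algebra. -/
def lieScale (E : VectorFunctor.{w, u} 𝔽 L) {R : Type u} [CommRing R] [Algebra L R] (c : R) :
    lie E R →ₗ[𝔽] lie E R :=
  (E.map (CommAlgCat.ofHom (dualScale L c))).hom.restrict fun x hx => by
    have hx' : (E.map (CommAlgCat.ofHom (TrivSqZeroExt.fstHom L R R))).hom x = 0 := hx
    have h : CommAlgCat.ofHom (dualScale L c) ≫ CommAlgCat.ofHom (TrivSqZeroExt.fstHom L R R) =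
        CommAlgCat.ofHom (TrivSqZeroExt.fstHom L R R) := by
      refine CommAlgCat.hom_ext (AlgHom.ext fun y => ?_)
      exact TrivSqZeroExt.fst_map _ _
    have h2 := congrArg (fun g => (E.map g).hom x) h
    change (E.map (CommAlgCat.ofHom (TrivSqZeroExt.fstHom L R R))).hom _ = 0
    rw [← hx', ← h2, E.map_comp]
    rfl

variable [Algebra 𝔽 L] {d : ℕ}

/-- The coordinates of an `R`-point, for an isomorphism `κ` with a power of the additive group. -/
def coords {E : VectorFunctor.{w, u} 𝔽 L} (κ : E ≅ gaPow 𝔽 L d) (R : Type u) [CommRing R]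
    [Algebra L R] : points E R →+ (Fin d → R) where
  toFun x := pointsMap κ.hom R x
  map_zero' := map_zero (pointsMap κ.hom R)
  map_add' := map_add (pointsMap κ.hom R)

/-- The differential `∂κ`: the coordinates of a tangent vector, read off from
`κ x = ε (∂κ x)`. -/
def lieCoords {E : VectorFunctor.{w, u} 𝔽 L} (κ : E ≅ gaPow 𝔽 L d) (R : Type u) [CommRing R]
    [Algebra L R] : lie E R →+ (Fin d → R) where
  toFun x i := (coords κ (DualNumber R) (x : points E (DualNumber R)) i).snd
  map_zero' := by ext i; simp
  map_add' x y := by ext i; simp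

end Schemes

/-- An Anderson `A`-module of dimension `d` over `L`: an `𝔽`-vector space scheme isomorphic to
the `d`-th power of the additive group, with an action of `A` by endomorphisms, such that
`∂φ_a - ℓ(a)` is nilpotent on the Lie algebra over `L` for all `a ∈ A`
(here `ℓ` is the structure map `A → L`). -/
structure AndersonModule (𝔽 : Type w) (A L : Type u) [Field 𝔽] [CommRing A] [Algebra 𝔽 A]
    [Field L] [Algebra 𝔽 L] [Algebra A L] (d : ℕ) where
  scheme : VectorFunctor.{w, u} 𝔽 L
  exists_coordinates : Nonempty (scheme ≅ gaPow 𝔽 L d)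
  action : A →ₐ[𝔽] End scheme
  nilpotent : ∀ a : A, IsNilpotent
    (lieMap (action a) L - lieScale scheme (algebraMap A L a) : Module.End 𝔽 (lie scheme L))

section Functoriality

variable {𝔽 : Type w} {L : Type u} [Field 𝔽] [Field L]

/-- The action of the endomorphism ring of `E` on the `R`-points. -/
def endPoints (E : VectorFunctor.{w, u} 𝔽 L) (R : Type u) [CommRing R] [Algebra L R] :
    End E →ₐ[𝔽] Module.End 𝔽 (points E R) :=
  AlgHom.ofLinearMap
    { toFun := fun f => pointsMap (show E ⟶ E from f) R
      map_add' := fun _ _ => rfl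
      map_smul' := fun _ _ => rfl }
    rfl (fun _ _ => rfl)

/-- The action of the endomorphism ring of `E` on the Lie algebra. -/
def endLie (E : VectorFunctor.{w, u} 𝔽 L) (R : Type u) [CommRing R] [Algebra L R] :
    End E →ₐ[𝔽] Module.End 𝔽 (lie E R) :=
  AlgHom.ofLinearMap
    { toFun := fun f => lieMap (show E ⟶ E from f) R
      map_add' := fun _ _ => rfl
      map_smul' := fun _ _ => rfl }
    rfl (fun _ _ => rfl)

variable [Algebra 𝔽 L] {d : ℕ}

/-- Morphisms between powers of the additive group are given by polynomials. -/
lemma exists_polynomials (f : gaPow.{w, u} 𝔽 L d ⟶ gaPow.{w, u} 𝔽 L d) :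
    ∃ P : Fin d → MvPolynomial (Fin d) L, ∀ (R : Type u) [CommRing R] [Algebra L R]
      (x : Fin d → R) (i : Fin d),
      (pointsMap f R x : Fin d → R) i = MvPolynomial.aeval x (P i) := by
  refine ⟨(pointsMap f (MvPolynomial (Fin d) L) (MvPolynomial.X : Fin d → _) : Fin d → _),
    fun R _ _ x i => ?_⟩
  have h := congrArg (fun g => (g.hom (MvPolynomial.X : Fin d → MvPolynomial (Fin d) L) :
    Fin d → R) i) (f.naturality (CommAlgCat.ofHom (MvPolynomial.aeval (R := L) x)))
  refine Eq.trans ?_ h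
  change (pointsMap f R x : Fin d → R) i = (pointsMap f R
    (fun j => MvPolynomial.aeval x (MvPolynomial.X j : MvPolynomial (Fin d) L)) : Fin d → R) i
  simp only [MvPolynomial.aeval_X]

lemma coords_pointsMap {E : VectorFunctor.{w, u} 𝔽 L} (κ : E ≅ gaPow 𝔽 L d) (f : E ⟶ E)
    (R : Type u) [CommRing R] [Algebra L R] (x : points E R) :
    coords κ R (pointsMap f R x) = pointsMap (κ.inv ≫ f ≫ κ.hom) R (coords κ R x) := by
  have h : κ.hom ≫ κ.inv ≫ f ≫ κ.hom = f ≫ κ.hom := by simp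
  exact congrArg (fun g : E ⟶ gaPow 𝔽 L d => (pointsMap g R x : Fin d → R)) h.symm

lemma coords_lie {E : VectorFunctor.{w, u} 𝔽 L} (κ : E ≅ gaPow 𝔽 L d)
    (R : Type u) [CommRing R] [Algebra L R] (x : lie E R) :
    coords κ (DualNumber R) (x : points E (DualNumber R)) =
      fun i => TrivSqZeroExt.inr (lieCoords κ R x i) := by
  have h := congrArg (fun g => g.hom (x : points E (DualNumber R)))
    (κ.hom.naturality (CommAlgCat.ofHom (TrivSqZeroExt.fstHom L R R)))
  have hx : (E.map (CommAlgCat.ofHom (TrivSqZeroExt.fstHom L R R))).hom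
    (x : points E (DualNumber R)) = 0 := x.2
  have h0 : (fun i => (coords κ (DualNumber R) (x : points E (DualNumber R)) i).fst) = 0 := by
    refine Eq.trans h.symm ?_
    change pointsMap κ.hom R ((E.map _).hom (x : points E (DualNumber R))) = 0
    rw [hx]
    exact map_zero (pointsMap κ.hom R)
  funext i
  exact TrivSqZeroExt.ext (congrFun h0 i) rfl

lemma lieCoords_surjective {E : VectorFunctor.{w, u} 𝔽 L} (κ : E ≅ gaPow 𝔽 L d)
    (R : Type u) [CommRing R] [Algebra L R] : Function.Surjective (lieCoords κ R) := fun y => by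
  let z : points (gaPow.{w, u} 𝔽 L d) (DualNumber R) :=
    (fun i => TrivSqZeroExt.inr (y i) : Fin d → DualNumber R)
  have hz : ((gaPow.{w, u} 𝔽 L d).map (CommAlgCat.ofHom (TrivSqZeroExt.fstHom L R R))).hom z =
    0 := funext fun i => TrivSqZeroExt.fst_inr R (y i)
  have h := congrArg (fun g => g.hom z)
    (κ.inv.naturality (CommAlgCat.ofHom (TrivSqZeroExt.fstHom L R R)))
  refine ⟨⟨pointsMap κ.inv (DualNumber R) z, ?_⟩, ?_⟩
  · refine Eq.trans h.symm ?_
    change pointsMap κ.inv R (((gaPow.{w, u} 𝔽 L d).map _).hom z) = 0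
    rw [hz, map_zero]
  · funext i
    have h2 : pointsMap κ.hom (DualNumber R) (pointsMap κ.inv (DualNumber R) z) = z :=
      congrArg (fun g : gaPow.{w, u} 𝔽 L d ⟶ gaPow.{w, u} 𝔽 L d =>
        pointsMap g (DualNumber R) z) κ.inv_hom_id
    exact congrArg TrivSqZeroExt.snd (congrFun h2 i)

end Functoriality

namespace AndersonModule

variable {𝔽 : Type w} {A L : Type u} [Field 𝔽] [CommRing A] [Algebra 𝔽 A] [Field L]
  [Algebra 𝔽 L] [Algebra A L] {d : ℕ}

/-- The `C`-points `E(C)`, with the norm given by the coordinate system `κ`. -/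
def Pts (E : AndersonModule.{w, u} 𝔽 A L d) (_κ : E.scheme ≅ gaPow 𝔽 L d) (C : Type u)
    [NormedField C] [Algebra L C] : Type u :=
  points E.scheme C

/-- The Lie algebra `Lie_E(C)`, with the norm given by the coordinate system `∂κ`. -/
def LiePts (E : AndersonModule.{w, u} 𝔽 A L d) (_κ : E.scheme ≅ gaPow 𝔽 L d) (C : Type u)
    [NormedField C] [Algebra L C] : Type u :=
  lie E.scheme C

variable (E : AndersonModule.{w, u} 𝔽 A L d) (κ : E.scheme ≅ gaPow 𝔽 L d) (C : Type u)
  [NormedField C] [Algebra L C]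

instance : AddCommGroup (E.Pts κ C) := inferInstanceAs (AddCommGroup (points E.scheme C))
instance : Module 𝔽 (E.Pts κ C) := inferInstanceAs (Module 𝔽 (points E.scheme C))
instance : AddCommGroup (E.LiePts κ C) := inferInstanceAs (AddCommGroup (lie E.scheme C))
instance : Module 𝔽 (E.LiePts κ C) := inferInstanceAs (Module 𝔽 (lie E.scheme C))

/-- `A` acts on `E(C)` via `φ`. -/
instance : Module A (E.Pts κ C) :=
  Module.compHom (points E.scheme C) ((endPoints E.scheme C).comp E.action).toRingHom

/-- `A` acts on `Lie_E(C)` via `∂φ`. -/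
instance : Module A (E.LiePts κ C) :=
  Module.compHom (lie E.scheme C) ((endLie E.scheme C).comp E.action).toRingHom

instance : IsScalarTower 𝔽 A (E.Pts κ C) where
  smul_assoc c a x :=
    congrArg (fun f : Module.End 𝔽 (points E.scheme C) => f x)
      (map_smul ((endPoints E.scheme C).comp E.action) c a)

instance : IsScalarTower 𝔽 A (E.LiePts κ C) where
  smul_assoc c a x :=
    congrArg (fun f : Module.End 𝔽 (lie E.scheme C) => f x)
      (map_smul ((endLie E.scheme C).comp E.action) c a)

instance : SeminormedAddCommGroup (E.Pts κ C) :=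
  SeminormedAddCommGroup.induced (E.Pts κ C) (Fin d → C)
    (show E.Pts κ C →+ (Fin d → C) from coords κ C)

instance : SeminormedAddCommGroup (E.LiePts κ C) :=
  SeminormedAddCommGroup.induced (E.LiePts κ C) (Fin d → C)
    (show E.LiePts κ C →+ (Fin d → C) from lieCoords κ C)

/-- The norm on `E(C)` is the maximum norm of the coordinates. -/
lemma norm_pts (x : E.Pts κ C) : ‖x‖ = ‖coords κ C x‖ := rfl

/-- The norm on `Lie_E(C)` is the maximum norm of the coordinates. -/
lemma norm_liePts (x : E.LiePts κ C) : ‖x‖ = ‖lieCoords κ C x‖ := rfl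

lemma isInducing_coords :
    Topology.IsInducing (fun x : E.Pts κ C => coords κ C x) := ⟨rfl⟩

lemma isInducing_lieCoords :
    Topology.IsInducing (fun x : E.LiePts κ C => lieCoords κ C x) := ⟨rfl⟩

/-- The continuous `𝔽`-linear map `φ_a` on `E(C)`. -/
def act (a : A) : E.Pts κ C →L[𝔽] E.Pts κ C where
  toLinearMap := (endPoints E.scheme C (E.action a) :
    points E.scheme C →ₗ[𝔽] points E.scheme C)
  cont := by
    obtain ⟨P, hP⟩ := exists_polynomials (κ.inv ≫ (E.action a : E.scheme ⟶ E.scheme) ≫ κ.hom)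
    refine (isInducing_coords E κ C).continuous_iff.2 ?_
    have h : ∀ x : E.Pts κ C, coords κ C (endPoints E.scheme C (E.action a) x) =
        fun i => MvPolynomial.aeval (coords κ C x) (P i) := fun x =>
      (coords_pointsMap κ (E.action a : E.scheme ⟶ E.scheme) C x).trans
        (funext fun i => hP C (coords κ C x) i)
    refine Continuous.congr ?_ fun x => (h x).symm
    refine continuous_pi fun i => ?_
    simp only [MvPolynomial.aeval_def, ← MvPolynomial.eval_map]
    exact (MvPolynomial.continuous_eval _).comp (isInducing_coords E κ C).continuous

/-- The continuous `𝔽`-linear map `∂φ_a` on `Lie_E(C)`. -/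
def actLie (a : A) : E.LiePts κ C →L[𝔽] E.LiePts κ C where
  toLinearMap := (endLie E.scheme C (E.action a) :
    lie E.scheme C →ₗ[𝔽] lie E.scheme C)
  cont := by
    obtain ⟨P, hP⟩ := exists_polynomials (κ.inv ≫ (E.action a : E.scheme ⟶ E.scheme) ≫ κ.hom)
    refine (isInducing_lieCoords E κ C).continuous_iff.2 ?_
    have h : ∀ x : lie E.scheme C, lieCoords κ C (endLie E.scheme C (E.action a) x) =
        fun i => (MvPolynomial.aeval (fun j => (TrivSqZeroExt.inr (lieCoords κ C x j) :
          DualNumber C)) (P i)).snd := fun x => by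
      have h1 := coords_pointsMap κ (E.action a : E.scheme ⟶ E.scheme) (DualNumber C)
        (x : points E.scheme (DualNumber C))
      funext i
      refine congrArg TrivSqZeroExt.snd ((congrFun h1 i).trans ?_)
      rw [coords_lie]
      exact hP (DualNumber C) _ i
    refine Continuous.congr ?_ fun x => (h x).symm
    refine continuous_pi fun i => ?_
    refine TrivSqZeroExt.continuous_snd.comp ?_
    simp only [MvPolynomial.aeval_def, ← MvPolynomial.eval_map]
    refine (MvPolynomial.continuous_eval _).comp (continuous_pi fun j => ?_)
    exact TrivSqZeroExt.continuous_inr.comp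
      ((continuous_apply j).comp (isInducing_lieCoords E κ C).continuous)

lemma act_apply (a : A) (x : E.Pts κ C) : E.act κ C a x = a • x := rfl

lemma actLie_apply (a : A) (x : E.LiePts κ C) : E.actLie κ C a x = a • x := rfl

/-- `f : Lie_E(C) → E(C)` has the two characterizing properties of the exponential function:
it is `A`-equivariant, and in every coordinate system `κ'` it is given by an everywhere
convergent series `∑ e n * τ ^ n (x)` with `e 0 = 1`, where `τ` is the `q`-power Frobenius. -/
structure IsExponential (f : lie E.scheme C →ₗ[𝔽] points E.scheme C) : Prop where
  equivariant : ∀ (a : A) (x : lie E.scheme C),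
    f (lieMap (E.action a) C x) = pointsMap (E.action a) C (f x)
  series : ∀ κ' : E.scheme ≅ gaPow 𝔽 L d, ∃ e : ℕ → Matrix (Fin d) (Fin d) C, e 0 = 1 ∧
    ∀ x : lie E.scheme C,
      HasSum (fun n => (e n).mulVec fun i => lieCoords κ' C x i ^ Nat.card 𝔽 ^ n)
        (coords κ' C (f x))

open Classical in
/-- The exponential function `exp_E : Lie_E(C) → E(C)`: the map with the characterizing
properties (which exists and is unique in the situation of interest). -/
def expLinear : lie E.scheme C →ₗ[𝔽] points E.scheme C :=
  if h : ∃ f, E.IsExponential C f then h.choose else 0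

lemma expLinear_equivariant (a : A) (x : lie E.scheme C) :
    E.expLinear C (lieMap (E.action a) C x) = pointsMap (E.action a) C (E.expLinear C x) := by
  unfold expLinear
  split_ifs with h
  · exact h.choose_spec.equivariant a x
  · simp

variable {C} in
lemma IsExponential.continuous [Finite 𝔽] {f : lie E.scheme C →ₗ[𝔽] points E.scheme C}
    (hf : E.IsExponential C f) (κ : E.scheme ≅ gaPow 𝔽 L d) :
    @Continuous (E.LiePts κ C) (E.Pts κ C) _ _ fun x => f x := by
  obtain ⟨e, -, he⟩ := hf.series κ
  set q := Nat.card 𝔽 with hq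
  have hq1 : 1 < q := Finite.one_lt_card
  have hlt : ∀ n : ℕ, n + 1 ≤ q ^ n := fun n => Nat.lt_pow_self hq1
  -- the coefficients are bounded
  have hcol : ∀ j : Fin d, ∃ M : ℝ, ∀ n i, ‖e n i j‖ ≤ M := fun j => by
    obtain ⟨x, hx⟩ := lieCoords_surjective κ C (Pi.single j 1)
    have h0 := (he x).summable.tendsto_atTop_zero
    obtain ⟨M, hM⟩ := h0.norm.bddAbove_range
    refine ⟨M, fun n i => (Eq.le ?_).trans ((norm_le_pi_norm _ i).trans (hM ⟨n, rfl⟩))⟩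
    have hs : (fun i => lieCoords κ C x i ^ q ^ n) = Pi.single j 1 := by
      funext k
      rw [hx]
      by_cases hk : k = j
      · subst hk; simp
      · simp [hk, (zero_lt_one.trans hq1).ne']
    rw [hs]
    simp
  choose M hM using hcol
  set S : ℝ := ∑ j, |M j| with hS
  have hS0 : 0 ≤ S := Finset.sum_nonneg fun j _ => abs_nonneg _
  have hbound : ∀ x : E.LiePts κ C, ‖x‖ ≤ 1 / 2 →
      ‖(show E.Pts κ C from f x)‖ ≤ S * ‖x‖ * 2 := fun x hx => by
    have hg : HasSum (fun n : ℕ => S * ‖x‖ * (1 / 2 : ℝ) ^ n) (S * ‖x‖ * 2) :=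
      hasSum_geometric_two.mul_left _
    refine (he x).norm_le_of_bounded hg fun n => ?_
    have hx0 : 0 ≤ ‖x‖ := norm_nonneg x
    have hpow : ‖x‖ ^ q ^ n ≤ ‖x‖ * (1 / 2 : ℝ) ^ n :=
      calc ‖x‖ ^ q ^ n ≤ ‖x‖ ^ (n + 1) :=
            pow_le_pow_of_le_one hx0 (hx.trans (by norm_num)) (hlt n)
        _ = ‖x‖ * ‖x‖ ^ n := pow_succ' _ _
        _ ≤ ‖x‖ * (1 / 2 : ℝ) ^ n := by gcongr
    refine (pi_norm_le_iff_of_nonneg (by positivity)).2 fun i => ?_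
    calc ‖(e n).mulVec (fun i => lieCoords κ C x i ^ q ^ n) i‖
        ≤ ∑ j, ‖e n i j * lieCoords κ C x j ^ q ^ n‖ := by
          simp only [Matrix.mulVec, dotProduct]
          exact norm_sum_le _ _
      _ ≤ ∑ j, |M j| * ‖x‖ ^ q ^ n := by
          refine Finset.sum_le_sum fun j _ => ?_
          rw [norm_mul, norm_pow]
          have h1 : ‖lieCoords κ C x j‖ ≤ ‖x‖ := norm_le_pi_norm (lieCoords κ C x) j
          exact mul_le_mul ((hM j n i).trans (le_abs_self _))
            (pow_le_pow_left₀ (norm_nonneg _) h1 _) (by positivity) (abs_nonneg _)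
      _ = S * ‖x‖ ^ q ^ n := by rw [hS, Finset.sum_mul]
      _ ≤ S * (‖x‖ * (1 / 2 : ℝ) ^ n) := by gcongr
      _ = S * ‖x‖ * (1 / 2 : ℝ) ^ n := by ring
  let g : E.LiePts κ C →+ E.Pts κ C := f.toAddMonoidHom
  refine continuous_of_continuousAt_zero g ?_
  rw [ContinuousAt, map_zero, Metric.tendsto_nhds_nhds]
  intro ε hε
  refine ⟨min (1 / 2) (ε / (2 * (S + 1))), by positivity, fun {x} hx => ?_⟩
  rw [dist_zero_right] at hx ⊢
  have h1 := hbound x (hx.le.trans (min_le_left _ _))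
  have h2 : ‖x‖ * (2 * (S + 1)) < ε :=
    (lt_div_iff₀ (by positivity)).1 (hx.trans_le (min_le_right _ _))
  refine lt_of_le_of_lt h1 (lt_of_le_of_lt ?_ h2)
  nlinarith [norm_nonneg x]

/-- The exponential function as a continuous `𝔽`-linear map. -/
def exp [Finite 𝔽] : E.LiePts κ C →L[𝔽] E.Pts κ C where
  toLinearMap := (E.expLinear C : lie E.scheme C →ₗ[𝔽] points E.scheme C)
  cont := by
    change @Continuous (E.LiePts κ C) (E.Pts κ C) _ _ fun x => E.expLinear C x
    unfold expLinear
    split_ifs with h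
    · exact h.choose_spec.continuous E κ
    · exact continuous_const (y := (0 : E.Pts κ C))

variable [Finite 𝔽]

/-- The period lattice `Λ_E`, the kernel of the exponential function, as an `A`-module
via `∂φ`. -/
def lattice : Submodule A (E.LiePts κ C) where
  carrier := {x | E.exp κ C x = 0}
  add_mem' {x y} hx hy := by
    have hx' : E.exp κ C x = 0 := hx
    have hy' : E.exp κ C y = 0 := hy
    change E.exp κ C (x + y) = 0
    rw [map_add, hx', hy', add_zero]
  zero_mem' := map_zero (E.exp κ C)
  smul_mem' a x hx := by
    have hx' : E.exp κ C x = 0 := hx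
    have h : E.exp κ C (a • x) = a • E.exp κ C x := E.expLinear_equivariant C a x
    change E.exp κ C (a • x) = 0
    rw [h, hx', smul_zero]

/-- `E(𝕋)`, the completed tensor product of `A` and `E(C)`. Its scalar multiplication by `a` is
the action of `a ⊗ 1`. -/
abbrev PtsT : Type _ := HatTensor 𝔽 A (E.Pts κ C)

/-- `Lie_E(𝕋)`, the completed tensor product of `A` and `Lie_E(C)`. Its scalar multiplication by
`a` is the action of `a ⊗ 1`. -/
abbrev LieT : Type _ := HatTensor 𝔽 A (E.LiePts κ C)

/-- The action of `1 ⊗ a` on `E(𝕋)`. -/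
def rightAct (a : A) : E.PtsT κ C →L[A] E.PtsT κ C := hatMap A (E.act κ C a)

/-- The action of `1 ⊗ ∂a` on `Lie_E(𝕋)`. -/
def rightActLie (a : A) : E.LieT κ C →L[A] E.LieT κ C := hatMap A (E.actLie κ C a)

/-- The completed tensor product of the identity of `A` and `exp_E`. -/
def expT : E.LieT κ C →L[A] E.PtsT κ C := hatMap A (E.exp κ C)

/-- The `A`-module of special functions: the elements of `E(𝕋)` on which the two `A`-actions
coincide. -/
def specialFunctions : Submodule A (E.PtsT κ C) where
  carrier := {ω | ∀ a : A, a • ω = E.rightAct κ C a ω}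
  add_mem' {x y} hx hy a := by rw [smul_add, map_add, hx a, hy a]
  zero_mem' a := by rw [smul_zero, map_zero]
  smul_mem' c x hx a := by rw [map_smul, ← hx a, smul_comm]

/-- The canonical map `A ⊗ Λ_E → Lie_E(𝕋)`. -/
def latticeToLieT (x : A ⊗[𝔽] E.lattice κ C) : E.LieT κ C :=
  UniformSpace.Completion.coe' (α := GaussTensor 𝔽 A (E.LiePts κ C))
    (LinearMap.lTensor A ((E.lattice κ C).subtype.restrictScalars 𝔽) x)

/-- The canonical surjection from the tensor product over `𝔽` of `A` and `Λ_E` to the one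
over a subring, `a ⊗ x ↦ a ⊗ x`. -/
def relativeProj (S : Subalgebra 𝔽 A) :
    A ⊗[𝔽] E.lattice κ C →ₗ[A] A ⊗[S] E.lattice κ C :=
  TensorProduct.mapOfCompatibleSMul S 𝔽 A A (E.lattice κ C)

/-- The multiplication map `A ⊗ Λ_E → Λ_E` over `𝔽[u]`, `a ⊗ x ↦ ∂a (x)`. -/
def mulMap (S : Subalgebra 𝔽 A) : A ⊗[S] E.lattice κ C →ₗ[A] E.lattice κ C :=
  LinearMap.liftBaseChange A (LinearMap.id : E.lattice κ C →ₗ[S] E.lattice κ C)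

/-- The action of `1 ⊗ a` on the tensor product of `A` and `Λ_E` over a subring. -/
def rightActLattice (S : Subalgebra 𝔽 A) (a : A) :
    A ⊗[S] E.lattice κ C →ₗ[S] A ⊗[S] E.lattice κ C :=
  LinearMap.lTensor A ((LinearMap.lsmul A (E.lattice κ C) a).restrictScalars S)

/-- The elements of the tensor product of `A` and `Λ_E` over a subring on which the two
`A`-actions coincide. -/
def diagonalPart (S : Subalgebra 𝔽 A) : Set (A ⊗[S] E.lattice κ C) :=
  {x | ∀ a : A, a • x = E.rightActLattice κ C S a x}

end AndersonModule

end AndersonModules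

end

/-! The argument joins a snake lemma in non-archimedean analysis to trace duality.

An `𝔽`-basis of `A` identifies `A ⊗̂ V` isometrically with the null families in `V`, and `id ⊗̂ f`
acts coefficientwise (`norm_le_of_hatCoeff_le`, `exists_hatCoeff_eq`, `hatCoeff_hatMap`). As `u` has
a pole only at infinity, `A` is the integral closure of `𝔽[u]` in `K`, hence finite free, and has a
basis `u ^ n b_i` shifted by `u` (`exists_basis_shift`).

In characteristic `p` a power of `∂φ_u` is the scalar `ℓ(u) ^ k`, of absolute value above one. This
makes `D = 1 ⊗ ∂u - u ⊗ 1` invertible (`bijective_hatMap_sub_smul`) and produces the exponential: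
its coefficients solve a recursion, and compatibility with the rest of `A` follows from a rigidity
argument (`exists_isExponential`, `eq_zero_of_intertwines`). Near zero the exponential is a
norm-preserving bijection (`exists_exp_local`). So `Λ` is discrete and the kernel of `id ⊗̂ exp` is
exactly `A ⊗ Λ` (`exists_latticeToLieT_eq`).

Now `exp ∘ D⁻¹` kills `D (A ⊗ Λ)` and nothing else in `A ⊗ Λ`, so it is injective on `A ⊗ Λ` over
`𝔽[u]` (`deltaTilde_injective`). If the two actions of `u` agree on `ω`, its coefficients satisfy
`ω_n = u ^ m ω_(n+m)` with `ω_(n+m) → 0`. They lie in the image of `exp`, so `ω = exp y` with `D y ∈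
A ⊗ Λ` (`exists_deltaTilde_eq`). Hence `sf(E)` is the diagonal part of `A ⊗ Λ` over `𝔽[u]`.

For `S = 𝔽[u]`, contraction turns a diagonal `x ∈ A ⊗ M` into an `A`-linear map `Hom_S(A, S) → M`,
and multiplication is its value at the trace (`contraction_trace`). The trace form identifies
`Hom_S(A, S)` with the dual fractional ideal of `A`, the trace with `1`. For torsion-free `M`
multiplication is therefore injective on the diagonal part, with image the different times `M`
(`bijOn_liftBaseChange`). -/

set_option linter.unusedSectionVars false

noncomputable section

namespace AndersonModules

/-! ### Coordinates on completed tensor products -/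

/-- Scalars of `𝔽` do not increase the norm of `V`. -/
class NormSMulLE (𝔽 V : Type*) [SMul 𝔽 V] [Norm V] : Prop where
  norm_smul_le : ∀ (c : 𝔽) (v : V), ‖c • v‖ ≤ ‖v‖

section Coordinates

variable {𝔽 : Type w} {B : Type*} {V : Type*} [Field 𝔽] [CommRing B] [Algebra 𝔽 B]
  [SeminormedAddCommGroup V] [Module 𝔽 V] {J : Type*} (β : Module.Basis J 𝔽 B)

/-- The coefficient of `β j` of an element of `B ⊗ V`. -/
def tensorCoeff (j : J) : GaussTensor 𝔽 B V →+ V :=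
  ((TensorProduct.lid 𝔽 V).toLinearMap ∘ₗ LinearMap.rTensor V (β.coord j)).toAddMonoidHom

lemma tensorCoeff_tmul (j : J) (b : B) (v : V) :
    tensorCoeff β j (b ⊗ₜ[𝔽] v : B ⊗[𝔽] V) = β.coord j b • v := by
  change TensorProduct.lid 𝔽 V (LinearMap.rTensor V (β.coord j) (b ⊗ₜ v)) = _
  simp

lemma tensorCoeff_sum_tmul {n : ℕ} (j : J) (b : Fin n → B) (v : Fin n → V) :
    tensorCoeff β j (∑ i, b i ⊗ₜ[𝔽] v i : B ⊗[𝔽] V) = ∑ i, β.coord j (b i) • v i := by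
  refine (map_sum (tensorCoeff β j : B ⊗[𝔽] V →+ V) _ _).trans ?_
  exact Finset.sum_congr rfl fun i _ => tensorCoeff_tmul β j (b i) (v i)

lemma exists_finset_sum_tmul (x : GaussTensor 𝔽 B V) : ∃ s : Finset J,
    (∀ j ∉ s, tensorCoeff β j x = 0) ∧
      x = (∑ j ∈ s, β j ⊗ₜ[𝔽] tensorCoeff β j x : B ⊗[𝔽] V) := by
  classical
  have key : ∀ x : B ⊗[𝔽] V, ∃ f : J →₀ V, x = f.sum fun j v => β j ⊗ₜ[𝔽] v := by
    intro x
    induction x with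
    | zero => exact ⟨0, by simp⟩
    | tmul b v =>
      refine ⟨(β.repr b).mapRange (fun c => c • v) (zero_smul _ _), ?_⟩
      rw [Finsupp.sum_mapRange_index (by simp)]
      conv_lhs => rw [← β.linearCombination_repr b, Finsupp.linearCombination_apply, Finsupp.sum,
        TensorProduct.sum_tmul]
      simp [Finsupp.sum, TensorProduct.smul_tmul]
    | add x y hx hy =>
      obtain ⟨f, rfl⟩ := hx
      obtain ⟨g, rfl⟩ := hy
      refine ⟨f + g, ?_⟩
      rw [Finsupp.sum_add_index' (by simp) (by simp [TensorProduct.tmul_add])]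
  obtain ⟨f, hf⟩ := key x
  have hc : ∀ j, tensorCoeff β j x = f j := fun j => by
    have : tensorCoeff β j x = f.sum fun i v => tensorCoeff β j (β i ⊗ₜ[𝔽] v : B ⊗[𝔽] V) := by
      rw [hf]
      exact map_sum (tensorCoeff β j : B ⊗[𝔽] V →+ V) _ _
    rw [this, Finsupp.sum]
    simp only [tensorCoeff_tmul, Module.Basis.coord_apply, Module.Basis.repr_self]
    rw [Finset.sum_eq_single j]
    · simp
    · intro i _ hi
      rw [Finsupp.single_eq_of_ne' hi, zero_smul]
    · intro hj
      simp [Finsupp.notMem_support_iff.1 hj]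
  refine ⟨f.support, fun j hj => by rw [hc, Finsupp.notMem_support_iff.1 hj], ?_⟩
  conv_lhs => rw [hf]
  exact Finset.sum_congr rfl fun j _ => by rw [hc]

lemma norm_le_of_tensorCoeff_le {x : GaussTensor 𝔽 B V} {r : ℝ} (hr : 0 ≤ r)
    (h : ∀ j, ‖tensorCoeff β j x‖ ≤ r) : ‖x‖ ≤ r := by
  obtain ⟨s, -, hs⟩ := exists_finset_sum_tmul β x
  refine (gaussNorm_le (𝔽 := 𝔽) (x := x) (n := s.card) (fun i => β (s.equivFin.symm i))
    (fun i => tensorCoeff β (s.equivFin.symm i) x) ?_).trans ?_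
  · refine hs.trans ?_
    rw [← Finset.sum_coe_sort s]
    exact (Equiv.sum_comp s.equivFin.symm _).symm
  · exact (pi_norm_le_iff_of_nonneg hr).2 fun i => h _

lemma exists_norm_sub_coe_lt (x : HatTensor 𝔽 B V) {ε : ℝ} (hε : 0 < ε) :
    ∃ y : GaussTensor 𝔽 B V, ‖x - UniformSpace.Completion.coe' y‖ < ε := by
  obtain ⟨_, ⟨y, rfl⟩, hy⟩ := Metric.mem_closure_iff.1
    (UniformSpace.Completion.denseRange_coe x) ε hε
  exact ⟨y, by rwa [← dist_eq_norm]⟩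

variable {W : Type*} [SeminormedAddCommGroup W] [Module 𝔽 W]

lemma hatMap_coe (f : V →L[𝔽] W) (x : GaussTensor 𝔽 B V) :
    hatMap B f (x : HatTensor 𝔽 B V) = (GaussTensor.map B f x : GaussTensor 𝔽 B W) :=
  UniformSpace.Completion.map_coe (GaussTensor.map B f).uniformContinuous x

variable [IsUltrametricDist V] [NormSMulLE 𝔽 V]

/-- The ultrametric inequality bounds a coefficient by every representation. With
`norm_le_of_tensorCoeff_le`, the Gauss norm is the supremum of the coefficient norms in any basis.
-/
lemma norm_tensorCoeff_le (j : J) (x : GaussTensor 𝔽 B V) : ‖tensorCoeff β j x‖ ≤ ‖x‖ := by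
  refine le_of_forall_pos_le_add fun ε hε => ?_
  obtain ⟨n, b, v, hx, hv⟩ := exists_of_gaussNorm_lt (𝔽 := 𝔽) (B := B) (V := V) (x := x)
    (lt_add_of_pos_right _ hε)
  refine le_trans ?_ hv.le
  rw [hx, tensorCoeff_sum_tmul]
  refine IsUltrametricDist.norm_sum_le_of_forall_le_of_nonneg (norm_nonneg _) fun i _ => ?_
  exact (NormSMulLE.norm_smul_le _ _).trans (norm_le_pi_norm v i)

lemma continuous_tensorCoeff (j : J) : Continuous (tensorCoeff β j : GaussTensor 𝔽 B V →+ V) :=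
  AddMonoidHomClass.continuous_of_bound _ 1 fun x => by
    rw [one_mul]; exact norm_tensorCoeff_le β j x

variable [T0Space V] [CompleteSpace V]

/-- The coefficient of `β j` of an element of the completed tensor product. -/
def hatCoeff (j : J) : HatTensor 𝔽 B V →+ V :=
  (tensorCoeff β j).extension (continuous_tensorCoeff β j)

lemma hatCoeff_coe (j : J) (x : GaussTensor 𝔽 B V) :
    hatCoeff β j (x : HatTensor 𝔽 B V) = tensorCoeff β j x :=
  AddMonoidHom.extension_coe _ _ _

@[fun_prop]
lemma continuous_hatCoeff (j : J) : Continuous (hatCoeff β j : HatTensor 𝔽 B V →+ V) :=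
  AddMonoidHom.continuous_extension _ _

lemma norm_hatCoeff_le (j : J) (x : HatTensor 𝔽 B V) : ‖hatCoeff β j x‖ ≤ ‖x‖ := by
  induction x using UniformSpace.Completion.induction_on with
  | hp => exact isClosed_le (continuous_hatCoeff β j).norm continuous_norm
  | ih x => rw [hatCoeff_coe, UniformSpace.Completion.norm_coe]; exact norm_tensorCoeff_le β j x

/-- Follows from finite tensors by density. Coefficients therefore determine an element together
with its norm. -/
lemma norm_le_of_hatCoeff_le {x : HatTensor 𝔽 B V} {r : ℝ} (hr : 0 ≤ r)
    (h : ∀ j, ‖hatCoeff β j x‖ ≤ r) : ‖x‖ ≤ r := by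
  refine le_of_forall_pos_le_add fun ε hε => ?_
  obtain ⟨y, hy⟩ := exists_norm_sub_coe_lt x (half_pos hε)
  have hy' : ‖y‖ ≤ r + ε / 2 := norm_le_of_tensorCoeff_le β (by positivity) fun j => by
    rw [← hatCoeff_coe]
    have h1 : hatCoeff β j (y : HatTensor 𝔽 B V) = hatCoeff β j x - hatCoeff β j (x - UniformSpace.Completion.coe' y) := by
      rw [map_sub]; abel
    rw [h1]
    exact (norm_sub_le _ _).trans (add_le_add (h j) ((norm_hatCoeff_le β j _).trans hy.le))
  have h2 : x = (x - UniformSpace.Completion.coe' y) + UniformSpace.Completion.coe' y := by abel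
  rw [h2]
  refine (norm_add_le _ _).trans ?_
  rw [UniformSpace.Completion.norm_coe]
  linarith

lemma hatTensor_ext {x y : HatTensor 𝔽 B V} (h : ∀ j, hatCoeff β j x = hatCoeff β j y) :
    x = y := by
  rw [← sub_eq_zero, ← norm_le_zero_iff]
  exact norm_le_of_hatCoeff_le β le_rfl fun j => by rw [map_sub, h, sub_self, norm_zero]

/-- Outside the finite support of a nearby finite tensor, the coefficients are those of a small
difference. -/
lemma tendsto_hatCoeff (x : HatTensor 𝔽 B V) :
    Filter.Tendsto (fun j => hatCoeff β j x) Filter.cofinite (nhds 0) := by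
  rw [Metric.tendsto_nhds]
  intro ε hε
  obtain ⟨y, hy⟩ := exists_norm_sub_coe_lt x hε
  obtain ⟨s, hs, -⟩ := exists_finset_sum_tmul β y
  refine (Set.Finite.subset s.finite_toSet fun j hj => ?_ :
    {j | ¬ dist (hatCoeff β j x) 0 < ε}.Finite)
  by_contra hjs
  refine hj ?_
  rw [dist_zero_right]
  have h1 : hatCoeff β j x = hatCoeff β j (x - UniformSpace.Completion.coe' y) := by
    rw [map_sub, hatCoeff_coe, hs j hjs, sub_zero]
  rw [h1]
  exact (norm_hatCoeff_le β j _).trans_lt hy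

/-- Every null family of vectors is the family of coefficients of an element. -/
lemma exists_hatCoeff_eq {f : J → V} (hf : Filter.Tendsto f Filter.cofinite (nhds 0)) :
    ∃ x : HatTensor 𝔽 B V, ∀ j, hatCoeff β j x = f j := by
  classical
  let g : J → HatTensor 𝔽 B V := fun j =>
    UniformSpace.Completion.coe' (α := GaussTensor 𝔽 B V) (β j ⊗ₜ[𝔽] f j : B ⊗[𝔽] V)
  have hg : ∀ i j, hatCoeff β i (g j) = if i = j then f j else 0 := fun i j => by
    refine (hatCoeff_coe β i _).trans ((tensorCoeff_tmul β i (β j) (f j)).trans ?_)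
    rw [Module.Basis.coord_apply, Module.Basis.repr_self]
    by_cases hij : i = j
    · simp [hij]
    · rw [Finsupp.single_eq_of_ne hij, zero_smul, if_neg hij]
  have hcoef : ∀ i (s : Finset J), hatCoeff β i (∑ j ∈ s, g j) = if i ∈ s then f i else 0 :=
    fun i s => by simp [map_sum, hg]
  -- Finite subsums far out are small because the norm is a supremum over coefficients, not a sum.
  have hsum : Summable g := by
    rw [summable_iff_vanishing_norm]
    intro ε hε
    have hfin := (Metric.tendsto_nhds.1 hf (ε / 2) (half_pos hε))
    have hfin' : {j | ¬ dist (f j) 0 < ε / 2}.Finite := hfin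
    refine ⟨hfin'.toFinset, fun t ht => ?_⟩
    refine lt_of_le_of_lt (norm_le_of_hatCoeff_le β (half_pos hε).le fun j => ?_) (half_lt_self hε)
    rw [hcoef]
    split_ifs with hj
    · by_contra hlt
      refine Finset.disjoint_left.1 ht hj (hfin'.mem_toFinset.2 fun hlt' => hlt ?_)
      rw [dist_zero_right] at hlt'
      exact hlt'.le
    · rw [norm_zero]; exact (half_pos hε).le
  refine ⟨∑' j, g j, fun i => ?_⟩
  have h1 : HasSum (fun j => hatCoeff β i (g j)) (hatCoeff β i (∑' j, g j)) :=
    hsum.hasSum.map (hatCoeff β i) (continuous_hatCoeff β i)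
  refine h1.unique ?_
  simp only [hg]
  simpa using hasSum_single (f := fun j => if i = j then f j else 0) i (fun j hj => if_neg hj.symm)

variable [IsUltrametricDist W]
  [NormSMulLE 𝔽 W] [T0Space W] [CompleteSpace W]

/-- True on pure tensors by `𝔽`-linearity of `f`, in general by continuity. It reduces questions
about `expT` to `exp`, one coefficient at a time. -/
lemma hatCoeff_hatMap (f : V →L[𝔽] W) (j : J) (x : HatTensor 𝔽 B V) :
    hatCoeff β j (hatMap B f x) = f (hatCoeff β j x) := by
  induction x using UniformSpace.Completion.induction_on with
  | hp => exact isClosed_eq (by fun_prop) (by fun_prop)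
  | ih x =>
    rw [hatMap_coe, hatCoeff_coe, hatCoeff_coe]
    induction x using TensorProduct.induction_on with
    | zero =>
      have h1 : tensorCoeff β j (0 : B ⊗[𝔽] V) = 0 := map_zero (tensorCoeff β j)
      have h2 : GaussTensor.map B f (0 : B ⊗[𝔽] V) = 0 := map_zero (GaussTensor.map B f)
      rw [h1, h2, map_zero, map_zero]
    | tmul b v =>
      have h2 : GaussTensor.map B f (b ⊗ₜ[𝔽] v : B ⊗[𝔽] V) = (b ⊗ₜ[𝔽] f v : B ⊗[𝔽] W) :=
        LinearMap.baseChange_tmul _ _ _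
      rw [h2, tensorCoeff_tmul, tensorCoeff_tmul, map_smul]
    | add x y hx hy =>
      have h1 : tensorCoeff β j (x + y : B ⊗[𝔽] V) = tensorCoeff β j x + tensorCoeff β j y :=
        map_add (tensorCoeff β j) _ _
      have h2 : GaussTensor.map B f (x + y : B ⊗[𝔽] V) =
        GaussTensor.map B f x + GaussTensor.map B f y := map_add (GaussTensor.map B f) _ _
      rw [h1, h2, map_add, hx, hy, map_add]

end Coordinates

/-! ### Morphisms between powers of the additive group -/

/-- Lucas' congruence, `e` times: both numbers end in the base `p` digit zero, which may be dropped.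
-/
lemma choose_prime_pow_mul_modEq {p : ℕ} [Fact p.Prime] (e a b : ℕ) :
    (p ^ e * a).choose (p ^ e * b) ≡ a.choose b [MOD p] := by
  have hp : 0 < p := (Fact.out : p.Prime).pos
  induction e with
  | zero => simp [Nat.ModEq.refl]
  | succ e ih =>
    have h := Choose.choose_modEq_choose_mod_mul_choose_div_nat (p := p)
      (n := p ^ (e + 1) * a) (k := p ^ (e + 1) * b)
    have h1 : ∀ c, p ^ (e + 1) * c = p * (p ^ e * c) := fun c => by ring
    rw [h1, h1, Nat.mul_mod_right, Nat.mul_mod_right, Nat.choose_self, one_mul,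
      Nat.mul_div_cancel_left _ hp, Nat.mul_div_cancel_left _ hp] at h
    rw [h1, h1]
    exact h.trans ih

/-- If all inner binomial coefficients of `m` vanish modulo `p`, then `m` is a power of `p`. -/
lemma exists_eq_prime_pow_of_dvd_choose {p m : ℕ} (hp : p.Prime) (hm : m ≠ 0)
    (h : ∀ k, 0 < k → k < m → p ∣ m.choose k) : ∃ e, m = p ^ e := by
  have := Fact.mk hp
  obtain ⟨e, m', hm', rfl⟩ := Nat.exists_eq_pow_mul_and_not_dvd hm p hp.ne_one
  refine ⟨e, ?_⟩
  have hpe : 0 < p ^ e := pow_pos hp.pos e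
  by_contra hne
  have hm0 : m' ≠ 0 := by rintro rfl; simp at hm'
  have hm1 : m' ≠ 1 := by rintro rfl; simp at hne
  -- The inner coefficient at `p ^ e` is congruent to `m'`, which is prime to `p`.
  have h1 := h (p ^ e) hpe (by nlinarith [show 2 ≤ m' by omega])
  have h2 := choose_prime_pow_mul_modEq (p := p) e m' 1
  rw [mul_one, Nat.choose_one_right] at h2
  exact hm' ((Nat.modEq_zero_iff_dvd).1 (h2.symm.trans ((Nat.modEq_zero_iff_dvd).2 h1)))

/-- If `x ^ p ^ k = x` on a finite field of characteristic `p`, then `p ^ k` is a power of its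
cardinality. -/
lemma exists_prime_pow_eq_card_pow (𝔽 : Type*) [Field 𝔽] [Finite 𝔽] (p : ℕ) [CharP 𝔽 p]
    (hp : p.Prime) (k : ℕ) (h : ∀ c : 𝔽, c ^ p ^ k = c) : ∃ n, p ^ k = Nat.card 𝔽 ^ n := by
  classical
  have := Fintype.ofFinite 𝔽
  obtain ⟨f, -, hf⟩ := FiniteField.card 𝔽 p
  have hq : Fintype.card 𝔽 = p ^ (f : ℕ) := hf
  rw [Nat.card_eq_fintype_card]
  refine ⟨k / f, ?_⟩
  -- The `q`-power map is trivial on `𝔽`, so only `k % f` matters. If that were nonzero, a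
  -- polynomial of degree less than `q` would vanish on all of `𝔽`.
  have hr : ∀ c : 𝔽, c ^ p ^ (k % f) = c := fun c => by
    have h1 := h c
    rwa [← Nat.div_add_mod k f, pow_add, pow_mul p f, ← hq, pow_mul c,
      FiniteField.pow_card_pow] at h1
  by_cases hk : k % f = 0
  · rw [hq, ← pow_mul, ← Nat.div_add_mod k f, hk]
    simp
  · exfalso
    have hp1 : 1 < p := hp.one_lt
    have hne := FiniteField.X_pow_card_pow_sub_X_ne_zero 𝔽 hk hp1
    have hdeg := FiniteField.X_pow_card_pow_sub_X_natDegree_eq 𝔽 hk hp1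
    have h1 : Fintype.card 𝔽 ≤ p ^ (k % f) := by
      rw [← hdeg, ← Finset.card_univ]
      refine Polynomial.card_le_degree_of_subset_roots fun c _ => ?_
      rw [Polynomial.mem_roots hne]
      simp [Polynomial.IsRoot, hr c]
    rw [hq] at h1
    exact absurd (Nat.mod_lt k f.pos) (not_lt.2 ((Nat.pow_le_pow_iff_right hp1).1 h1))

/-- Only exponents that are powers of the cardinality of `𝔽` occur in an `𝔽`-linear polynomial. -/
lemma exists_eq_card_pow_of_coeff_ne_zero {𝔽 L : Type*} [Field 𝔽] [Finite 𝔽] [Field L]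
    [Algebra 𝔽 L] {p : Polynomial L}
    (hadd : Polynomial.aeval (Polynomial.X + Polynomial.C Polynomial.X :
        Polynomial (Polynomial L)) p =
      Polynomial.aeval (Polynomial.X : Polynomial (Polynomial L)) p +
        Polynomial.aeval (Polynomial.C Polynomial.X : Polynomial (Polynomial L)) p)
    (hsmul : ∀ c : 𝔽, Polynomial.aeval
      (Polynomial.C (algebraMap 𝔽 L c) * Polynomial.X : Polynomial L) p =
        Polynomial.C (algebraMap 𝔽 L c) * p)
    {m : ℕ} (hm : p.coeff m ≠ 0) : ∃ n, m = Nat.card 𝔽 ^ n := by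
  obtain ⟨r, hr⟩ := CharP.exists 𝔽
  have hrp : r.Prime := CharP.char_is_prime 𝔽 r
  have hL : CharP L r := charP_of_injective_algebraMap (algebraMap 𝔽 L).injective r
  -- Comparison of the coefficients of `X ^ m` in `p(cX) = c p(X)`.
  have hsm : ∀ c : 𝔽, algebraMap 𝔽 L c ^ m = algebraMap 𝔽 L c := fun c => by
    have h := congrArg (fun q => Polynomial.coeff q m) (hsmul c)
    have h1 : Polynomial.aeval (Polynomial.C (algebraMap 𝔽 L c) * Polynomial.X : Polynomial L) p =
        p.comp (Polynomial.C (algebraMap 𝔽 L c) * Polynomial.X) := by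
      rw [Polynomial.comp, Polynomial.aeval_def]
      rfl
    simp only [h1, Polynomial.comp_C_mul_X_coeff, Polynomial.coeff_C_mul] at h
    rw [mul_comm] at h
    exact mul_right_cancel₀ hm h
  have hm0 : m ≠ 0 := by
    rintro rfl
    have := hsm 0
    simp at this
  have hch : ∀ k, 0 < k → k < m → r ∣ m.choose k := fun k hk hkm => by
    -- The coefficient at bidegree `(k, m - k)` of `p(X + Y) = p(X) + p(Y)`: zero on the right,
    -- `m.choose k` times `p.coeff m` on the left, read off from a Hasse derivative.
    have h := congrArg (fun q => (Polynomial.coeff q k).coeff (m - k)) hadd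
    have h1 : Polynomial.aeval (Polynomial.X + Polynomial.C Polynomial.X :
        Polynomial (Polynomial L)) p = Polynomial.taylor Polynomial.X (p.map Polynomial.C) := by
      rw [Polynomial.taylor_apply, Polynomial.comp, Polynomial.eval₂_map]
      rfl
    have h2 : Polynomial.aeval (Polynomial.X : Polynomial (Polynomial L)) p =
        p.map Polynomial.C := by
      rw [Polynomial.map, Polynomial.aeval_def]
      rfl
    have h3 : Polynomial.aeval (Polynomial.C Polynomial.X : Polynomial (Polynomial L)) p =
        Polynomial.C p := by
      have := Polynomial.aeval_algHom_apply (Polynomial.CAlgHom (R := L) (A := Polynomial L))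
        Polynomial.X p
      rw [Polynomial.aeval_X_left_apply] at this
      exact this
    have h4 : Polynomial.hasseDeriv k (p.map (Polynomial.C : L →+* Polynomial L)) =
        (Polynomial.hasseDeriv k p).map Polynomial.C := by
      ext n
      simp [Polynomial.hasseDeriv_coeff]
    have h5 : ∀ q : Polynomial L, (q.map Polynomial.C).eval Polynomial.X = q := fun q => by
      rw [Polynomial.eval_map]
      exact Polynomial.eval₂_C_X
    simp only [h1, h2, h3, Polynomial.taylor_coeff, h4, h5, Polynomial.coeff_add,
      Polynomial.hasseDeriv_coeff, Polynomial.coeff_map, Polynomial.coeff_C,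
      Nat.sub_add_cancel hkm.le] at h
    rw [if_neg (by omega), if_neg (by omega), Polynomial.coeff_zero, add_zero] at h
    have h6 := (mul_eq_zero.1 h).resolve_right hm
    exact (CharP.cast_eq_zero_iff L r _).1 h6
  obtain ⟨e, rfl⟩ := exists_eq_prime_pow_of_dvd_choose hrp hm0 hch
  refine exists_prime_pow_eq_card_pow 𝔽 r hrp e fun c => (algebraMap 𝔽 L).injective ?_
  rw [map_pow, hsm]


/-! ### Yoneda: morphisms as polynomials in Frobenius -/

section Morphisms

variable {𝔽 : Type w} {L : Type u} [Field 𝔽] [Field L] [Algebra 𝔽 L] {d : ℕ}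

lemma pointsMap_comp_algHom (f : gaPow.{w, u} 𝔽 L d ⟶ gaPow.{w, u} 𝔽 L d) {R S : Type u}
    [CommRing R] [CommRing S] [Algebra L R] [Algebra L S] (g : R →ₐ[L] S) (x : Fin d → R)
    (i : Fin d) :
    (pointsMap f S (fun j => g (x j) : Fin d → S) : Fin d → S) i =
      g ((pointsMap f R x : Fin d → R) i) :=
  congrArg (fun h => (h.hom x : Fin d → S) i) (f.naturality (CommAlgCat.ofHom g))

lemma pointsMap_mul (f : gaPow.{w, u} 𝔽 L d ⟶ gaPow.{w, u} 𝔽 L d) {R : Type u} [CommRing R]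
    [Algebra L R] (c : 𝔽) (x : Fin d → R) (i : Fin d) :
    (pointsMap f R (fun j => algebraMap L R (algebraMap 𝔽 L c) * x j : Fin d → R) :
      Fin d → R) i = algebraMap L R (algebraMap 𝔽 L c) * (pointsMap f R x : Fin d → R) i := by
  have h := congrFun (map_smul (pointsMap f R) c (show points (gaPow.{w, u} 𝔽 L d) R from x)) i
  rw [← Algebra.smul_def]
  refine Eq.trans ?_ h
  refine congrArg (fun y => (pointsMap f R y : Fin d → R) i) ?_
  funext j
  exact (Algebra.smul_def _ _).symm

lemma coords_bijective {E : VectorFunctor.{w, u} 𝔽 L} (κ : E ≅ gaPow 𝔽 L d) (R : Type u)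
    [CommRing R] [Algebra L R] : Function.Bijective (coords κ R) := by
  refine ⟨fun x y h => ?_, fun y => ⟨pointsMap κ.inv R y, ?_⟩⟩
  · have h1 : ∀ z : points E R, pointsMap κ.inv R (pointsMap κ.hom R z) = z := fun z =>
      congrArg (fun g : E ⟶ E => pointsMap g R z) κ.hom_inv_id
    rw [← h1 x, ← h1 y]
    exact congrArg (pointsMap κ.inv R) h
  · exact congrArg (fun g : gaPow.{w, u} 𝔽 L d ⟶ gaPow.{w, u} 𝔽 L d => pointsMap g R y)
      κ.inv_hom_id

lemma lieCoords_lieScale {E : VectorFunctor.{w, u} 𝔽 L} (κ : E ≅ gaPow 𝔽 L d)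
    {R : Type u} [CommRing R] [Algebra L R] (c : R) (x : lie E R) :
    lieCoords κ R (lieScale E c x) = c • lieCoords κ R x := by
  funext i
  have h := congrArg (fun g => (g.hom (x : points E (DualNumber R)) : Fin d → DualNumber R) i)
    (κ.hom.naturality (CommAlgCat.ofHom (dualScale L c)))
  refine (congrArg TrivSqZeroExt.snd h).trans ?_
  change (dualScale L c (coords κ (DualNumber R) (x : points E (DualNumber R)) i)).snd = _
  rw [coords_lie]
  simp [dualScale, mul_comm]

lemma lieCoords_injective {E : VectorFunctor.{w, u} 𝔽 L} (κ : E ≅ gaPow 𝔽 L d)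
    {R : Type u} [CommRing R] [Algebra L R] : Function.Injective (lieCoords κ R) := by
  intro x y h
  refine Subtype.ext ((coords_bijective κ (DualNumber R)).1 ?_)
  rw [coords_lie, coords_lie, h]

/-- The univariate polynomials describing a morphism between powers of the additive group. -/
def entryPoly (f : gaPow.{w, u} 𝔽 L d ⟶ gaPow.{w, u} 𝔽 L d) (i j : Fin d) : Polynomial L :=
  (pointsMap f (Polynomial L) (Pi.single j Polynomial.X : Fin d → Polynomial L) :
    Fin d → Polynomial L) i

/-- Yoneda: the point with entry `r` at `j` is the image of the universal one under `X ↦ r`. -/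
lemma pointsMap_single (f : gaPow.{w, u} 𝔽 L d ⟶ gaPow.{w, u} 𝔽 L d) {R : Type u}
    [CommRing R] [Algebra L R] (i j : Fin d) (r : R) :
    (pointsMap f R (Pi.single j r : Fin d → R) : Fin d → R) i =
      Polynomial.aeval r (entryPoly f i j) := by
  rw [entryPoly, ← pointsMap_comp_algHom]
  have h : (Pi.single j r : Fin d → R) = fun k =>
      Polynomial.aeval r ((Pi.single j Polynomial.X : Fin d → Polynomial L) k) := by
    funext k
    by_cases hk : k = j
    · subst hk; simp
    · simp [hk]
  rw [← h]

/-- The matrix of coefficients of the `n`-th power of Frobenius in a morphism between powers of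
the additive group. -/
def coeffMatrix (f : gaPow.{w, u} 𝔽 L d ⟶ gaPow.{w, u} 𝔽 L d) (n : ℕ) :
    Matrix (Fin d) (Fin d) L :=
  Matrix.of fun i j => (entryPoly f i j).coeff (Nat.card 𝔽 ^ n)

/-- A bound for the exponents of Frobenius occurring in a morphism. -/
def frobBound (f : gaPow.{w, u} 𝔽 L d ⟶ gaPow.{w, u} 𝔽 L d) : ℕ :=
  1 + Finset.univ.sup fun i => Finset.univ.sup fun j => (entryPoly f i j).natDegree

lemma natDegree_entryPoly_lt (f : gaPow.{w, u} 𝔽 L d ⟶ gaPow.{w, u} 𝔽 L d) (i j : Fin d) :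
    (entryPoly f i j).natDegree < frobBound f := by
  have h : (entryPoly f i j).natDegree ≤ Finset.univ.sup fun i => Finset.univ.sup
      fun j => (entryPoly f i j).natDegree :=
    (Finset.le_sup (f := fun j => (entryPoly f i j).natDegree) (Finset.mem_univ j)).trans
      (Finset.le_sup (f := fun i => Finset.univ.sup
        fun j => (entryPoly f i j).natDegree) (Finset.mem_univ i))
  rw [frobBound]
  omega

variable [Finite 𝔽]

/-- Additivity on points over `L[X][Y]` and `𝔽`-linearity over `L[X]` are polynomial identities for
the entry, and they exclude all exponents that are not powers of `q`. -/
lemma aeval_entryPoly (f : gaPow.{w, u} 𝔽 L d ⟶ gaPow.{w, u} 𝔽 L d) {R : Type u}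
    [CommRing R] [Algebra L R] (i j : Fin d) (r : R) :
    Polynomial.aeval r (entryPoly f i j) = ∑ n ∈ Finset.range (frobBound f),
      algebraMap L R (coeffMatrix f n i j) * r ^ Nat.card 𝔽 ^ n := by
  have hq : 1 < Nat.card 𝔽 := Finite.one_lt_card
  have hexp : ∀ m, (entryPoly f i j).coeff m ≠ 0 → ∃ n, m = Nat.card 𝔽 ^ n := by
    intro m hm
    refine exists_eq_card_pow_of_coeff_ne_zero (𝔽 := 𝔽) ?_ (fun c => ?_) hm
    · rw [← pointsMap_single, ← pointsMap_single, ← pointsMap_single, Pi.single_add]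
      exact congrFun (map_add (pointsMap f _) _ _) i
    · rw [← pointsMap_single]
      have h := pointsMap_mul f c (Pi.single j Polynomial.X : Fin d → Polynomial L) i
      have h1 : (fun k => algebraMap L (Polynomial L) (algebraMap 𝔽 L c) *
          (Pi.single j Polynomial.X : Fin d → Polynomial L) k) =
          Pi.single j (Polynomial.C (algebraMap 𝔽 L c) * Polynomial.X) := by
        funext k
        by_cases hk : k = j
        · subst hk; simp
        · simp [hk]
      rw [h1] at h
      exact h
  have hp : entryPoly f i j = ∑ n ∈ Finset.range (frobBound f),
      Polynomial.C (coeffMatrix f n i j) * Polynomial.X ^ Nat.card 𝔽 ^ n := by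
    ext m
    rw [Polynomial.finsetSum_coeff]
    simp only [Polynomial.coeff_C_mul_X_pow, coeffMatrix, Matrix.of_apply]
    by_cases hm : (entryPoly f i j).coeff m = 0
    · rw [hm, Finset.sum_eq_zero]
      intro n _
      split_ifs with h
      · rw [← h, hm]
      · rfl
    · obtain ⟨n, rfl⟩ := hexp m hm
      rw [Finset.sum_eq_single n, if_pos rfl]
      · intro k _ hk
        rw [if_neg fun h => hk (Nat.pow_right_injective hq h.symm)]
      · intro hn
        refine absurd (Finset.mem_range.2 ?_) hn
        -- The degree bounds `q ^ n`, hence also `n`.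
        have h1 : n < Nat.card 𝔽 ^ n := Nat.lt_pow_self hq
        have h2 := Polynomial.le_natDegree_of_ne_zero hm
        have h3 := natDegree_entryPoly_lt f i j
        omega
  conv_lhs => rw [hp]
  simp

/-- A morphism between powers of the additive group is a polynomial in Frobenius with matrix
coefficients. -/
lemma pointsMap_eq_sum (f : gaPow.{w, u} 𝔽 L d ⟶ gaPow.{w, u} 𝔽 L d) {R : Type u}
    [CommRing R] [Algebra L R] (x : Fin d → R) :
    (pointsMap f R x : Fin d → R) = ∑ n ∈ Finset.range (frobBound f),
      ((coeffMatrix f n).map (algebraMap L R)).mulVec fun i => x i ^ Nat.card 𝔽 ^ n := by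
  let F : (Fin d → R) →+ (Fin d → R) :=
    { toFun := fun x => pointsMap f R x
      map_zero' := map_zero (pointsMap f R)
      map_add' := map_add (pointsMap f R) }
  have h2 : ∀ i j (r : R), F (Pi.single j r) i = ∑ n ∈ Finset.range (frobBound f),
      algebraMap L R (coeffMatrix f n i j) * r ^ Nat.card 𝔽 ^ n := fun i j r =>
    (pointsMap_single f i j r).trans (aeval_entryPoly f i j r)
  change F x = _
  conv_lhs => rw [← Finset.univ_sum_single x, map_sum]
  funext i
  simp only [Finset.sum_apply, Matrix.mulVec, dotProduct, Matrix.map_apply, h2]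
  exact Finset.sum_comm

lemma coeffMatrix_eq_zero (f : gaPow.{w, u} 𝔽 L d ⟶ gaPow.{w, u} 𝔽 L d) (n : ℕ)
    (hn : frobBound f ≤ n) : coeffMatrix f n = 0 := by
  ext i j
  refine Polynomial.coeff_eq_zero_of_natDegree_lt ?_
  have h1 : n < Nat.card 𝔽 ^ n := Nat.lt_pow_self Finite.one_lt_card
  exact (natDegree_entryPoly_lt f i j).trans (hn.trans_lt h1)

variable {E : VectorFunctor.{w, u} 𝔽 L} {R : Type u} [CommRing R] [Algebra L R]

/-- Source and target coordinates may differ, so that the identity morphism describes a change of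
coordinates. -/
lemma coords_pointsMap_eq_sum (κ κ' : E ≅ gaPow 𝔽 L d) (f : E ⟶ E) (x : points E R) :
    coords κ' R (pointsMap f R x) =
      ∑ n ∈ Finset.range (frobBound (κ.inv ≫ f ≫ κ'.hom)),
        ((coeffMatrix (κ.inv ≫ f ≫ κ'.hom) n).map (algebraMap L R)).mulVec
          fun i => coords κ R x i ^ Nat.card 𝔽 ^ n := by
  rw [← pointsMap_eq_sum]
  have h : κ.hom ≫ κ.inv ≫ f ≫ κ'.hom = f ≫ κ'.hom := by simp
  exact congrArg (fun g : E ⟶ gaPow 𝔽 L d => (pointsMap g R x : Fin d → R)) h.symm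

/-- Frobenius kills tangent vectors because `ε ^ 2 = 0`, so only the constant term of the polynomial
survives. -/
lemma lieCoords_lieMap (κ κ' : E ≅ gaPow 𝔽 L d) (f : E ⟶ E) (x : lie E R) :
    lieCoords κ' R (lieMap f R x) =
      ((coeffMatrix (κ.inv ≫ f ≫ κ'.hom) 0).map (algebraMap L R)).mulVec (lieCoords κ R x) := by
  have hq : 1 < Nat.card 𝔽 := Finite.one_lt_card
  have h := coords_pointsMap_eq_sum κ κ' f (x : points E (DualNumber R))
  rw [coords_lie] at h
  have h0 : ∀ n ≠ 0, (fun i => (TrivSqZeroExt.inr (lieCoords κ R x i) : DualNumber R) ^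
      Nat.card 𝔽 ^ n) = 0 := fun n hn => by
    funext i
    obtain ⟨k, hk⟩ := Nat.exists_eq_add_of_le (Nat.one_lt_pow hn hq)
    rw [hk, pow_add, pow_succ, pow_one, TrivSqZeroExt.inr_mul_inr, zero_mul]
    rfl
  rw [Finset.sum_eq_single_of_mem 0 (Finset.mem_range.2 (by rw [frobBound]; omega))
    (fun n _ hn => by rw [h0 n hn, Matrix.mulVec_zero])] at h
  funext i
  refine (congrArg TrivSqZeroExt.snd (congrFun h i)).trans ?_
  simp only [Matrix.mulVec, dotProduct, pow_zero, pow_one, TrivSqZeroExt.snd_sum]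
  refine Finset.sum_congr rfl fun j _ => ?_
  simp [TrivSqZeroExt.algebraMap_eq_inl', mul_comm]

end Morphisms

/-! ### Series in Frobenius with matrix coefficients -/

/-- The iterated `q`-power Frobenius of an `𝔽`-algebra. -/
def frobAlgHom (𝔽 R : Type*) [Field 𝔽] [Finite 𝔽] [CommRing R] [Algebra 𝔽 R] (n : ℕ) :
    R →ₐ[𝔽] R :=
  letI := Fintype.ofFinite 𝔽
  FiniteField.frobeniusAlgHom 𝔽 R ^ n

lemma frobAlgHom_apply (𝔽 : Type*) {R : Type*} [Field 𝔽] [Finite 𝔽] [CommRing R] [Algebra 𝔽 R]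
    (n : ℕ) (x : R) : frobAlgHom 𝔽 R n x = x ^ Nat.card 𝔽 ^ n := by
  let := Fintype.ofFinite 𝔽
  rw [frobAlgHom, AlgHom.coe_pow, FiniteField.coe_frobeniusAlgHom, pow_iterate,
    Nat.card_eq_fintype_card]

/-- The higher power dominates. These are the denominators of the exponential coefficients, which
are thus nonzero and of norm above one. -/
lemma norm_pow_card_sub {𝔽 C : Type*} [Field 𝔽] [Finite 𝔽] [NormedField C]
    [IsUltrametricDist C] {ϑ : C} (hϑ : 1 < ‖ϑ‖) (n : ℕ) :
    ‖ϑ ^ Nat.card 𝔽 ^ (n + 1) - ϑ‖ = ‖ϑ‖ ^ Nat.card 𝔽 ^ (n + 1) := by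
  have hq1 : 1 < Nat.card 𝔽 := Finite.one_lt_card
  have h1 : ‖ϑ‖ < ‖ϑ ^ Nat.card 𝔽 ^ (n + 1)‖ := by
    rw [norm_pow]
    exact lt_self_pow₀ hϑ (Nat.one_lt_pow (by omega) hq1)
  rw [← norm_pow, sub_eq_add_neg, IsUltrametricDist.norm_add_eq_max_of_norm_ne_norm
    (by rw [norm_neg]; exact h1.ne'), norm_neg, max_eq_left h1.le]

section Frobenius

variable (𝔽 : Type*) {C : Type*} [Field 𝔽] [Finite 𝔽] [NormedField C] [Algebra 𝔽 C] {d : ℕ}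

/-- The iterated Frobenius on vectors. -/
def frob (n : ℕ) : (Fin d → C) →+ (Fin d → C) where
  toFun x i := x i ^ Nat.card 𝔽 ^ n
  map_zero' := by funext i; simp [← frobAlgHom_apply]
  map_add' x y := by funext i; simp [← frobAlgHom_apply]

lemma frob_apply (n : ℕ) (x : Fin d → C) (i : Fin d) : frob 𝔽 n x i = x i ^ Nat.card 𝔽 ^ n := rfl

lemma frob_zero (x : Fin d → C) : frob 𝔽 0 x = x := by
  funext i; simp [frob_apply]

lemma continuous_frob (n : ℕ) : Continuous (frob 𝔽 n : (Fin d → C) →+ (Fin d → C)) :=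
  continuous_pi fun i => (continuous_apply i).pow _

lemma norm_frob_le (n : ℕ) (x : Fin d → C) : ‖frob 𝔽 n x‖ ≤ ‖x‖ ^ Nat.card 𝔽 ^ n :=
  (pi_norm_le_iff_of_nonneg (by positivity)).2 fun i => by
    rw [frob_apply, norm_pow]
    exact pow_le_pow_left₀ (norm_nonneg _) (norm_le_pi_norm x i) _

lemma frob_smul (n : ℕ) (c : C) (x : Fin d → C) :
    frob 𝔽 n (c • x) = c ^ Nat.card 𝔽 ^ n • frob 𝔽 n x := by
  funext i
  simp [frob_apply, mul_pow]

/-- Frobenius is a ring homomorphism, so passing it across a matrix twists the entries; this is the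
twist in `frobConv`. -/
lemma frob_mulVec (n m : ℕ) (e : Matrix (Fin d) (Fin d) C) (x : Fin d → C) :
    frob 𝔽 n (e.mulVec (frob 𝔽 m x)) =
      (e.map (· ^ Nat.card 𝔽 ^ n)).mulVec (frob 𝔽 (m + n) x) := by
  funext i
  rw [frob_apply, ← frobAlgHom_apply]
  simp only [Matrix.mulVec, dotProduct, map_sum, map_mul, Matrix.map_apply, frob_apply,
    frobAlgHom_apply, ← pow_mul, pow_add]

variable {𝔽}

lemma norm_matrix_mul_le [IsUltrametricDist C] {M N : Matrix (Fin d) (Fin d) C} {a b : ℝ}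
    (hM : ∀ i j, ‖M i j‖ ≤ a) (hN : ∀ i j, ‖N i j‖ ≤ b) (i j : Fin d) :
    ‖(M * N) i j‖ ≤ a * b := by
  have ha : 0 ≤ a := (norm_nonneg _).trans (hM i i)
  have hb : 0 ≤ b := (norm_nonneg _).trans (hN i i)
  rw [Matrix.mul_apply]
  refine IsUltrametricDist.norm_sum_le_of_forall_le_of_nonneg (by positivity) fun k _ => ?_
  rw [norm_mul]
  exact mul_le_mul (hM i k) (hN k j) (norm_nonneg _) ha

lemma norm_mulVec_le [IsUltrametricDist C] {M : Matrix (Fin d) (Fin d) C} {a : ℝ} (ha : 0 ≤ a)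
    (hM : ∀ i j, ‖M i j‖ ≤ a) (x : Fin d → C) : ‖M.mulVec x‖ ≤ a * ‖x‖ := by
  refine (pi_norm_le_iff_of_nonneg (by positivity)).2 fun i => ?_
  simp only [Matrix.mulVec, dotProduct]
  refine IsUltrametricDist.norm_sum_le_of_forall_le_of_nonneg (by positivity) fun k _ => ?_
  rw [norm_mul]
  exact mul_le_mul (hM i k) (norm_le_pi_norm x k) (norm_nonneg _) ha

lemma exists_norm_entry_le (M : Matrix (Fin d) (Fin d) C) : ∃ a : ℝ, 0 ≤ a ∧
    ∀ i j, ‖M i j‖ ≤ a :=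
  ⟨∑ i, ∑ j, ‖M i j‖, by positivity, fun i j =>
    (Finset.single_le_sum (f := fun j => ‖M i j‖) (fun _ _ => norm_nonneg _)
      (Finset.mem_univ j)).trans (Finset.single_le_sum (f := fun i => ∑ j, ‖M i j‖)
        (fun _ _ => by positivity) (Finset.mem_univ i))⟩

lemma continuous_mulVec_const (M : Matrix (Fin d) (Fin d) C) :
    Continuous fun x : Fin d → C => M.mulVec x :=
  Continuous.matrix_mulVec continuous_const continuous_id

/-- A series in Frobenius agrees with its linear term up to a quadratic error. -/
lemma exists_norm_series_sub_le [IsUltrametricDist C] {e : ℕ → Matrix (Fin d) (Fin d) C}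
    {g : (Fin d → C) → (Fin d → C)}
    (hg : ∀ x, HasSum (fun n => (e n).mulVec (frob 𝔽 n x)) (g x)) :
    ∃ S : ℝ, 0 < S ∧ ∀ x, ‖x‖ ≤ 1 → ‖g x - (e 0).mulVec x‖ ≤ S * ‖x‖ ^ 2 := by
  have hq1 : 1 < Nat.card 𝔽 := Finite.one_lt_card
  -- Frobenius fixes unit vectors, so convergence at the `j`-th one bounds the `j`-th columns of all
  -- coefficients.
  have hcol : ∀ j : Fin d, ∃ M : ℝ, ∀ n i, ‖e n i j‖ ≤ M := fun j => by
    obtain ⟨M, hM⟩ := (hg (Pi.single j 1)).summable.tendsto_atTop_zero.norm.bddAbove_range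
    refine ⟨M, fun n i => (Eq.le ?_).trans ((norm_le_pi_norm _ i).trans (hM ⟨n, rfl⟩))⟩
    have hs : frob 𝔽 n (Pi.single j (1 : C)) = Pi.single j 1 := by
      funext k
      rw [frob_apply]
      by_cases hk : k = j
      · subst hk; simp
      · simp [hk, (zero_lt_one.trans hq1).ne']
    simp only [hs, Matrix.mulVec_single_one]
    rfl
  choose M hM using hcol
  set S : ℝ := 1 + ∑ j, |M j| with hS
  have hS0 : 0 < S := by positivity
  have hSe : ∀ n i j, ‖e n i j‖ ≤ S := fun n i j =>
    (hM j n i).trans ((le_abs_self _).trans ((Finset.single_le_sum (f := fun j => |M j|)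
      (fun _ _ => abs_nonneg _) (Finset.mem_univ j)).trans (by linarith)))
  refine ⟨S, hS0, fun x hx => ?_⟩
  have h1 := (hasSum_nat_add_iff' 1).2 (hg x)
  rw [Finset.sum_range_one, frob_zero] at h1
  rw [← h1.tsum_eq]
  refine IsUltrametricDist.norm_tsum_le_of_forall_le_of_nonneg (by positivity) fun n => ?_
  refine (norm_mulVec_le hS0.le (hSe _) _).trans ?_
  gcongr
  refine (norm_frob_le 𝔽 _ x).trans (pow_le_pow_of_le_one (norm_nonneg x) hx ?_)
  -- With the linear term removed, every exponent `q ^ (n + 1)` is at least two.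
  exact (Nat.succ_le_of_lt hq1).trans (Nat.le_self_pow (by omega) _)

/-- The coefficients of the composition of a polynomial and a series in Frobenius. -/
def frobConv (𝔽 : Type*) (M e : ℕ → Matrix (Fin d) (Fin d) C) (n : ℕ) :
    Matrix (Fin d) (Fin d) C :=
  ∑ i ∈ Finset.range (n + 1), M i * (e (n - i)).map (· ^ Nat.card 𝔽 ^ i)

/-- Each `M i` contributes the given series, transformed continuously and shifted by `i`. Only
finitely many are added, so no double series has to be rearranged. -/
lemma hasSum_frobConv {M e : ℕ → Matrix (Fin d) (Fin d) C} {r : ℕ} (hM : ∀ i, r ≤ i → M i = 0)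
    {x y : Fin d → C} (h : HasSum (fun n => (e n).mulVec (frob 𝔽 n x)) y) :
    HasSum (fun n => (frobConv 𝔽 M e n).mulVec (frob 𝔽 n x))
      (∑ i ∈ Finset.range r, (M i).mulVec (frob 𝔽 i y)) := by
  have h1 : ∀ i, HasSum (fun n => if i ≤ n then
      (M i * (e (n - i)).map (· ^ Nat.card 𝔽 ^ i)).mulVec (frob 𝔽 n x) else 0)
      ((M i).mulVec (frob 𝔽 i y)) := fun i => by
    refine (Function.Injective.hasSum_iff (add_left_injective i) fun n hn => ?_).1 ?_
    · refine if_neg fun hin => hn ⟨n - i, Nat.sub_add_cancel hin⟩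
    · have h2 := h.map ((Matrix.mulVecLin (M i)).toAddMonoidHom.comp (frob 𝔽 i))
        ((continuous_mulVec_const (M i)).comp (continuous_frob 𝔽 i))
      change HasSum _ ((M i).mulVec (frob 𝔽 i y)) at h2
      convert h2 using 1
      funext n
      simp only [Function.comp_apply, le_add_iff_nonneg_left, zero_le, if_true,
        Nat.add_sub_cancel]
      rw [← Matrix.mulVec_mulVec, ← frob_mulVec]
      rfl
  convert hasSum_sum fun i (_ : i ∈ Finset.range r) => h1 i using 1
  funext n
  rw [frobConv, Matrix.sum_mulVec, ← Finset.sum_filter]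
  refine (Finset.sum_subset (fun i hi => ?_) fun i hi hi' => ?_).symm
  · simp only [Finset.mem_filter, Finset.mem_range] at hi ⊢
    omega
  · simp only [Finset.mem_filter, Finset.mem_range, not_and] at hi hi'
    rw [hM i (by by_contra h; exact hi' (by omega) (by omega)), zero_mul, Matrix.zero_mulVec]

/-- The coefficients of the series `e` in Frobenius with `e 0 = 1` and `M ∘ e = e ∘ ϑ`, where `M`
is a polynomial in Frobenius with constant term `ϑ`. -/
def expCoeff (𝔽 : Type*) (M : ℕ → Matrix (Fin d) (Fin d) C) (ϑ : C) :
    ℕ → Matrix (Fin d) (Fin d) C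
  | 0 => 1
  | n + 1 => (ϑ ^ Nat.card 𝔽 ^ (n + 1) - ϑ)⁻¹ • ∑ i : Fin (n + 1),
      M (i + 1) * (expCoeff 𝔽 M ϑ (n - i)).map (· ^ Nat.card 𝔽 ^ (i + 1 : ℕ))

variable [IsUltrametricDist C] {M : ℕ → Matrix (Fin d) (Fin d) C} {ϑ : C}

/-- The term `i = 0` contributes `ϑ e_n`; for `n > 0` the recursion is made so that the others add
up to `(ϑ ^ q ^ n - ϑ) e_n`. -/
lemma frobConv_expCoeff (hϑ : 1 < ‖ϑ‖) (hM0 : M 0 = ϑ • (1 : Matrix (Fin d) (Fin d) C)) (n : ℕ) :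
    frobConv 𝔽 M (expCoeff 𝔽 M ϑ) n = ϑ ^ Nat.card 𝔽 ^ n • expCoeff 𝔽 M ϑ n := by
  have hmap : ∀ N : Matrix (Fin d) (Fin d) C, N.map (· ^ Nat.card 𝔽 ^ 0) = N := fun N => by
    ext; simp
  cases n with
  | zero => simp [frobConv, hM0, expCoeff]
  | succ n =>
    have hne : ϑ ^ Nat.card 𝔽 ^ (n + 1) - ϑ ≠ 0 := by
      rw [← norm_pos_iff, norm_pow_card_sub (𝔽 := 𝔽) hϑ]
      positivity
    rw [frobConv, Finset.sum_range_succ', hmap, hM0, Nat.sub_zero]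
    have h1 : ∑ i ∈ Finset.range (n + 1), M (i + 1) *
        (expCoeff 𝔽 M ϑ (n + 1 - (i + 1))).map (· ^ Nat.card 𝔽 ^ (i + 1)) =
        (ϑ ^ Nat.card 𝔽 ^ (n + 1) - ϑ) • expCoeff 𝔽 M ϑ (n + 1) := by
      rw [expCoeff, smul_smul, mul_inv_cancel₀ hne, one_smul, Finset.sum_range]
      simp
    rw [h1, Matrix.smul_mul, one_mul, sub_smul, sub_add_cancel]

/-- By induction: the denominators have norm at least one, and `1 + (q ^ (n - i) - 1) q ^ (i + 1) ≤
q ^ (n + 1) - 1` since `q ^ (i + 1) ≥ 2`. -/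
lemma norm_expCoeff_le (hϑ : 1 < ‖ϑ‖) {μ : ℝ} (hμ : 1 ≤ μ) (hM : ∀ n i j, ‖M n i j‖ ≤ μ) (n : ℕ) :
    ∀ i j, ‖expCoeff 𝔽 M ϑ n i j‖ ≤ μ ^ (Nat.card 𝔽 ^ n - 1) := by
  have hq1 : 1 < Nat.card 𝔽 := Finite.one_lt_card
  induction n using Nat.strong_induction_on with
  | _ n ih =>
    intro k l
    cases n with
    | zero =>
      rw [expCoeff, pow_zero, Nat.sub_self, pow_zero, Matrix.one_apply]
      split_ifs <;> simp
    | succ n =>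
      rw [expCoeff, Matrix.smul_apply, smul_eq_mul, norm_mul, norm_inv, norm_pow_card_sub (𝔽 := 𝔽) hϑ]
      refine (mul_le_of_le_one_left (norm_nonneg _)
        (inv_le_one_of_one_le₀ (one_le_pow₀ hϑ.le))).trans ?_
      rw [Matrix.sum_apply]
      refine IsUltrametricDist.norm_sum_le_of_forall_le_of_nonneg (by positivity) fun i _ => ?_
      have hi := i.2
      refine (norm_matrix_mul_le (hM _) (b := (μ ^ (Nat.card 𝔽 ^ (n - i) - 1)) ^
        Nat.card 𝔽 ^ (i + 1 : ℕ)) (fun a b => ?_) k l).trans ?_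
      · rw [Matrix.map_apply, norm_pow]
        exact pow_le_pow_left₀ (norm_nonneg _) (ih _ (by omega) a b) _
      · rw [← pow_mul, ← pow_succ']
        refine pow_le_pow_right₀ hμ ?_
        rw [Nat.sub_mul, one_mul, ← pow_add, show n - i + (i + 1) = n + 1 by omega]
        have h1 : 1 < Nat.card 𝔽 ^ (i + 1 : ℕ) := Nat.one_lt_pow (by omega) hq1
        have h2 : Nat.card 𝔽 ^ (i + 1 : ℕ) ≤ Nat.card 𝔽 ^ (n + 1) :=
          Nat.pow_le_pow_right (by omega) (by omega)
        omega

/-- The coefficients of the exponential series decay faster than any geometric sequence. -/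
lemma tendsto_expCoeff (hϑ : 1 < ‖ϑ‖) (hM0 : M 0 = ϑ • (1 : Matrix (Fin d) (Fin d) C))
    {r : ℕ} (hM : ∀ i, r ≤ i → M i = 0) (B : ℝ) (hB : 0 ≤ B) (i j : Fin d) :
    Filter.Tendsto (fun n => ‖expCoeff 𝔽 M ϑ n i j‖ * B ^ Nat.card 𝔽 ^ n) Filter.atTop
      (nhds 0) := by
  have hq1 : 1 < Nat.card 𝔽 := Finite.one_lt_card
  obtain ⟨μ, hμ, hMμ⟩ : ∃ μ : ℝ, 1 ≤ μ ∧ ∀ n i j, ‖M n i j‖ ≤ μ := by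
    choose a ha0 ha using fun n => exists_norm_entry_le (M n)
    refine ⟨1 + ∑ n ∈ Finset.range r, a n, by
      have := Finset.sum_nonneg fun n (_ : n ∈ Finset.range r) => ha0 n
      linarith, fun n i j => ?_⟩
    have h0 := Finset.sum_nonneg fun n (_ : n ∈ Finset.range r) => ha0 n
    by_cases hn : n < r
    · have := Finset.single_le_sum (f := a) (fun n _ => ha0 n) (Finset.mem_range.2 hn)
      linarith [ha n i j]
    · rw [hM n (not_lt.1 hn), Matrix.zero_apply, norm_zero]
      linarith
  -- `P B` expresses convergence at radius `B`. The crude bound gives the radius `1 / (2 * μ)`; the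
  -- functional equation enlarges a radius by the factor `‖ϑ‖`, and iteration passes every `B`.
  let P : ℝ → Prop := fun B => ∀ i j, Filter.Tendsto
    (fun n => ‖expCoeff 𝔽 M ϑ n i j‖ * B ^ Nat.card 𝔽 ^ n) Filter.atTop (nhds 0)
  have hbase : P (1 / (2 * μ)) := fun i j => by
    have hpow : Filter.Tendsto (fun n => (1 / 2 : ℝ) ^ Nat.card 𝔽 ^ n) Filter.atTop (nhds 0) :=
      (tendsto_pow_atTop_nhds_zero_of_lt_one (by norm_num) (by norm_num)).comp
        (tendsto_pow_atTop_atTop_of_one_lt hq1)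
    refine squeeze_zero (fun n => by positivity) (fun n => ?_) hpow
    have h1 : ‖expCoeff 𝔽 M ϑ n i j‖ ≤ μ ^ Nat.card 𝔽 ^ n :=
      (norm_expCoeff_le hϑ hμ hMμ n i j).trans (pow_le_pow_right₀ hμ (Nat.sub_le _ _))
    calc _ ≤ μ ^ Nat.card 𝔽 ^ n * (1 / (2 * μ)) ^ Nat.card 𝔽 ^ n := by gcongr
      _ = (1 / 2 : ℝ) ^ Nat.card 𝔽 ^ n := by
        rw [← mul_pow]
        congr 1
        field_simp
  have hstep : ∀ B, 0 ≤ B → P B → P (‖ϑ‖ * B) := fun B hB0 hPB i j => by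
    let a : ℕ → ℝ := fun n => (∑ k, ∑ l, ‖expCoeff 𝔽 M ϑ n k l‖) * B ^ Nat.card 𝔽 ^ n
    have ha : Filter.Tendsto a Filter.atTop (nhds 0) := by
      have := tendsto_finsetSum (Finset.univ : Finset (Fin d)) fun k _ =>
        tendsto_finsetSum (Finset.univ : Finset (Fin d)) fun l _ => hPB k l
      simpa [a, Finset.sum_mul] using this
    have ha0 : ∀ n, 0 ≤ a n := fun n => by positivity
    have hlim : Filter.Tendsto (fun n => ∑ k ∈ Finset.range r,
        μ * a (n - k) ^ Nat.card 𝔽 ^ k) Filter.atTop (nhds 0) := by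
      have h1 : ∀ k ∈ Finset.range r, Filter.Tendsto
          (fun n => μ * a (n - k) ^ Nat.card 𝔽 ^ k) Filter.atTop (nhds 0) := fun k _ => by
        have h2 := ((ha.comp (Filter.tendsto_sub_atTop_nat k)).pow (Nat.card 𝔽 ^ k)).const_mul μ
        rwa [zero_pow (by positivity), mul_zero] at h2
      simpa using tendsto_finsetSum _ h1
    refine squeeze_zero (fun n => by positivity) (fun n => ?_) hlim
    -- The factor `ϑ ^ q ^ n` turns `e_n` into the `n`-th coefficient of `M ∘ e`, whose at most `r`
    -- nonzero terms are controlled by the null sequence `a`.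
    have h2 : ‖expCoeff 𝔽 M ϑ n i j‖ * (‖ϑ‖ * B) ^ Nat.card 𝔽 ^ n =
        ‖frobConv 𝔽 M (expCoeff 𝔽 M ϑ) n i j‖ * B ^ Nat.card 𝔽 ^ n := by
      rw [frobConv_expCoeff hϑ hM0, Matrix.smul_apply, smul_eq_mul, norm_mul, norm_pow, mul_pow]
      ring
    rw [h2, frobConv, Matrix.sum_apply]
    refine (mul_le_mul_of_nonneg_right (norm_sum_le _ _) (by positivity)).trans ?_
    rw [Finset.sum_mul]
    have h3 : ∀ k ∈ Finset.range (n + 1), ‖(M k * (expCoeff 𝔽 M ϑ (n - k)).map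
        (· ^ Nat.card 𝔽 ^ k)) i j‖ * B ^ Nat.card 𝔽 ^ n ≤ μ * a (n - k) ^ Nat.card 𝔽 ^ k := by
      intro k hk
      have hk' : k ≤ n := Nat.lt_succ_iff.1 (Finset.mem_range.1 hk)
      have hBn : B ^ Nat.card 𝔽 ^ n = (B ^ Nat.card 𝔽 ^ (n - k)) ^ Nat.card 𝔽 ^ k := by
        rw [← pow_mul, ← pow_add, Nat.sub_add_cancel hk']
      have h4 : ‖(M k * (expCoeff 𝔽 M ϑ (n - k)).map (· ^ Nat.card 𝔽 ^ k)) i j‖ ≤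
          μ * (∑ k', ∑ l, ‖expCoeff 𝔽 M ϑ (n - k) k' l‖) ^ Nat.card 𝔽 ^ k := by
        refine norm_matrix_mul_le (hMμ k) (fun s t => ?_) i j
        rw [Matrix.map_apply, norm_pow]
        refine pow_le_pow_left₀ (norm_nonneg _) ?_ _
        exact (Finset.single_le_sum (f := fun l => ‖expCoeff 𝔽 M ϑ (n - k) s l‖)
          (fun _ _ => norm_nonneg _) (Finset.mem_univ t)).trans
            (Finset.single_le_sum (f := fun k' => ∑ l, ‖expCoeff 𝔽 M ϑ (n - k) k' l‖)
            (fun _ _ => by positivity) (Finset.mem_univ s))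
      refine (mul_le_mul_of_nonneg_right h4 (by positivity)).trans (le_of_eq ?_)
      rw [hBn, mul_assoc, ← mul_pow]
    have h5 : ∀ k ∈ Finset.range (n + 1), k ∉ (Finset.range (n + 1)).filter (· < r) →
        ‖(M k * (expCoeff 𝔽 M ϑ (n - k)).map (· ^ Nat.card 𝔽 ^ k)) i j‖ *
          B ^ Nat.card 𝔽 ^ n = 0 := by
      intro k hk hk'
      rw [hM k (by by_contra h; exact hk' (Finset.mem_filter.2 ⟨hk, not_le.1 h⟩)), zero_mul,
        Matrix.zero_apply, norm_zero, zero_mul]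
    rw [← Finset.sum_subset (Finset.filter_subset (· < r) _) h5]
    refine (Finset.sum_le_sum fun k hk => h3 k (Finset.mem_filter.1 hk).1).trans ?_
    refine Finset.sum_le_sum_of_subset_of_nonneg (fun k hk => ?_) fun k _ _ => ?_
    · exact Finset.mem_range.2 (Finset.mem_filter.1 hk).2
    · have := ha0 (n - k)
      positivity
  have hall : ∀ N : ℕ, P (‖ϑ‖ ^ N * (1 / (2 * μ))) := fun N => by
    induction N with
    | zero => simpa using hbase
    | succ N ih =>
      rw [pow_succ', mul_assoc]
      exact hstep _ (by positivity) ih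
  obtain ⟨N, hN⟩ := pow_unbounded_of_one_lt (B * (2 * μ)) hϑ
  have hBN : B ≤ ‖ϑ‖ ^ N * (1 / (2 * μ)) := by
    rw [mul_one_div, le_div_iff₀ (by positivity)]
    exact hN.le
  refine squeeze_zero (fun n => by positivity) (fun n => ?_) (hall N i j)
  gcongr

end Frobenius

/-! ### Existence of the exponential function -/

lemma isBigO_of_norm_sub_le {V : Type*} [SeminormedAddCommGroup V] {g N : V → V}
    (h : ∃ S : ℝ, 0 < S ∧ ∀ x, ‖x‖ ≤ 1 → ‖g x - N x‖ ≤ S * ‖x‖ ^ 2) :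
    (fun x => g x - N x) =O[nhds 0] fun x => ‖x‖ ^ 2 := by
  obtain ⟨S, -, hS⟩ := h
  refine Asymptotics.IsBigO.of_bound S ?_
  filter_upwards [Metric.closedBall_mem_nhds (0 : V) one_pos] with x hx
  rw [norm_pow, norm_norm]
  exact hS x (by simpa using hx)

/-- A map that intertwines multiplication by a large scalar with a map tangent to it
and that has no linear term vanishes. -/
lemma eq_zero_of_intertwines {V C : Type*} [NormedField C] [NormedAddCommGroup V]
    [NormedSpace C V] [IsUltrametricDist V] {φ h : V → V} {ϑ : C} (hϑ : 1 < ‖ϑ‖) {S : ℝ}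
    (hS : 0 < S) (hφ : ∀ y, ‖y‖ ≤ 1 → ‖φ y - ϑ • y‖ ≤ S * ‖y‖ ^ 2)
    (hh : h =O[nhds 0] fun x => ‖x‖ ^ 2) (hint : ∀ x, h (ϑ • x) = φ (h x)) (x : V) :
    h x = 0 := by
  have hϑ0 : ϑ ≠ 0 := norm_pos_iff.1 (zero_lt_one.trans hϑ)
  obtain ⟨c, hc, hcw⟩ := hh.exists_pos
  -- Within this radius the quadratic error is at most `‖y‖`, so `φ` stretches norms by at most
  -- `‖ϑ‖`.
  set δ : ℝ := min 1 (1 / S)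
  have hδ : 0 < δ := by positivity
  have h1 : ∀ y, ‖y‖ ≤ δ → ‖φ y‖ ≤ ‖ϑ‖ * ‖y‖ := fun y hy => by
    have h2 : S * ‖y‖ ≤ 1 := by
      have := (le_div_iff₀ hS).1 (hy.trans (min_le_right _ _))
      linarith
    have h3 : φ y = (φ y - ϑ • y) + ϑ • y := by abel
    rw [h3]
    refine (IsUltrametricDist.norm_add_le_max _ _).trans (max_le ?_ (norm_smul _ _).le)
    refine (hφ y (hy.trans (min_le_left _ _))).trans ?_
    nlinarith [norm_nonneg y]
  have h2 : ∀ k z, ‖ϑ‖ ^ k * ‖z‖ ≤ δ → ‖φ^[k] z‖ ≤ ‖ϑ‖ ^ k * ‖z‖ := fun k z => by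
    induction k with
    | zero => intro _; simp
    | succ k ih =>
      intro hz
      have hle : ‖ϑ‖ ^ k * ‖z‖ ≤ ‖ϑ‖ ^ (k + 1) * ‖z‖ := by
        gcongr
        exacts [hϑ.le, Nat.le_succ k]
      have h3 := ih (hle.trans hz)
      rw [Function.iterate_succ_apply']
      refine (h1 _ (h3.trans (hle.trans hz))).trans ?_
      rw [pow_succ', mul_assoc]
      gcongr
  have h3 : ∀ k y, h (ϑ ^ k • y) = φ^[k] (h y) := fun k y => by
    induction k with
    | zero => simp
    | succ k ih => rw [Function.iterate_succ_apply', ← ih, pow_succ', mul_smul, hint]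
  have hinv : ‖ϑ‖⁻¹ < 1 := inv_lt_one_of_one_lt₀ hϑ
  have hpow : Filter.Tendsto (fun n : ℕ => ‖ϑ‖⁻¹ ^ n) Filter.atTop (nhds 0) :=
    tendsto_pow_atTop_nhds_zero_of_lt_one (by positivity) hinv
  have hyn : ∀ n : ℕ, ‖ϑ⁻¹ ^ n • x‖ = ‖ϑ‖⁻¹ ^ n * ‖x‖ := fun n => by
    rw [norm_smul, norm_pow, norm_inv]
  have hy : Filter.Tendsto (fun n : ℕ => ϑ⁻¹ ^ n • x) Filter.atTop (nhds 0) := by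
    rw [tendsto_zero_iff_norm_tendsto_zero]
    simp only [hyn]
    simpa using hpow.mul_const ‖x‖
  have hlim : Filter.Tendsto (fun n : ℕ => c * ‖x‖ ^ 2 * ‖ϑ‖⁻¹ ^ n) Filter.atTop (nhds 0) := by
    simpa using hpow.const_mul (c * ‖x‖ ^ 2)
  rw [← norm_le_zero_iff]
  refine ge_of_tendsto hlim ?_
  filter_upwards [hy.eventually hcw.bound, hlim.eventually (ge_mem_nhds hδ)] with n hn1 hn2
  -- At `ϑ⁻¹ ^ n • x` the quadratic bound on `h` gains `‖ϑ‖ ^ (-2n)`, whereas applying `φ` `n` times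
  -- loses only `‖ϑ‖ ^ n`.
  have h4 : h x = φ^[n] (h (ϑ⁻¹ ^ n • x)) := by
    rw [← h3, smul_smul, ← mul_pow, mul_inv_cancel₀ hϑ0, one_pow, one_smul]
  rw [norm_pow, norm_norm, hyn] at hn1
  have h5 : ‖ϑ‖ ^ n * ‖h (ϑ⁻¹ ^ n • x)‖ ≤ c * ‖x‖ ^ 2 * ‖ϑ‖⁻¹ ^ n := by
    calc _ ≤ ‖ϑ‖ ^ n * (c * (‖ϑ‖⁻¹ ^ n * ‖x‖) ^ 2) := by gcongr
      _ = c * ‖x‖ ^ 2 * ‖ϑ‖⁻¹ ^ n * (‖ϑ‖ ^ n * ‖ϑ‖⁻¹ ^ n) := by ring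
      _ = _ := by rw [← mul_pow, mul_inv_cancel₀ (by positivity), one_pow, mul_one]
  rw [h4]
  exact (h2 n _ (h5.trans hn2)).trans h5

namespace AndersonModule

variable {𝔽 : Type w} {A L : Type u} [Field 𝔽] [Finite 𝔽] [CommRing A] [Algebra 𝔽 A] [Field L]
  [Algebra 𝔽 L] [Algebra A L] {d : ℕ} (E : AndersonModule.{w, u} 𝔽 A L d)
  (κ : E.scheme ≅ gaPow 𝔽 L d)

/-- The action of `a` in the coordinate systems `κ` (source) and `κ'` (target). -/
def conj (κ κ' : E.scheme ≅ gaPow 𝔽 L d) (a : A) : gaPow.{w, u} 𝔽 L d ⟶ gaPow 𝔽 L d :=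
  κ.inv ≫ (E.action a : E.scheme ⟶ E.scheme) ≫ κ'.hom

/-- The coefficients of `a` as a polynomial in Frobenius over an extension `C` of `L`. -/
def actCoeff (C : Type u) [CommRing C] [Algebra L C] (κ κ' : E.scheme ≅ gaPow 𝔽 L d) (a : A)
    (n : ℕ) : Matrix (Fin d) (Fin d) C :=
  (coeffMatrix (E.conj κ κ' a) n).map (algebraMap L C)

lemma actCoeff_eq_zero (C : Type u) [CommRing C] [Algebra L C] (κ κ' : E.scheme ≅ gaPow 𝔽 L d)
    (a : A) (n : ℕ) (hn : frobBound (E.conj κ κ' a) ≤ n) : E.actCoeff C κ κ' a n = 0 := by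
  rw [actCoeff, coeffMatrix_eq_zero _ _ hn]
  ext; simp

/-! ### The tangent action of `A` in coordinates -/

section LieRing

variable {C : Type u} [CommRing C] [Algebra L C]

lemma lieCoords_action (κ κ' : E.scheme ≅ gaPow 𝔽 L d) (a : A) (x : lie E.scheme C) :
    lieCoords κ' C (lieMap (E.action a) C x) =
      (E.actCoeff C κ κ' a 0).mulVec (lieCoords κ C x) :=
  lieCoords_lieMap κ κ' _ x

lemma lieCoords_action_pow (a : A) (n : ℕ) (x : lie E.scheme C) :
    lieCoords κ C (lieMap (E.action (a ^ n)) C x) =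
      (E.actCoeff C κ κ a 0 ^ n).mulVec (lieCoords κ C x) := by
  induction n with
  | zero =>
    rw [pow_zero, pow_zero, map_one, Matrix.one_mulVec]
    rfl
  | succ n ih =>
    rw [pow_succ', pow_succ', map_mul, ← Matrix.mulVec_mulVec, ← ih, ← lieCoords_action]
    rfl

/-- The tangent action of a suitable power of `a` is scalar. -/
lemma exists_actCoeff_pow_eq (hd : 0 < d) (a : A) : ∃ k : ℕ, 0 < k ∧
    E.actCoeff C κ κ a 0 ^ k = algebraMap L C (algebraMap A L a) ^ k • 1 := by
  have : Nonempty (Fin d) := ⟨⟨0, hd⟩⟩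
  obtain ⟨n, hn⟩ := E.nilpotent a
  set ℓ := algebraMap A L a with hℓ
  set M := E.actCoeff L κ κ a 0 with hM
  have h1 : ∀ x : lie E.scheme L, lieCoords κ L
      ((lieMap (E.action a) L - lieScale E.scheme ℓ : Module.End 𝔽 (lie E.scheme L)) x) =
      (M - ℓ • (1 : Matrix (Fin d) (Fin d) L)).mulVec (lieCoords κ L x) := fun x => by
    rw [LinearMap.sub_apply, map_sub, E.lieCoords_action κ κ, lieCoords_lieScale,
      Matrix.sub_mulVec, Matrix.smul_mulVec, Matrix.one_mulVec]
  have h2 : ∀ m (x : lie E.scheme L), lieCoords κ L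
      (((lieMap (E.action a) L - lieScale E.scheme ℓ : Module.End 𝔽 (lie E.scheme L)) ^ m) x) =
      ((M - ℓ • (1 : Matrix (Fin d) (Fin d) L)) ^ m).mulVec (lieCoords κ L x) := fun m x => by
    induction m with
    | zero => simp
    | succ m ih => rw [pow_succ', Module.End.mul_apply, h1, ih, Matrix.mulVec_mulVec, pow_succ']
  have h3 : (M - ℓ • (1 : Matrix (Fin d) (Fin d) L)) ^ n = 0 := by
    refine Matrix.mulVec_injective (funext fun y => ?_)
    obtain ⟨x, rfl⟩ := lieCoords_surjective κ L y
    rw [← h2, hn, Matrix.zero_mulVec]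
    exact map_zero _
  obtain ⟨p, hp⟩ := CharP.exists 𝔽
  have hpp : Fact p.Prime := ⟨CharP.char_is_prime 𝔽 p⟩
  have hL : CharP L p := charP_of_injective_algebraMap (algebraMap 𝔽 L).injective p
  -- Since `p ^ n ≥ n`, this power kills the nilpotent part; in characteristic `p` it distributes
  -- over the difference.
  have h4 : (M - ℓ • (1 : Matrix (Fin d) (Fin d) L)) ^ p ^ n = 0 :=
    pow_eq_zero_of_le (Nat.lt_pow_self hpp.out.one_lt).le h3
  rw [sub_pow_char_pow_of_commute, sub_eq_zero, smul_pow, one_pow] at h4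
  · refine ⟨p ^ n, pow_pos hpp.out.pos n, ?_⟩
    have h5 : E.actCoeff C κ κ a 0 = (algebraMap L C).mapMatrix M := by
      ext; simp [hM, actCoeff]
    rw [h5, ← map_pow, h4]
    ext i j
    by_cases hij : i = j <;> simp [hij]
  · exact (Commute.one_right M).smul_right ℓ

end LieRing

section Exponential

variable {C : Type u} [NormedField C] [Algebra L C] [Algebra 𝔽 C] [IsScalarTower 𝔽 L C]

lemma coords_action (κ κ' : E.scheme ≅ gaPow 𝔽 L d) (a : A) (x : points E.scheme C) :
    coords κ' C (pointsMap (E.action a) C x) =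
      ∑ n ∈ Finset.range (frobBound (E.conj κ κ' a)),
        (E.actCoeff C κ κ' a n).mulVec (frob 𝔽 n (coords κ C x)) :=
  coords_pointsMap_eq_sum κ κ' _ x

variable (C) in
/-- The action of `a` on the `C`-points in coordinates, as a polynomial in Frobenius. -/
def actPoly (κ κ' : E.scheme ≅ gaPow 𝔽 L d) (a : A) : (Fin d → C) →+ (Fin d → C) :=
  ∑ n ∈ Finset.range (frobBound (E.conj κ κ' a)),
    (E.actCoeff C κ κ' a n).mulVecLin.toAddMonoidHom.comp (frob 𝔽 n)

lemma actPoly_apply (κ κ' : E.scheme ≅ gaPow 𝔽 L d) (a : A) (y : Fin d → C) :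
    E.actPoly C κ κ' a y = ∑ n ∈ Finset.range (frobBound (E.conj κ κ' a)),
      (E.actCoeff C κ κ' a n).mulVec (frob 𝔽 n y) := by
  rw [actPoly, AddMonoidHom.finsetSum_apply]
  rfl

lemma coords_action_eq_actPoly (κ κ' : E.scheme ≅ gaPow 𝔽 L d) (a : A) (x : points E.scheme C) :
    coords κ' C (pointsMap (E.action a) C x) = E.actPoly C κ κ' a (coords κ C x) := by
  rw [coords_action, actPoly_apply]

lemma hasSum_actPoly (κ κ' : E.scheme ≅ gaPow 𝔽 L d) (a : A) (y : Fin d → C) :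
    HasSum (fun n => (E.actCoeff C κ κ' a n).mulVec (frob 𝔽 n y)) (E.actPoly C κ κ' a y) := by
  rw [actPoly_apply]
  refine hasSum_sum_of_ne_finset_zero fun n hn => ?_
  rw [E.actCoeff_eq_zero C κ κ' a n (by simpa using hn), Matrix.zero_mulVec]

lemma coords_smul_base (c : 𝔽) (x : points E.scheme C) :
    coords κ C (c • x) = algebraMap 𝔽 C c • coords κ C x := by
  have h := map_smul (pointsMap κ.hom C) c x
  refine Eq.trans h ?_
  rw [IsScalarTower.algebraMap_apply 𝔽 L C]
  funext i
  exact Algebra.smul_def _ _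

lemma lieCoords_smul_base (c : 𝔽) (x : lie E.scheme C) :
    lieCoords κ C (c • x) = algebraMap 𝔽 C c • lieCoords κ C x := by
  have h := congrFun (map_smul (pointsMap κ.hom (DualNumber C)) c
    (x : points E.scheme (DualNumber C)))
  funext i
  refine (congrArg TrivSqZeroExt.snd (h i)).trans ?_
  rw [IsScalarTower.algebraMap_apply 𝔽 L C]
  exact Algebra.smul_def (A := C) (algebraMap 𝔽 L c) (lieCoords κ C x i)

lemma frob_smul_base (n : ℕ) (c : 𝔽) (x : Fin d → C) :
    frob 𝔽 n (algebraMap 𝔽 C c • x) = algebraMap 𝔽 C c • frob 𝔽 n x := by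
  rw [frob_smul, ← frobAlgHom_apply, AlgHom.commutes]

lemma actPoly_comm (a b : A) (y : Fin d → C) :
    E.actPoly C κ κ a (E.actPoly C κ κ b y) = E.actPoly C κ κ b (E.actPoly C κ κ a y) := by
  obtain ⟨z, rfl⟩ := (coords_bijective κ C).2 y
  have h : ∀ a b : A, E.actPoly C κ κ a (E.actPoly C κ κ b (coords κ C z)) =
      coords κ C (pointsMap (E.action (a * b)) C z) := fun a b => by
    rw [← coords_action_eq_actPoly, ← coords_action_eq_actPoly, map_mul]
    rfl
  rw [h, h, mul_comm]

variable [IsUltrametricDist C] [CompleteSpace C]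

lemma summable_expCoeff {M : ℕ → Matrix (Fin d) (Fin d) C} {ϑ : C} (hϑ : 1 < ‖ϑ‖)
    (hM0 : M 0 = ϑ • (1 : Matrix (Fin d) (Fin d) C)) {r : ℕ} (hM : ∀ i, r ≤ i → M i = 0)
    (x : Fin d → C) : Summable fun n => (expCoeff 𝔽 M ϑ n).mulVec (frob 𝔽 n x) := by
  refine NonarchimedeanAddGroup.summable_of_tendsto_cofinite_zero ?_
  rw [Nat.cofinite_eq_atTop, tendsto_pi_nhds]
  intro i
  have h1 : ∀ j, Filter.Tendsto (fun n => expCoeff 𝔽 M ϑ n i j * frob 𝔽 n x j) Filter.atTop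
      (nhds 0) := fun j => by
    rw [tendsto_zero_iff_norm_tendsto_zero]
    simpa [frob_apply] using tendsto_expCoeff (𝔽 := 𝔽) hϑ hM0 hM ‖x j‖ (norm_nonneg _) i j
  simpa [Matrix.mulVec, dotProduct] using
    tendsto_finsetSum (Finset.univ : Finset (Fin d)) fun j _ => h1 j

/-- The exponential function exists as soon as the tangent action of some element is
multiplication by a large scalar. -/
lemma exists_isExponential {t : A} {ϑ : C} (hϑ : 1 < ‖ϑ‖) (ht : E.actCoeff C κ κ t 0 = ϑ • 1) :
    ∃ f, E.IsExponential C f := by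
  set M := E.actCoeff C κ κ t with hM
  set r := frobBound (E.conj κ κ t)
  have hMr : ∀ i, r ≤ i → M i = 0 := E.actCoeff_eq_zero C κ κ t
  set e := expCoeff 𝔽 M ϑ with he
  have he0 : e 0 = 1 := by rw [he, expCoeff]
  have hsum : ∀ x : Fin d → C, HasSum (fun n => (e n).mulVec (frob 𝔽 n x))
      (∑' n, (e n).mulVec (frob 𝔽 n x)) := fun x => (summable_expCoeff hϑ ht hMr x).hasSum
  let F : (Fin d → C) →+ (Fin d → C) :=
    { toFun := fun x => ∑' n, (e n).mulVec (frob 𝔽 n x)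
      map_zero' := by simp
      map_add' := fun x y => by
        refine HasSum.tsum_eq ?_
        simpa only [map_add, Matrix.mulVec_add] using (hsum x).add (hsum y) }
  have hF : ∀ x, HasSum (fun n => (e n).mulVec (frob 𝔽 n x)) (F x) := hsum
  -- Both sides are the series with coefficients `ϑ ^ q ^ n • e n`.
  have hFϑ : ∀ x, F (ϑ • x) = E.actPoly C κ κ t (F x) := fun x => by
    have h1 := hasSum_frobConv hMr (hF x)
    rw [← actPoly_apply] at h1
    refine (hF (ϑ • x)).unique ?_
    convert h1 using 2 with n
    rw [frobConv_expCoeff hϑ ht, frob_smul, Matrix.mulVec_smul, Matrix.smul_mulVec]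
  have hFsmul : ∀ (c : 𝔽) x, F (algebraMap 𝔽 C c • x) = algebraMap 𝔽 C c • F x := fun c x => by
    refine (hF _).unique ?_
    simpa only [frob_smul_base, Matrix.mulVec_smul] using (hF x).const_smul (algebraMap 𝔽 C c)
  let co : points E.scheme C ≃+ (Fin d → C) := AddEquiv.ofBijective _ (coords_bijective κ C)
  have hco : ∀ x, co x = coords κ C x := fun x => rfl
  let f : lie E.scheme C →ₗ[𝔽] points E.scheme C :=
    { toFun := fun x => co.symm (F (lieCoords κ C x))
      map_add' := fun x y => by rw [map_add, map_add, map_add]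
      map_smul' := fun c x => by
        refine co.injective ?_
        rw [AddEquiv.apply_symm_apply, RingHom.id_apply, hco, coords_smul_base, ← hco,
          AddEquiv.apply_symm_apply, lieCoords_smul_base, hFsmul] }
  have hf : ∀ x, coords κ C (f x) = F (lieCoords κ C x) := fun x => co.apply_symm_apply _
  refine ⟨f, ⟨fun a x => ?_, fun κ' => ?_⟩⟩
  -- The construction only ensures compatibility with `t`. For any `a`, the defect `φ_a ∘ F - F ∘
  -- ∂φ_a` has no linear term, and it intertwines `ϑ` with `φ_t` because `φ_a` and `φ_t` commute;
  -- hence it vanishes.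
  · refine (coords_bijective κ C).1 ?_
    rw [hf, coords_action_eq_actPoly E κ κ, hf, lieCoords_action E κ κ]
    set N := E.actCoeff C κ κ a 0
    have hA := exists_norm_series_sub_le (C := C) (E.hasSum_actPoly κ κ a)
    have hAO := isBigO_of_norm_sub_le hA
    have hF' := exists_norm_series_sub_le hF
    have hFO := isBigO_of_norm_sub_le hF'
    simp only [he0, Matrix.one_mulVec] at hFO
    have hN : ∀ g : (Fin d → C) → (Fin d → C), (fun y => N.mulVec (g y)) =O[nhds 0] g := fun g => by
      obtain ⟨b, hb, hNb⟩ := exists_norm_entry_le N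
      exact Asymptotics.IsBigO.of_bound b (Filter.Eventually.of_forall fun y =>
        norm_mulVec_le hb hNb (g y))
    have hsq : (fun y : Fin d → C => ‖y‖ ^ 2) =O[nhds 0] fun y => y := by
      refine Asymptotics.IsBigO.of_bound 1 ?_
      filter_upwards [Metric.closedBall_mem_nhds (0 : Fin d → C) one_pos] with y hy
      rw [mem_closedBall_zero_iff] at hy
      rw [norm_pow, norm_norm]
      nlinarith [norm_nonneg y]
    have hF1 : F =O[nhds 0] fun y => y := by
      simpa using (hFO.trans hsq).add (Asymptotics.isBigO_refl (fun y : Fin d → C => y) (nhds 0))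
    have hF0 : Filter.Tendsto F (nhds 0) (nhds 0) := hF1.trans_tendsto Filter.tendsto_id
    have hN0 : Filter.Tendsto (fun y => N.mulVec y) (nhds 0) (nhds 0) :=
      (hN fun y => y).trans_tendsto Filter.tendsto_id
    obtain ⟨S, hS, hSt⟩ := exists_norm_series_sub_le (C := C) (E.hasSum_actPoly κ κ t)
    have key := eq_zero_of_intertwines (φ := E.actPoly C κ κ t)
      (h := fun y => E.actPoly C κ κ a (F y) - F (N.mulVec y)) hϑ hS (fun y hy => by
        have := hSt y hy
        rwa [← hM, ht, Matrix.smul_mulVec, Matrix.one_mulVec] at this) ?_ ?_ (lieCoords κ C x)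
    · exact (sub_eq_zero.1 key).symm
    · have h1 := (hAO.comp_tendsto hF0).trans (hF1.norm_norm.pow 2)
      have h2 := (hN _).trans hFO
      have h3 := (hFO.comp_tendsto hN0).trans ((hN fun y => y).norm_norm.pow 2)
      refine ((h1.add h2).sub h3).congr_left fun y => ?_
      simp only [Function.comp_apply, Matrix.mulVec_sub]
      abel
    · intro y
      rw [hFϑ, actPoly_comm, Matrix.mulVec_smul, hFϑ, map_sub]
  -- A change of coordinates is the action of `1` read in two systems: a polynomial in Frobenius on
  -- `E`, only its linear part on the Lie algebra.
  · set H := E.actCoeff C κ' κ 1 0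
    have hone : ∀ z : points E.scheme C, pointsMap (E.action 1) C z = z := fun z => by
      rw [map_one]; rfl
    have hone' : ∀ z : lie E.scheme C, lieMap (E.action 1) C z = z := fun z => by
      rw [map_one]; rfl
    have hH : ∀ x, lieCoords κ C x = H.mulVec (lieCoords κ' C x) := fun x => by
      rw [← lieCoords_action, hone']
    refine ⟨fun n => frobConv 𝔽 (E.actCoeff C κ κ' 1) e n * H.map (· ^ Nat.card 𝔽 ^ n), ?_,
      fun x => ?_⟩
    · refine Matrix.mulVec_injective (funext fun y => ?_)
      obtain ⟨x, rfl⟩ := lieCoords_surjective κ' C y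
      have h1 : H.map (· ^ Nat.card 𝔽 ^ 0) = H := by ext; simp
      have h2 : frobConv 𝔽 (E.actCoeff C κ κ' 1) e 0 = E.actCoeff C κ κ' 1 0 := by
        simp [frobConv, he0]
      beta_reduce
      rw [h1, h2, ← Matrix.mulVec_mulVec, ← hH, ← lieCoords_action, hone', Matrix.one_mulVec]
    · have h1 := hasSum_frobConv (E.actCoeff_eq_zero C κ κ' 1) (hF (lieCoords κ C x))
      rw [← actPoly_apply, ← hf, ← coords_action_eq_actPoly, hone] at h1
      convert h1 using 2 with n
      rw [← Matrix.mulVec_mulVec, hH]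
      have h2 := frob_mulVec 𝔽 n 0 H (lieCoords κ' C x)
      rw [frob_zero, zero_add] at h2
      rw [h2]
      rfl

end Exponential

end AndersonModule

/-! ### The exponential function near zero -/

lemma norm_eq_of_norm_sub_le {V : Type*} [NormedAddCommGroup V] [IsUltrametricDist V] {x y : V}
    (h : ‖y - x‖ ≤ 1 / 2 * ‖x‖) : ‖y‖ = ‖x‖ := by
  by_cases hx : x = 0
  · subst hx
    simpa using h
  · have hx' : 0 < ‖x‖ := norm_pos_iff.2 hx
    rw [← norm_neg x]
    refine IsUltrametricDist.norm_eq_of_add_norm_lt_max ?_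
    rw [← sub_eq_add_neg, norm_neg]
    exact (h.trans_lt (by linarith)).trans_le (le_max_right _ _)

lemma norm_sub_le_max {V : Type*} [SeminormedAddCommGroup V] [IsUltrametricDist V] (x y : V) :
    ‖x - y‖ ≤ max ‖x‖ ‖y‖ := by
  rw [sub_eq_add_neg, ← norm_neg y]
  exact IsUltrametricDist.norm_add_le_max _ _

/-- An additive map that is close to the identity maps a small ball onto itself. -/
lemma exists_eq_of_norm_sub_le {V : Type*} [NormedAddCommGroup V] [IsUltrametricDist V]
    [CompleteSpace V] (g : V →+ V) {ρ : ℝ} (hg : ∀ x, ‖x‖ ≤ ρ → ‖g x - x‖ ≤ 1 / 2 * ‖x‖)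
    {y : V} (hy : ‖y‖ ≤ ρ) : ∃ x, g x = y ∧ ‖x‖ = ‖y‖ := by
  set s : Set V := Metric.closedBall 0 ρ
  -- A fixed point is a preimage of `y`. By additivity of `g`, closeness to the identity makes `F` a
  -- contraction of the ball.
  let F : V → V := fun x => y - (g x - x)
  have hmem : ∀ x, x ∈ s ↔ ‖x‖ ≤ ρ := fun x => mem_closedBall_zero_iff
  have hF : Set.MapsTo F s s := fun x hx => by
    rw [hmem] at hx ⊢
    refine (norm_sub_le_max _ _).trans (max_le hy ((hg x hx).trans ?_))
    linarith [norm_nonneg x]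
  have hK : ContractingWith (1 / 2) (hF.restrict F s s) := by
    refine ⟨by rw [← NNReal.coe_lt_coe]; norm_num, LipschitzWith.of_dist_le_mul fun x x' => ?_⟩
    rw [Subtype.dist_eq, Subtype.dist_eq, dist_eq_norm, dist_eq_norm]
    have h1 : F x - F x' = -(g (x - x') - (x - x' : V)) := by
      simp only [F, map_sub]
      abel
    change ‖F x - F x'‖ ≤ _
    rw [h1, norm_neg]
    refine (hg _ ?_).trans_eq (by simp)
    exact (norm_sub_le_max _ _).trans (max_le ((hmem _).1 x.2) ((hmem _).1 x'.2))
  obtain ⟨x, hx, hfix, -⟩ := hK.exists_fixedPoint' (Metric.isClosed_closedBall.isComplete) hF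
    ((hmem y).2 hy) (edist_ne_top _ _)
  have h1 : g x = y := by
    have h2 : y - (g x - x) = x := hfix
    have h3 : y - g x = 0 := by
      have : y - g x = (y - (g x - x)) - x := by abel
      rw [this, h2, sub_self]
    exact (sub_eq_zero.1 h3).symm
  refine ⟨x, h1, ?_⟩
  rw [← h1]
  exact (norm_eq_of_norm_sub_le (hg x ((hmem x).1 hx))).symm

/-- Forced by `c ^ q = c`. -/
lemma norm_algebraMap_le_one (𝔽 : Type*) {C : Type*} [Field 𝔽] [Finite 𝔽] [NormedField C]
    [Algebra 𝔽 C] (c : 𝔽) : ‖algebraMap 𝔽 C c‖ ≤ 1 := by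
  have := Fintype.ofFinite 𝔽
  by_contra! h
  have h1 := congrArg (fun c => ‖algebraMap 𝔽 C c‖) (FiniteField.pow_card c)
  simp only [map_pow, norm_pow] at h1
  exact (lt_self_pow₀ h Fintype.one_lt_card).ne' h1

namespace AndersonModule

variable {𝔽 : Type w} {A L : Type u} [Field 𝔽] [Finite 𝔽] [CommRing A] [Algebra 𝔽 A] [Field L]
  [Algebra 𝔽 L] [Algebra A L] {d : ℕ} (E : AndersonModule.{w, u} 𝔽 A L d)
  (κ : E.scheme ≅ gaPow 𝔽 L d) {C : Type u} [NormedField C] [Algebra L C]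

lemma isUniformInducing_coords :
    IsUniformInducing (fun x : E.Pts κ C => coords κ C x) := ⟨rfl⟩

lemma isUniformInducing_lieCoords :
    IsUniformInducing (fun x : E.LiePts κ C => lieCoords κ C x) := ⟨rfl⟩

instance : T0Space (E.Pts κ C) :=
  t0Space_of_injective_of_continuous
    (coords_bijective κ C).1 (E.isInducing_coords κ C).continuous

instance : T0Space (E.LiePts κ C) :=
  t0Space_of_injective_of_continuous
    (lieCoords_injective κ) (E.isInducing_lieCoords κ C).continuous

instance [CompleteSpace C] : CompleteSpace (E.Pts κ C) :=
  ((E.isUniformInducing_coords κ).completeSpace_congr (coords_bijective κ C).2).2 inferInstance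

instance [CompleteSpace C] : CompleteSpace (E.LiePts κ C) :=
  ((E.isUniformInducing_lieCoords κ).completeSpace_congr (lieCoords_surjective κ C)).2
    inferInstance

instance [IsUltrametricDist C] : IsUltrametricDist (E.Pts κ C) :=
  IsUltrametricDist.isUltrametricDist_of_isNonarchimedean_norm fun x y => by
    rw [norm_pts, norm_pts, norm_pts]
    exact (congrArg norm (map_add (coords κ C) x y)).trans_le
      (IsUltrametricDist.norm_add_le_max _ _)

instance [IsUltrametricDist C] : IsUltrametricDist (E.LiePts κ C) :=
  IsUltrametricDist.isUltrametricDist_of_isNonarchimedean_norm fun x y => by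
    rw [norm_liePts, norm_liePts, norm_liePts]
    exact (congrArg norm (map_add (lieCoords κ C) x y)).trans_le
      (IsUltrametricDist.norm_add_le_max _ _)

variable [Algebra 𝔽 C] [IsScalarTower 𝔽 L C]

instance : NormSMulLE 𝔽 (E.Pts κ C) where
  norm_smul_le c x := by
    rw [norm_pts, norm_pts]
    refine (congrArg norm (E.coords_smul_base κ c x)).trans_le ?_
    rw [norm_smul]
    exact mul_le_of_le_one_left (norm_nonneg _) (norm_algebraMap_le_one 𝔽 c)

instance : NormSMulLE 𝔽 (E.LiePts κ C) where
  norm_smul_le c x := by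
    rw [norm_liePts, norm_liePts]
    refine (congrArg norm (E.lieCoords_smul_base κ c x)).trans_le ?_
    rw [norm_smul]
    exact mul_le_of_le_one_left (norm_nonneg _) (norm_algebraMap_le_one 𝔽 c)

variable [IsUltrametricDist C] [CompleteSpace C]

variable {E} in
lemma isExponential_expLinear (h : ∃ f, E.IsExponential C f) :
    E.IsExponential C (E.expLinear C) := by
  rw [expLinear, dif_pos h]
  exact h.choose_spec

lemma exp_smul (a : A) (x : E.LiePts κ C) : E.exp κ C (a • x) = a • E.exp κ C x :=
  E.expLinear_equivariant C a x

variable {E} in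
/-- Near zero, the exponential function is isometric and bijective. -/
lemma exists_exp_local (h : ∃ f, E.IsExponential C f) : ∃ ρ : ℝ, 0 < ρ ∧
    (∀ x : E.LiePts κ C, ‖x‖ ≤ ρ → ‖E.exp κ C x‖ = ‖x‖) ∧
    ∀ y : E.Pts κ C, ‖y‖ ≤ ρ → ∃ x : E.LiePts κ C, E.exp κ C x = y ∧ ‖x‖ = ‖y‖ := by
  obtain ⟨e, he0, he⟩ := (isExponential_expLinear h).series κ
  let lc : E.LiePts κ C ≃+ (Fin d → C) :=
    AddEquiv.ofBijective (show E.LiePts κ C →+ (Fin d → C) from lieCoords κ C)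
      ⟨lieCoords_injective κ, lieCoords_surjective κ C⟩
  let g : (Fin d → C) →+ (Fin d → C) :=
    (show E.Pts κ C →+ (Fin d → C) from coords κ C).comp
      ((E.exp κ C : E.LiePts κ C →+ E.Pts κ C).comp lc.symm.toAddMonoidHom)
  have hg : ∀ x : E.LiePts κ C, g (lieCoords κ C x) = coords κ C (E.exp κ C x) := fun x =>
    congrArg (fun z : E.LiePts κ C => coords κ C (E.exp κ C z)) (lc.symm_apply_apply x)
  have hsum : ∀ y, HasSum (fun n => (e n).mulVec (frob 𝔽 n y)) (g y) := fun y => by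
    obtain ⟨x, rfl⟩ := lieCoords_surjective κ C y
    exact (hg x).symm ▸ he x
  obtain ⟨S, hS, hSg⟩ := exists_norm_series_sub_le hsum
  -- The radius is chosen so that the quadratic error `S * ‖x‖ ^ 2` is at most half of `‖x‖`.
  have hloc : ∀ x, ‖x‖ ≤ min 1 (1 / (2 * S)) → ‖g x - x‖ ≤ 1 / 2 * ‖x‖ := fun x hx => by
    have h1 := hSg x (hx.trans (min_le_left _ _))
    rw [he0, Matrix.one_mulVec] at h1
    have h2 := (le_div_iff₀ (by positivity)).1 (hx.trans (min_le_right _ _))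
    refine h1.trans ?_
    nlinarith [norm_nonneg x]
  refine ⟨min 1 (1 / (2 * S)), by positivity, fun x hx => ?_, fun y hy => ?_⟩
  · rw [norm_pts, ← hg]
    exact norm_eq_of_norm_sub_le (hloc _ hx)
  · obtain ⟨x, hx, hxy⟩ := exists_eq_of_norm_sub_le g hloc (y := coords κ C y) hy
    obtain ⟨z, rfl⟩ := lieCoords_surjective κ C x
    exact ⟨z, (coords_bijective κ C).1 ((hg z).symm.trans hx), hxy⟩

end AndersonModule

/-! ### Maps between completed tensor products -/

/-- A vector fixed by `T` would have to shrink, and a preimage of `y` is a fixed point of the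
contraction `x ↦ y + T x`. -/
lemma bijective_sub_of_norm_le {X : Type*} [NormedAddCommGroup X] [CompleteSpace X] (T : X →+ X)
    {c : ℝ} (hc0 : 0 ≤ c) (hc : c < 1) (hT : ∀ x, ‖T x‖ ≤ c * ‖x‖) :
    Function.Bijective fun x => x - T x := by
  refine ⟨fun x y hxy => ?_, fun y => ?_⟩
  · have h1 : x - y = T (x - y) := by
      have h2 : x - T x = y - T y := hxy
      have h3 : x - y - (T x - T y) = (x - T x) - (y - T y) := by abel
      rw [h2, sub_self, sub_eq_zero] at h3
      rw [map_sub, h3]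
    have h2 := hT (x - y)
    rw [← h1] at h2
    rw [← sub_eq_zero, ← norm_le_zero_iff]
    nlinarith [norm_nonneg (x - y)]
  · have hK : ContractingWith ⟨c, hc0⟩ fun x => y + T x :=
      ⟨hc, LipschitzWith.of_dist_le_mul fun x x' => by
        rw [dist_eq_norm, dist_eq_norm, add_sub_add_left_eq_sub, ← map_sub]
        exact hT _⟩
    have h1 : y + T (hK.fixedPoint _) = hK.fixedPoint _ := hK.fixedPoint_isFixedPt
    exact ⟨hK.fixedPoint _, sub_eq_iff_eq_add.2 h1.symm⟩

section

variable {𝔽 : Type w} {B : Type*} {V W U : Type*} [Field 𝔽] [CommRing B] [Algebra 𝔽 B]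
  [SeminormedAddCommGroup V] [Module 𝔽 V] [SeminormedAddCommGroup W] [Module 𝔽 W]
  [SeminormedAddCommGroup U] [Module 𝔽 U]

lemma norm_smul_hatTensor_le (b : B) (x : HatTensor 𝔽 B V) : ‖b • x‖ ≤ ‖x‖ := by
  induction x using UniformSpace.Completion.induction_on with
  | hp => exact isClosed_le (continuous_const_smul b).norm continuous_norm
  | ih x =>
    rw [← UniformSpace.Completion.coe_smul, UniformSpace.Completion.norm_coe,
      UniformSpace.Completion.norm_coe]
    exact gaussNorm_smul_le (𝔽 := 𝔽) b x

lemma hatMap_comp_apply (g : W →L[𝔽] U) (f : V →L[𝔽] W) (x : HatTensor 𝔽 B V) :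
    hatMap B (g.comp f) x = hatMap B g (hatMap B f x) := by
  induction x using UniformSpace.Completion.induction_on with
  | hp => exact isClosed_eq (by fun_prop) (by fun_prop)
  | ih x =>
    rw [hatMap_coe, hatMap_coe, hatMap_coe]
    refine congrArg _ ?_
    exact LinearMap.congr_fun (LinearMap.baseChange_comp (A := B) (f : V →ₗ[𝔽] W)
      (g : W →ₗ[𝔽] U)) x

lemma hatMap_id_apply (x : HatTensor 𝔽 B V) : hatMap B (ContinuousLinearMap.id 𝔽 V) x = x := by
  induction x using UniformSpace.Completion.induction_on with
  | hp => exact isClosed_eq (by fun_prop) (by fun_prop)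
  | ih x =>
    rw [hatMap_coe]
    refine congrArg _ ?_
    exact LinearMap.congr_fun (LinearMap.baseChange_id (R := 𝔽) (A := B) (M := V)) x

lemma hatMap_pow_apply (f : V →L[𝔽] V) (k : ℕ) (x : HatTensor 𝔽 B V) :
    hatMap B (f ^ k) x = ((hatMap B f : HatTensor 𝔽 B V →ₗ[B] HatTensor 𝔽 B V) ^ k) x := by
  induction k with
  | zero => exact hatMap_id_apply x
  | succ k ih =>
    rw [pow_succ', pow_succ', Module.End.mul_apply, ← ih]
    exact hatMap_comp_apply f (f ^ k) x

variable {J : Type*} [IsUltrametricDist V] [NormSMulLE 𝔽 V]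
  [T0Space V] [CompleteSpace V]

lemma norm_hatMap_le (β : Module.Basis J 𝔽 B) [IsUltrametricDist W] [NormSMulLE 𝔽 W] [T0Space W] [CompleteSpace W]
    (f : V →L[𝔽] W) {c : ℝ} (hc : 0 ≤ c) (hf : ∀ v, ‖f v‖ ≤ c * ‖v‖) (x : HatTensor 𝔽 B V) :
    ‖hatMap B f x‖ ≤ c * ‖x‖ := by
  refine norm_le_of_hatCoeff_le β (by positivity) fun j => ?_
  rw [hatCoeff_hatMap]
  refine (hf _).trans ?_
  gcongr
  exact norm_hatCoeff_le β j x

/-- If a power of `f` has a contracting inverse, then `1 ⊗ f - b ⊗ 1` is bijective. -/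
lemma bijective_hatMap_sub_smul (β : Module.Basis J 𝔽 B) (f h : V →L[𝔽] V) {k : ℕ} (hfh : f ^ k * h = 1)
    (hhf : h * f ^ k = 1) {c : ℝ} (hc0 : 0 ≤ c) (hc : c < 1) (hh : ∀ v, ‖h v‖ ≤ c * ‖v‖) (b : B) :
    Function.Bijective fun x : HatTensor 𝔽 B V => hatMap B f x - b • x := by
  let r : Module.End B (HatTensor 𝔽 B V) := (hatMap B f : HatTensor 𝔽 B V →ₗ[B] HatTensor 𝔽 B V)
  let s : Module.End B (HatTensor 𝔽 B V) := algebraMap B (Module.End B (HatTensor 𝔽 B V)) b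
  let H : Module.End B (HatTensor 𝔽 B V) := (hatMap B h : HatTensor 𝔽 B V →ₗ[B] HatTensor 𝔽 B V)
  have hrH : r ^ k * H = 1 := LinearMap.ext fun x => by
    refine (hatMap_pow_apply f k _).symm.trans ((hatMap_comp_apply (f ^ k) h x).symm.trans ?_)
    exact (congrArg (fun g => hatMap B g x) hfh).trans (hatMap_id_apply x)
  have hHr : H * r ^ k = 1 := LinearMap.ext fun x => by
    refine (congrArg (hatMap B h) (hatMap_pow_apply f k x).symm).trans
      ((hatMap_comp_apply h (f ^ k) x).symm.trans ?_)
    exact (congrArg (fun g => hatMap B g x) hhf).trans (hatMap_id_apply x)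
  have hrs : Commute r s := (Algebra.commutes b r).symm
  have hs : ∀ x, s x = b • x := fun x => rfl
  have hsk : ∀ x, (s ^ k) x = b ^ k • x := fun x => by
    rw [← map_pow]
    rfl
  -- Multiplication by `b ^ k` does not increase the Gauss norm, so `H * s ^ k` contracts for every
  -- `b`.
  have h1 : IsUnit (1 - H * s ^ k) := by
    rw [Module.End.isUnit_iff]
    refine bijective_sub_of_norm_le (H * s ^ k).toAddMonoidHom hc0 hc fun x => ?_
    change ‖hatMap B h ((s ^ k) x)‖ ≤ _
    refine (norm_hatMap_le β h hc0 hh _).trans ?_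
    rw [hsk]
    gcongr
    exact norm_smul_hatTensor_le _ _
  have h2 : IsUnit (r ^ k - s ^ k) := by
    have h3 : r ^ k - s ^ k = r ^ k * (1 - H * s ^ k) := by
      rw [mul_sub, mul_one, ← mul_assoc, hrH, one_mul]
    rw [h3]
    exact IsUnit.mul ⟨⟨r ^ k, H, hrH, hHr⟩, rfl⟩ h1
  -- `r - s` is one of two commuting factors of the unit `r ^ k - s ^ k`.
  have h3 : IsUnit (r - s) := by
    rw [← hrs.mul_geom_sum₂] at h2
    refine ((Commute.isUnit_mul_iff ?_).1 h2).1
    refine Commute.sum_right _ _ _ fun i _ => ?_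
    refine Commute.mul_right ?_ ?_
    · exact ((Commute.refl r).sub_left hrs.symm).pow_right _
    · exact (hrs.sub_left (Commute.refl s)).pow_right _
  have h4 := (Module.End.isUnit_iff _).1 h3
  exact h4

variable [IsUltrametricDist W] [NormSMulLE 𝔽 W] [T0Space W] [CompleteSpace W]

/-- If `f` is injective near zero, the kernel of its extension consists of finite sums. -/
lemma exists_coe_of_hatMap_eq_zero (β : Module.Basis J 𝔽 B) (f : V →L[𝔽] W) {ρ : ℝ} (hρ : 0 < ρ)
    (hf : ∀ v, ‖v‖ ≤ ρ → f v = 0 → v = 0) {y : HatTensor 𝔽 B V} (hy : hatMap B f y = 0) :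
    ∃ s : Finset J, y = UniformSpace.Completion.coe' (α := GaussTensor 𝔽 B V)
      (∑ j ∈ s, β j ⊗ₜ[𝔽] hatCoeff β j y : B ⊗[𝔽] V) ∧ ∀ j, f (hatCoeff β j y) = 0 := by
  have hker : ∀ j, f (hatCoeff β j y) = 0 := fun j => by
    rw [← hatCoeff_hatMap, hy, map_zero]
  -- All but finitely many coefficients are small elements of the kernel, hence zero.
  have hfin : {j | ¬ dist (hatCoeff β j y) 0 < ρ}.Finite :=
    Metric.tendsto_nhds.1 (tendsto_hatCoeff β y) ρ hρ
  refine ⟨hfin.toFinset, hatTensor_ext β fun j => ?_, hker⟩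
  classical
  have h1 : tensorCoeff β j (∑ i ∈ hfin.toFinset, β i ⊗ₜ[𝔽] hatCoeff β i y : B ⊗[𝔽] V) =
      ∑ i ∈ hfin.toFinset, β.coord j (β i) • hatCoeff β i y :=
    (map_sum (tensorCoeff β j : B ⊗[𝔽] V →+ V) _ _).trans
      (Finset.sum_congr rfl fun i _ => tensorCoeff_tmul β j (β i) _)
  refine Eq.trans ?_ ((hatCoeff_coe β j _).trans h1).symm
  simp only [Module.Basis.coord_apply, Module.Basis.repr_self, Finsupp.single_apply, ite_smul,
    one_smul, zero_smul, Finset.sum_ite_eq', Set.Finite.mem_toFinset, Set.mem_ofPred_eq]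
  split_ifs with h
  · rw [dist_zero_right] at h
    exact hf _ h.le (hker j)
  · rfl

/-- If `f` is open near zero, an element lies in the range of the extension of `f` as soon as all
its coefficients lie in the range of `f`. -/
lemma exists_hatMap_eq (β : Module.Basis J 𝔽 B) (f : V →L[𝔽] W) {ρ : ℝ} (hρ : 0 < ρ)
    (hf : ∀ v, ‖v‖ ≤ ρ → ∃ x, f x = v ∧ ‖x‖ = ‖v‖) {y : HatTensor 𝔽 B W}
    (hy : ∀ j, ∃ x, f x = hatCoeff β j y) : ∃ x, hatMap B f x = y := by
  -- Small coefficients get preimages of equal norm, so the preimages again form a null family; the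
  -- finitely many others may have any preimage.
  have h1 : ∀ j, ∃ x, f x = hatCoeff β j y ∧ (‖hatCoeff β j y‖ ≤ ρ → ‖x‖ = ‖hatCoeff β j y‖) := by
    intro j
    by_cases h : ‖hatCoeff β j y‖ ≤ ρ
    · obtain ⟨x, hx, hxn⟩ := hf _ h
      exact ⟨x, hx, fun _ => hxn⟩
    · obtain ⟨x, hx⟩ := hy j
      exact ⟨x, hx, fun h' => absurd h' h⟩
  choose g hg hgn using h1
  have hlim := tendsto_hatCoeff β y
  have hg0 : Filter.Tendsto g Filter.cofinite (nhds 0) := by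
    rw [tendsto_zero_iff_norm_tendsto_zero] at hlim ⊢
    refine hlim.congr' ?_
    filter_upwards [hlim.eventually (ge_mem_nhds hρ)] with j hj
    exact (hgn j hj).symm
  obtain ⟨x, hx⟩ := exists_hatCoeff_eq β hg0
  exact ⟨x, hatTensor_ext β fun j => by rw [hatCoeff_hatMap, hx, hg]⟩

end

/-! ### Special functions for a single element -/

section Shift

variable {𝔽 : Type w} {B : Type*} {V : Type*} [Field 𝔽] [CommRing B] [Algebra 𝔽 B]
  [SeminormedAddCommGroup V] [Module 𝔽 V] {ι : Type*} (β : Module.Basis (ℕ × ι) 𝔽 B) {b : B}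
  (hβ : ∀ n i, b * β (n, i) = β (n + 1, i))

include hβ in
lemma coord_mul_shift (c : B) (n : ℕ) (i : ι) :
    β.coord (n + 1, i) (b * c) = β.coord (n, i) c := by
  have h : β.coord (n + 1, i) ∘ₗ LinearMap.mulLeft 𝔽 b = β.coord (n, i) := by
    classical
    refine β.ext fun ⟨m, j⟩ => ?_
    simp only [LinearMap.comp_apply, LinearMap.mulLeft_apply, hβ, Module.Basis.coord_apply,
      Module.Basis.repr_self, Finsupp.single_apply, Prod.mk.injEq, Nat.add_right_cancel_iff]
  exact LinearMap.congr_fun h c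

variable [IsUltrametricDist V] [NormSMulLE 𝔽 V] [T0Space V] [CompleteSpace V]

include hβ in
-- Checked on pure tensors and extended by continuity. It turns the condition on `ω` at a single `t`
-- into a recursion between coefficients.
lemma hatCoeff_smul_shift (x : HatTensor 𝔽 B V) (n : ℕ) (i : ι) :
    hatCoeff β (n + 1, i) (b • x) = hatCoeff β (n, i) x := by
  have hc : Continuous fun x : HatTensor 𝔽 B V => hatCoeff β (n + 1, i) (b • x) :=
    (continuous_hatCoeff (V := V) β (n + 1, i)).comp (continuous_const_smul b)
  induction x using UniformSpace.Completion.induction_on with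
  | hp => exact isClosed_eq hc (continuous_hatCoeff (V := V) β (n, i))
  | ih x =>
    rw [← UniformSpace.Completion.coe_smul, hatCoeff_coe, hatCoeff_coe]
    induction x using TensorProduct.induction_on with
    | zero =>
      have h1 : (b • (0 : GaussTensor 𝔽 B V)) = 0 := smul_zero b
      have h2 : ∀ j, tensorCoeff β j (0 : GaussTensor 𝔽 B V) = 0 := fun j => map_zero _
      exact (congrArg _ h1).trans ((h2 _).trans (h2 _).symm)
    | tmul c v =>
      have h1 : (b • (c ⊗ₜ[𝔽] v : B ⊗[𝔽] V)) = (b * c) ⊗ₜ[𝔽] v := by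
        rw [TensorProduct.smul_tmul', smul_eq_mul]
      refine (congrArg (tensorCoeff β (n + 1, i)) h1).trans ?_
      rw [tensorCoeff_tmul, tensorCoeff_tmul, coord_mul_shift β hβ]
    | add x y hx hy =>
      have h1 : (b • (x + y : GaussTensor 𝔽 B V)) = b • x + b • y := smul_add b x y
      have h2 : ∀ j (x y : GaussTensor 𝔽 B V), tensorCoeff β j (x + y) =
        tensorCoeff β j x + tensorCoeff β j y := fun j => map_add _
      exact (congrArg _ h1).trans ((h2 _ _ _).trans
        ((congrArg₂ (· + ·) hx hy).trans (h2 _ _ _).symm))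

end Shift

namespace AndersonModule

variable {𝔽 : Type w} {A L : Type u} [Field 𝔽] [Finite 𝔽] [CommRing A] [Algebra 𝔽 A] [Field L]
  [Algebra 𝔽 L] [Algebra A L] {d : ℕ} (E : AndersonModule.{w, u} 𝔽 A L d)
  (κ : E.scheme ≅ gaPow 𝔽 L d) {C : Type u} [NormedField C] [Algebra L C]

lemma rightAct_expT (a : A) (y : E.LieT κ C) :
    E.expT κ C (E.rightActLie κ C a y) = E.rightAct κ C a (E.expT κ C y) := by
  have h : (E.exp κ C).comp (E.actLie κ C a) = (E.act κ C a).comp (E.exp κ C) :=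
    ContinuousLinearMap.ext fun x => E.expLinear_equivariant C a x
  exact (hatMap_comp_apply _ _ _).symm.trans
    ((congrArg (fun g => hatMap A g y) h).trans (hatMap_comp_apply _ _ _))

lemma rightActLie_comm (a b : A) (y : E.LieT κ C) :
    E.rightActLie κ C a (E.rightActLie κ C b y) = E.rightActLie κ C b (E.rightActLie κ C a y) := by
  have h : (E.actLie κ C a).comp (E.actLie κ C b) = (E.actLie κ C b).comp (E.actLie κ C a) :=
    ContinuousLinearMap.ext fun x => smul_comm a b x
  exact (hatMap_comp_apply _ _ _).symm.trans
    ((congrArg (fun g => hatMap A g y) h).trans (hatMap_comp_apply _ _ _))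

variable (C) in
/-- The canonical map `A ⊗ Λ_E → Lie_E(𝕋)` is linear. -/
def latticeToLieTLinear : A ⊗[𝔽] E.lattice κ C →ₗ[A] E.LieT κ C where
  toFun := E.latticeToLieT κ C
  map_add' x y := by
    refine (congrArg (UniformSpace.Completion.coe' (α := GaussTensor 𝔽 A (E.LiePts κ C)))
      (map_add (LinearMap.lTensor A ((E.lattice κ C).subtype.restrictScalars 𝔽)) x y)).trans ?_
    exact UniformSpace.Completion.coe_add (α := GaussTensor 𝔽 A (E.LiePts κ C)) _ _
  map_smul' a x := by
    refine (congrArg (UniformSpace.Completion.coe' (α := GaussTensor 𝔽 A (E.LiePts κ C)))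
      (map_smul (LinearMap.baseChange A ((E.lattice κ C).subtype.restrictScalars 𝔽)) a x)).trans ?_
    exact UniformSpace.Completion.coe_smul (X := GaussTensor 𝔽 A (E.LiePts κ C)) a _

lemma expT_latticeToLieT (x : A ⊗[𝔽] E.lattice κ C) :
    E.expT κ C (E.latticeToLieTLinear κ C x) = 0 := by
  have h1 : ∀ x : A ⊗[𝔽] E.lattice κ C, LinearMap.baseChange A
      (E.exp κ C : E.LiePts κ C →ₗ[𝔽] E.Pts κ C) (LinearMap.lTensor A
      ((E.lattice κ C).subtype.restrictScalars 𝔽) x) = 0 := fun x => by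
    induction x with
    | zero => simp
    | tmul a x =>
      have h : E.exp κ C x = 0 := x.2
      simp [h]
    | add x y hx hy => rw [map_add, map_add, hx, hy, add_zero]
  exact (hatMap_coe (E.exp κ C) _).trans ((congrArg _ (h1 x)).trans
    (UniformSpace.Completion.coe_zero (α := GaussTensor 𝔽 A (E.Pts κ C))))

variable (C) in
/-- The action of `1 ⊗ a` on `A ⊗ Λ_E`. -/
def rightActBase (a : A) : A ⊗[𝔽] E.lattice κ C →ₗ[A] A ⊗[𝔽] E.lattice κ C :=
  LinearMap.baseChange A ((LinearMap.lsmul A (E.lattice κ C) a).restrictScalars 𝔽)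

lemma rightActBase_tmul (a b : A) (x : E.lattice κ C) :
    E.rightActBase κ C a (b ⊗ₜ x) = b ⊗ₜ (a • x) := rfl

lemma rightActLie_latticeToLieT (a : A) (x : A ⊗[𝔽] E.lattice κ C) :
    E.rightActLie κ C a (E.latticeToLieTLinear κ C x) =
      E.latticeToLieTLinear κ C (E.rightActBase κ C a x) := by
  have h1 : ∀ x : A ⊗[𝔽] E.lattice κ C, LinearMap.baseChange A
      (E.actLie κ C a : E.LiePts κ C →ₗ[𝔽] E.LiePts κ C) (LinearMap.lTensor A
      ((E.lattice κ C).subtype.restrictScalars 𝔽) x) = LinearMap.lTensor A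
      ((E.lattice κ C).subtype.restrictScalars 𝔽) (E.rightActBase κ C a x) := fun x => by
    induction x with
    | zero => simp
    | tmul b x => rfl
    | add x y hx hy => rw [map_add, map_add, map_add, map_add, hx, hy]
  exact (hatMap_coe (E.actLie κ C a) _).trans (congrArg _ (h1 x))

lemma relativeProj_tmul (S : Subalgebra 𝔽 A) (a : A) (x : E.lattice κ C) :
    E.relativeProj κ C S (a ⊗ₜ x) = a ⊗ₜ x := rfl

lemma relativeProj_surjective (S : Subalgebra 𝔽 A) :
    Function.Surjective (E.relativeProj κ C S) := fun x => by
  induction x with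
  | zero => exact ⟨0, map_zero _⟩
  | tmul a x => exact ⟨a ⊗ₜ x, rfl⟩
  | add x y hx hy =>
    obtain ⟨x, rfl⟩ := hx
    obtain ⟨y, rfl⟩ := hy
    exact ⟨x + y, map_add _ _ _⟩

lemma relativeProj_rightActBase (S : Subalgebra 𝔽 A) (a : A) (x : A ⊗[𝔽] E.lattice κ C) :
    E.relativeProj κ C S (E.rightActBase κ C a x) =
      E.rightActLattice κ C S a (E.relativeProj κ C S x) := by
  induction x with
  | zero => simp
  | tmul b x => rfl
  | add x y hx hy => simp only [map_add, hx, hy]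

lemma rightActLattice_eq_smul (S : Subalgebra 𝔽 A) (s : S) (x : A ⊗[S] E.lattice κ C) :
    E.rightActLattice κ C S s x = (s : A) • x := by
  induction x with
  | zero => simp
  | tmul b x =>
    refine (TensorProduct.tmul_smul s b x).trans ?_
    exact TensorProduct.smul_tmul' s b x
  | add x y hx hy => rw [map_add, smul_add, hx, hy]

/-- The map `x ↦ exp (D⁻¹ x)` on `A ⊗ Λ_E`. -/
def deltaBase (D : E.LieT κ C ≃ₗ[A] E.LieT κ C) : A ⊗[𝔽] E.lattice κ C →ₗ[A] E.PtsT κ C :=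
  (E.expT κ C : E.LieT κ C →ₗ[A] E.PtsT κ C) ∘ₗ D.symm.toLinearMap ∘ₗ E.latticeToLieTLinear κ C

lemma deltaBase_apply (D : E.LieT κ C ≃ₗ[A] E.LieT κ C) (x : A ⊗[𝔽] E.lattice κ C) :
    E.deltaBase κ D x = E.expT κ C (D.symm (E.latticeToLieTLinear κ C x)) := rfl

section

variable {D : E.LieT κ C ≃ₗ[A] E.LieT κ C} {t : A}
  (hD : ∀ y, D y = E.rightActLie κ C t y - t • y)

include hD in
lemma apply_latticeToLieT (x : A ⊗[𝔽] E.lattice κ C) :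
    D (E.latticeToLieTLinear κ C x) =
      E.latticeToLieTLinear κ C (E.rightActBase κ C t x - t • x) := by
  rw [hD, rightActLie_latticeToLieT, map_sub, map_smul]

include hD in
lemma symm_rightActLie (a : A) (y : E.LieT κ C) :
    D.symm (E.rightActLie κ C a y) = E.rightActLie κ C a (D.symm y) := by
  rw [LinearEquiv.symm_apply_eq, hD, rightActLie_comm, ← map_smul, ← map_sub, ← hD,
    LinearEquiv.apply_symm_apply]

include hD in
lemma deltaBase_rightActBase (a : A) (x : A ⊗[𝔽] E.lattice κ C) :
    E.deltaBase κ D (E.rightActBase κ C a x) = E.rightAct κ C a (E.deltaBase κ D x) := by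
  rw [deltaBase_apply, ← rightActLie_latticeToLieT, E.symm_rightActLie κ hD, rightAct_expT]
  rfl

include hD in
-- The difference of the two actions of `t` is `D`, which cancels `D⁻¹` and leaves an element of `A
-- ⊗ Λ`, killed by `expT`. This is why the map descends to the tensor product over `𝔽[t]`.
lemma deltaBase_rightActBase_self (x : A ⊗[𝔽] E.lattice κ C) :
    E.deltaBase κ D (E.rightActBase κ C t x) = t • E.deltaBase κ D x := by
  rw [← sub_eq_zero, ← map_smul, ← map_sub, deltaBase_apply, ← E.apply_latticeToLieT κ hD,
    LinearEquiv.symm_apply_apply, expT_latticeToLieT]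

include hD in
lemma deltaBase_tmul_smul (s : Algebra.adjoin 𝔽 {t}) (x : E.lattice κ C) :
    E.deltaBase κ D (1 ⊗ₜ ((s : A) • x)) = (s : A) • E.deltaBase κ D (1 ⊗ₜ x) := by
  obtain ⟨s, hs⟩ := s
  simp only
  induction hs using Algebra.adjoin_induction generalizing x with
  | mem s hs =>
    rw [Set.mem_singleton_iff] at hs
    subst hs
    rw [← E.deltaBase_rightActBase_self κ hD, rightActBase_tmul]
  | algebraMap c =>
    rw [algebraMap_smul, ← map_smul, TensorProduct.smul_tmul', TensorProduct.tmul_smul,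
      TensorProduct.smul_tmul', ← algebraMap_smul A c (1 : A)]
  | add a b _ _ ha hb => rw [add_smul, TensorProduct.tmul_add, map_add, ha, hb, add_smul]
  | mul a b _ _ ha hb => rw [mul_smul, ha, hb, mul_smul]

/-- The map induced by `x ↦ exp (D⁻¹ x)` on the tensor product over `𝔽[t]`. -/
def deltaTilde : A ⊗[Algebra.adjoin 𝔽 {t}] E.lattice κ C →ₗ[A] E.PtsT κ C :=
  LinearMap.liftBaseChange A
    { toFun := fun x => E.deltaBase κ D (1 ⊗ₜ x)
      map_add' := fun x y => by rw [TensorProduct.tmul_add, map_add]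
      map_smul' := fun s x => E.deltaBase_tmul_smul κ hD s x }

lemma deltaTilde_relativeProj (x : A ⊗[𝔽] E.lattice κ C) :
    E.deltaTilde κ hD (E.relativeProj κ C _ x) = E.deltaBase κ D x := by
  induction x with
  | zero => simp
  | tmul a x =>
    rw [relativeProj_tmul, deltaTilde, LinearMap.liftBaseChange_tmul]
    change a • E.deltaBase κ D (1 ⊗ₜ x) = _
    rw [← map_smul, TensorProduct.smul_tmul', smul_eq_mul, mul_one]
  | add x y hx hy => rw [map_add, map_add, hx, hy, map_add]

lemma deltaTilde_rightActLattice (a : A) (x : A ⊗[Algebra.adjoin 𝔽 {t}] E.lattice κ C) :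
    E.deltaTilde κ hD (E.rightActLattice κ C _ a x) = E.rightAct κ C a (E.deltaTilde κ hD x) := by
  obtain ⟨x, rfl⟩ := E.relativeProj_surjective κ _ x
  rw [← relativeProj_rightActBase, deltaTilde_relativeProj, deltaTilde_relativeProj,
    E.deltaBase_rightActBase κ hD]

end

end AndersonModule

/-! ### Invertibility of `D`, and the kernel and image of `deltaTilde` -/

namespace AndersonModule

variable {𝔽 : Type w} {A L : Type u} [Field 𝔽] [Finite 𝔽] [CommRing A] [Algebra 𝔽 A] [Field L]
  [Algebra 𝔽 L] [Algebra A L] {d : ℕ} (E : AndersonModule.{w, u} 𝔽 A L d)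
  (κ : E.scheme ≅ gaPow 𝔽 L d) {C : Type u} [NormedField C] [Algebra L C] [Algebra 𝔽 C]
  [IsScalarTower 𝔽 L C] [IsUltrametricDist C] [CompleteSpace C]

/-- Multiplication by a scalar on the Lie algebra, as a continuous map. -/
def scaleLie (c : C) : E.LiePts κ C →L[𝔽] E.LiePts κ C where
  toLinearMap := (lieScale E.scheme c : lie E.scheme C →ₗ[𝔽] lie E.scheme C)
  cont := by
    refine (E.isInducing_lieCoords κ C).continuous_iff.2 ?_
    have h : Continuous fun x : E.LiePts κ C => c • lieCoords κ C x :=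
      (E.isInducing_lieCoords κ C).continuous.const_smul c
    exact h.congr fun x => (lieCoords_lieScale κ c x).symm

lemma lieCoords_scaleLie (c : C) (x : E.LiePts κ C) :
    lieCoords κ C (E.scaleLie κ c x) = c • lieCoords κ C x := lieCoords_lieScale κ c x

lemma lieCoords_actLie_pow (a : A) (k : ℕ) (x : E.LiePts κ C) :
    lieCoords κ C ((E.actLie κ C a ^ k) x) =
      (E.actCoeff C κ κ a 0 ^ k).mulVec (lieCoords κ C x) := by
  induction k with
  | zero => rw [pow_zero, pow_zero, Matrix.one_mulVec]; rfl
  | succ k ih =>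
    rw [pow_succ', pow_succ', ← Matrix.mulVec_mulVec, ← ih]
    exact E.lieCoords_action κ κ a _

variable {t : A} {k : ℕ} {ϑ : C}

/-- `1 ⊗ ∂t - t ⊗ 1` is bijective as soon as the tangent action of a power of `t` is
multiplication by a large scalar. -/
lemma bijective_rightActLie_sub_smul {J : Type*} (β : Module.Basis J 𝔽 A) (hϑ : 1 < ‖ϑ‖)
    (ht : E.actCoeff C κ κ t 0 ^ k = ϑ • 1) :
    Function.Bijective fun y : E.LieT κ C => E.rightActLie κ C t y - t • y := by
  have hϑ0 : ϑ ≠ 0 := norm_pos_iff.1 (zero_lt_one.trans hϑ)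
  have hpow : ∀ x : E.LiePts κ C,
      lieCoords κ C ((E.actLie κ C t ^ k) x) = ϑ • lieCoords κ C x := fun x => by
    rw [lieCoords_actLie_pow, ht, Matrix.smul_mulVec, Matrix.one_mulVec]
  refine bijective_hatMap_sub_smul β (E.actLie κ C t) (E.scaleLie κ ϑ⁻¹) (k := k) (c := ‖ϑ‖⁻¹)
    ?_ ?_ (by positivity) (inv_lt_one_of_one_lt₀ hϑ) (fun x => ?_) t
  · refine ContinuousLinearMap.ext fun x => lieCoords_injective κ ?_
    refine (hpow _).trans ((congrArg (ϑ • ·) (E.lieCoords_scaleLie κ ϑ⁻¹ x)).trans ?_)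
    rw [smul_smul, mul_inv_cancel₀ hϑ0, one_smul]
    rfl
  · refine ContinuousLinearMap.ext fun x => lieCoords_injective κ ?_
    refine (E.lieCoords_scaleLie κ _ _).trans ((congrArg (ϑ⁻¹ • ·) (hpow x)).trans ?_)
    rw [smul_smul, inv_mul_cancel₀ hϑ0, one_smul]
    rfl
  · rw [norm_liePts, norm_liePts, lieCoords_scaleLie, norm_smul, norm_inv]

/-- `A` is flat over the field `𝔽`, and coefficients separate the elements of `A ⊗ Lie`, so nothing
is lost in the completion. -/
lemma latticeToLieTLinear_injective {J : Type*} (β : Module.Basis J 𝔽 A) :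
    Function.Injective (E.latticeToLieTLinear κ C) := by
  have h1 : Function.Injective (LinearMap.lTensor A ((E.lattice κ C).subtype.restrictScalars 𝔽)) :=
    Module.Flat.lTensor_preserves_injective_linearMap _ Subtype.val_injective
  have h2 : ∀ y : GaussTensor 𝔽 A (E.LiePts κ C),
      UniformSpace.Completion.coe' (α := GaussTensor 𝔽 A (E.LiePts κ C)) y = 0 → y = 0 := by
    intro y hy
    obtain ⟨s, -, hs⟩ := exists_finset_sum_tmul β y
    rw [hs]
    refine Finset.sum_eq_zero fun j _ => ?_
    rw [← hatCoeff_coe, hy, map_zero, TensorProduct.tmul_zero]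
    rfl
  rw [injective_iff_map_eq_zero]
  intro x hx
  exact h1 ((h2 _ hx).trans (map_zero _).symm)

variable {E} in
-- The coefficients of `y` are a null family in `Λ`. Since `exp` preserves norms near zero, `Λ` is
-- discrete and the family is finite.
lemma exists_latticeToLieT_eq {J : Type*} (β : Module.Basis J 𝔽 A)
    (h : ∃ f, E.IsExponential C f) {y : E.LieT κ C} (hy : E.expT κ C y = 0) :
    ∃ x, E.latticeToLieTLinear κ C x = y := by
  obtain ⟨ρ, hρ, hiso, -⟩ := exists_exp_local κ h
  obtain ⟨s, hs, hker⟩ := exists_coe_of_hatMap_eq_zero β (E.exp κ C) hρ (fun x hx h0 => by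
    have := hiso x hx
    rw [h0, norm_zero] at this
    exact (inseparable_zero_iff_norm.2 this.symm).eq) hy
  refine ⟨∑ j ∈ s, β j ⊗ₜ ⟨hatCoeff β j y, hker j⟩, ?_⟩
  refine Eq.trans ?_ hs.symm
  refine congrArg (UniformSpace.Completion.coe' (α := GaussTensor 𝔽 A (E.LiePts κ C))) ?_
  exact map_sum (LinearMap.lTensor A ((E.lattice κ C).subtype.restrictScalars 𝔽)) _ _

section

variable {D : E.LieT κ C ≃ₗ[A] E.LieT κ C} (hD : ∀ y, D y = E.rightActLie κ C t y - t • y)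

variable {E} in
-- If `exp (D⁻¹ x) = 0`, then `D⁻¹ x = z` lies in `A ⊗ Λ`, and `x = D z = (1 ⊗ t - t ⊗ 1) z` becomes
-- zero over `𝔽[t]`.
lemma deltaTilde_injective {J : Type*} (β : Module.Basis J 𝔽 A)
    (h : ∃ f, E.IsExponential C f) : Function.Injective (E.deltaTilde κ hD) := by
  rw [injective_iff_map_eq_zero]
  intro x hx
  obtain ⟨x, rfl⟩ := E.relativeProj_surjective κ _ x
  rw [deltaTilde_relativeProj, deltaBase_apply] at hx
  obtain ⟨z, hz⟩ := exists_latticeToLieT_eq κ β h hx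
  rw [LinearEquiv.eq_symm_apply, E.apply_latticeToLieT κ hD] at hz
  rw [← E.latticeToLieTLinear_injective κ β hz, map_sub, relativeProj_rightActBase, map_smul]
  rw [sub_eq_zero]
  exact E.rightActLattice_eq_smul κ (Algebra.adjoin 𝔽 {t})
    ⟨t, Algebra.self_mem_adjoin_singleton 𝔽 t⟩ _

lemma smul_deltaTilde (x : A ⊗[Algebra.adjoin 𝔽 {t}] E.lattice κ C) :
    t • E.deltaTilde κ hD x = E.rightAct κ C t (E.deltaTilde κ hD x) := by
  rw [← deltaTilde_rightActLattice, ← map_smul]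
  exact congrArg _ (E.rightActLattice_eq_smul κ (Algebra.adjoin 𝔽 {t})
    ⟨t, Algebra.self_mem_adjoin_singleton 𝔽 t⟩ _).symm

variable {E} in
include hD in
-- Once `ω = expT y`, the condition on `ω` says that `expT` kills `D y`, so `D y` comes from `A ⊗ Λ`
-- and is the required preimage.
lemma exists_deltaTilde_eq {ι : Type*} [Finite ι] (β : Module.Basis (ℕ × ι) 𝔽 A)
    (hβ : ∀ n i, t * β (n, i) = β (n + 1, i)) (h : ∃ f, E.IsExponential C f) {ω : E.PtsT κ C}
    (hω : t • ω = E.rightAct κ C t ω) : ∃ x, E.deltaTilde κ hD x = ω := by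
  obtain ⟨ρ, hρ, -, hsurj⟩ := exists_exp_local κ h
  have hshift : ∀ n i, hatCoeff β (n, i) ω = t • hatCoeff β (n + 1, i) ω := fun n i => by
    rw [← hatCoeff_smul_shift β hβ, hω]
    exact hatCoeff_hatMap β (E.act κ C t) _ ω
  have hshift' : ∀ m n i, hatCoeff β (n, i) ω = t ^ m • hatCoeff β (n + m, i) ω := by
    intro m
    induction m with
    | zero => intro n i; simp
    | succ m ih => intro n i; rw [ih, hshift, smul_smul, ← pow_succ]; rfl
  -- The coefficient equals `t ^ m` times one that, for large `m`, lies in the ball covered by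
  -- `exp`; equivariance moves `t ^ m` to the preimage.
  have hrange : ∀ j, ∃ x, E.exp κ C x = hatCoeff β j ω := fun ⟨n, i⟩ => by
    have hlim : Filter.Tendsto (fun m => hatCoeff β (n + m, i) ω) Filter.atTop (nhds 0) := by
      rw [← Nat.cofinite_eq_atTop]
      refine (tendsto_hatCoeff β ω).comp (Function.Injective.tendsto_cofinite fun a b hab => ?_)
      simpa using hab
    obtain ⟨m, hm⟩ := (hlim.norm.eventually (ge_mem_nhds (by simpa using hρ))).exists
    obtain ⟨x, hx, -⟩ := hsurj _ hm
    exact ⟨t ^ m • x, by rw [exp_smul, hx, ← hshift']⟩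
  obtain ⟨y, hy⟩ := exists_hatMap_eq β (E.exp κ C) hρ hsurj hrange
  have hy' : E.expT κ C y = ω := hy
  have h1 : E.expT κ C (D y) = 0 := by
    rw [hD, map_sub, rightAct_expT, map_smul, hy', hω, sub_self]
  obtain ⟨x, hx⟩ := exists_latticeToLieT_eq κ β h h1
  exact ⟨E.relativeProj κ C _ x, by
    rw [deltaTilde_relativeProj, deltaBase_apply, hx, LinearEquiv.symm_apply_apply, hy']⟩

/-- The elements of the tensor product of `A` and `Λ_E` on which the two actions coincide. -/
def diagonalSubmodule (S : Subalgebra 𝔽 A) : Submodule A (A ⊗[S] E.lattice κ C) where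
  carrier := E.diagonalPart κ C S
  add_mem' {x y} hx hy a := by rw [smul_add, map_add, hx a, hy a]
  zero_mem' a := by rw [smul_zero, map_zero]
  smul_mem' c x hx a := by
    have h : ∀ y, E.rightActLattice κ C S a (c • y) = c • E.rightActLattice κ C S a y := fun y =>
      map_smul (LinearMap.baseChange A ((LinearMap.lsmul A (E.lattice κ C) a).restrictScalars S))
        c y
    rw [h, ← hx a, smul_comm]

variable {E} in
/-- The diagonal part of `A ⊗ Λ_E` is isomorphic to the module of special functions. -/
def diagonalEquiv {ι : Type*} [Finite ι] (β : Module.Basis (ℕ × ι) 𝔽 A)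
    (hβ : ∀ n i, t * β (n, i) = β (n + 1, i)) (h : ∃ f, E.IsExponential C f) :
    E.diagonalSubmodule κ (C := C) (Algebra.adjoin 𝔽 {t}) ≃ₗ[A] E.specialFunctions κ C :=
  -- `deltaTilde` is injective and respects both actions, so equality of the actions can be tested
  -- on `x`.
  have hmem : ∀ x, E.deltaTilde κ hD x ∈ E.specialFunctions κ C ↔
      x ∈ E.diagonalSubmodule κ (C := C) (Algebra.adjoin 𝔽 {t}) := fun x => by
    refine forall_congr' fun a => ?_
    rw [← deltaTilde_rightActLattice, ← map_smul]
    exact (deltaTilde_injective κ hD β h).eq_iff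
  LinearEquiv.ofBijective
    ((E.deltaTilde κ hD).restrict fun x hx => (hmem x).2 hx) <| by
    refine ⟨fun x y hxy => ?_, fun ω => ?_⟩
    · exact Subtype.ext (deltaTilde_injective κ hD β h (congrArg Subtype.val hxy))
    · obtain ⟨x, hx⟩ := exists_deltaTilde_eq κ hD β hβ h (ω.2 t)
      exact ⟨⟨x, (hmem x).1 (hx ▸ ω.2)⟩, Subtype.ext hx⟩

end

end AndersonModule

/-! ### The diagonal part of `A ⊗ M` and the different -/

section Diagonal

variable {S A M : Type*} [CommRing S] [CommRing A] [Algebra S A] [AddCommGroup M] [Module A M]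
  [Module S M] [IsScalarTower S A M]

variable (M) in
/-- The contraction `A ⊗ M → M` along a linear form on `A`. -/
def contraction (f : A →ₗ[S] S) : A ⊗[S] M →ₗ[S] M :=
  (TensorProduct.lid S M).toLinearMap ∘ₗ LinearMap.rTensor M f

@[simp]
lemma contraction_tmul (f : A →ₗ[S] S) (a : A) (m : M) : contraction M f (a ⊗ₜ m) = f a • m := by
  simp [contraction]

lemma contraction_smul (f : A →ₗ[S] S) (a : A) (x : A ⊗[S] M) :
    contraction M f (a • x) = contraction M (f ∘ₗ LinearMap.mulLeft S a) x := by
  induction x with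
  | zero => simp
  | tmul b m => rw [TensorProduct.smul_tmul', contraction_tmul, contraction_tmul]; rfl
  | add x y hx hy => rw [smul_add, map_add, map_add, hx, hy]

lemma contraction_lTensor (f : A →ₗ[S] S) (a : A) (x : A ⊗[S] M) :
    contraction M f (LinearMap.lTensor A ((LinearMap.lsmul A M a).restrictScalars S) x) =
      a • contraction M f x := by
  induction x with
  | zero => simp
  | tmul b m =>
    rw [LinearMap.lTensor_tmul, contraction_tmul, contraction_tmul]
    exact smul_comm (f b) a m
  | add x y hx hy => simp only [map_add, smul_add, hx, hy]

lemma contraction_sum {J : Type*} (s : Finset J) (f : J → A →ₗ[S] S) (x : A ⊗[S] M) :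
    contraction M (∑ j ∈ s, f j) x = ∑ j ∈ s, contraction M (f j) x := by
  induction x with
  | zero => simp
  | tmul b m => simp [Finset.sum_smul]
  | add x y hx hy => simp only [map_add, hx, hy, Finset.sum_add_distrib]

variable {ι : Type*} [Fintype ι] (b : Module.Basis ι S A)

lemma sum_tmul_contraction (x : A ⊗[S] M) :
    ∑ i, b i ⊗ₜ[S] contraction M (b.coord i) x = x := by
  induction x with
  | zero => simp
  | tmul a m =>
    conv_rhs => rw [← b.sum_repr a, TensorProduct.sum_tmul]
    refine Finset.sum_congr rfl fun i _ => ?_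
    rw [contraction_tmul, TensorProduct.smul_tmul, b.coord_apply]
  | add x y hx hy =>
    simp only [map_add, TensorProduct.tmul_add, Finset.sum_add_distrib, hx, hy]

/-- The `i`-th summand is the `i`-th diagonal entry of the multiplication matrix. -/
lemma sum_coord_comp_mulLeft :
    ∑ i, b.coord i ∘ₗ LinearMap.mulLeft S (b i) = Algebra.trace S A := by
  classical
  refine LinearMap.ext fun a => ?_
  rw [Algebra.trace_eq_matrix_trace b, Matrix.trace, LinearMap.sum_apply]
  refine Finset.sum_congr rfl fun i _ => ?_
  rw [Matrix.diag_apply, Algebra.leftMulMatrix_eq_repr_mul, mul_comm]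
  rfl

variable {x : A ⊗[S] M}
  (hx : ∀ a : A, a • x = LinearMap.lTensor A ((LinearMap.lsmul A M a).restrictScalars S) x)

include hx in
-- A diagonal `x` thus defines an `A`-linear map from `Hom_S(A, S)` to `M`, which determines `x` by
-- `sum_tmul_contraction`.
lemma contraction_comp_mulLeft (f : A →ₗ[S] S) (a : A) :
    contraction M (f ∘ₗ LinearMap.mulLeft S a) x = a • contraction M f x := by
  rw [← contraction_smul, hx, contraction_lTensor]

include b hx in
/-- On the diagonal part, the multiplication is the contraction along the trace. -/
lemma contraction_trace :
    contraction M (Algebra.trace S A) x =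
      LinearMap.liftBaseChange A (LinearMap.id : M →ₗ[S] M) x := by
  conv_rhs => rw [← sum_tmul_contraction b x]
  rw [← sum_coord_comp_mulLeft b, contraction_sum, map_sum]
  refine Finset.sum_congr rfl fun i _ => ?_
  rw [contraction_comp_mulLeft hx]
  simp

include b hx in
-- The contraction along the trace vanishes. Every form has a multiple, by a nonzerodivisor on `M`,
-- that is a multiple of the trace, so all contractions vanish.
lemma eq_zero_of_liftBaseChange_eq_zero
    (htor : ∀ f : A →ₗ[S] S, ∃ n a : A, (∀ m : M, n • m = 0 → m = 0) ∧
      f ∘ₗ LinearMap.mulLeft S n = Algebra.trace S A ∘ₗ LinearMap.mulLeft S a)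
    (h0 : LinearMap.liftBaseChange A (LinearMap.id : M →ₗ[S] M) x = 0) : x = 0 := by
  rw [← sum_tmul_contraction b x]
  refine Finset.sum_eq_zero fun i _ => ?_
  obtain ⟨n, a, hn, h⟩ := htor (b.coord i)
  rw [hn (contraction M (b.coord i) x), TensorProduct.tmul_zero]
  rw [← contraction_comp_mulLeft hx, h, contraction_comp_mulLeft hx, contraction_trace b hx, h0,
    smul_zero]

include b hx in
-- If the trace is a sum of forms `f(a ·)` with `a ∈ I`, contraction along it is a sum of elements
-- `a • contraction M f x`.
lemma liftBaseChange_mem_smul_top {I : Ideal A}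
    (hI : Algebra.trace S A ∈ AddSubmonoid.closure
      {g : A →ₗ[S] S | ∃ a ∈ I, ∃ f : A →ₗ[S] S, g = f ∘ₗ LinearMap.mulLeft S a}) :
    LinearMap.liftBaseChange A (LinearMap.id : M →ₗ[S] M) x ∈ I • (⊤ : Submodule A M) := by
  rw [← contraction_trace b hx]
  generalize Algebra.trace S A = g at hI
  induction hI using AddSubmonoid.closure_induction with
  | mem g hg =>
    obtain ⟨a, ha, f, rfl⟩ := hg
    rw [contraction_comp_mulLeft hx]
    exact Submodule.smul_mem_smul ha trivial
  | zero => simp [contraction]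
  | add f g _ _ hf hg =>
    have h : contraction M (f + g) x = contraction M f x + contraction M g x := by
      simp [contraction, LinearMap.rTensor_add]
    rw [h]
    exact add_mem hf hg

include b in
-- The witness is `∑ b_i ⊗ e_i m`, where `e_i` represents the form `b_i^*(a ·)` through the trace.
lemma exists_liftBaseChange_eq_smul
    (hnd : ∀ e : A, Algebra.trace S A ∘ₗ LinearMap.mulLeft S e = 0 → e = 0) {a : A}
    (ha : ∀ f : A →ₗ[S] S, ∃ e : A,
      f ∘ₗ LinearMap.mulLeft S a = Algebra.trace S A ∘ₗ LinearMap.mulLeft S e) (m : M) :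
    ∃ x : A ⊗[S] M, (∀ a : A, a • x =
        LinearMap.lTensor A ((LinearMap.lsmul A M a).restrictScalars S) x) ∧
      LinearMap.liftBaseChange A (LinearMap.id : M →ₗ[S] M) x = a • m := by
  choose e he using fun i => ha (b.coord i)
  have he' : ∀ i c, b.coord i (a * c) = Algebra.trace S A (e i * c) := fun i c =>
    LinearMap.congr_fun (he i) c
  have hnd' : ∀ c c' : A, (∀ y, Algebra.trace S A (c * y) = Algebra.trace S A (c' * y)) →
      c = c' := fun c c' h => by
    refine sub_eq_zero.1 (hnd _ (LinearMap.ext fun y => ?_))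
    simp [sub_mul, h y]
  -- Paired with `y` under the trace, both sides give `Tr(a y)`, the trace being the sum of the
  -- forms `b_i^*(b_i ·)`.
  have h1 : ∑ i, b i * e i = a := hnd' _ _ fun y => by
    rw [Finset.sum_mul, map_sum]
    conv_rhs => rw [← sum_coord_comp_mulLeft b, LinearMap.sum_apply]
    refine Finset.sum_congr rfl fun i _ => ?_
    rw [mul_comm (b i), mul_assoc, ← he', LinearMap.comp_apply, LinearMap.mulLeft_apply,
      mul_left_comm]
  -- Paired with `y` under the trace, both sides give `b_k^*(a c y)`.
  have h2 : ∀ (c : A) k, ∑ i, b.coord k (c * b i) • e i = c * e k := fun c k => hnd' _ _ fun y => by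
    rw [Finset.sum_mul, map_sum, mul_comm c, mul_assoc, ← he', mul_left_comm]
    conv_rhs => rw [← b.sum_repr (a * y), Finset.mul_sum, map_sum]
    refine Finset.sum_congr rfl fun i _ => ?_
    rw [smul_mul_assoc, map_smul, ← he', mul_smul_comm, map_smul, smul_eq_mul, smul_eq_mul,
      mul_comm, b.coord_apply]
  refine ⟨∑ i, b i ⊗ₜ (e i • m), fun c => ?_, ?_⟩
  · rw [Finset.smul_sum, map_sum]
    have h3 : ∀ i, c • (b i ⊗ₜ[S] (e i • m)) =
        ∑ k, b k ⊗ₜ[S] ((b.coord k (c * b i) • e i) • m) := fun i => by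
      rw [TensorProduct.smul_tmul', smul_eq_mul]
      conv_lhs => rw [← b.sum_repr (c * b i), TensorProduct.sum_tmul]
      refine Finset.sum_congr rfl fun k _ => ?_
      rw [TensorProduct.smul_tmul, b.coord_apply, smul_assoc]
    rw [Finset.sum_congr rfl fun i _ => h3 i, Finset.sum_comm]
    refine Finset.sum_congr rfl fun k _ => ?_
    rw [← TensorProduct.tmul_sum, ← Finset.sum_smul, h2, mul_smul]
    rfl
  · rw [map_sum, ← h1, Finset.sum_smul]
    exact Finset.sum_congr rfl fun i _ => by simp [mul_smul]

end Diagonal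

/-! ### Trace duality -/

section TraceDual

open nonZeroDivisors

variable {S A Q K : Type*} [CommRing S] [IsDomain S] [CommRing A] [Field Q] [Field K]
  [Algebra S A] [Algebra S Q] [IsFractionRing S Q] [Algebra A K] [IsFractionRing A K]
  [Algebra Q K] [Algebra S K] [IsScalarTower S Q K] [IsScalarTower S A K]
  [IsLocalization (Algebra.algebraMapSubmonoid A S⁰) K]
  [FiniteDimensional Q K] [Algebra.IsSeparable Q K]

variable {ι : Type*} [Finite ι] (b : Module.Basis ι S A)

variable (Q K) in
include b in
-- Extend `f` to a `Q`-linear form on `K`; the trace form of a separable extension is nondegenerate.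
-- With `exists_form_of_trace_mem`, `Hom_S(A, S)` is the trace dual of `A`.
lemma exists_trace_mul_eq (f : A →ₗ[S] S) :
    ∃ x : K, ∀ a, algebraMap S Q (f a) = Algebra.trace Q K (x * algebraMap A K a) := by
  let b' : Module.Basis ι Q K := b.localizationLocalization Q S⁰ K
  let g : K →ₗ[Q] Q := b'.constr Q fun i => algebraMap S Q (f (b i))
  let x : K := ((Algebra.traceForm Q K).toDual (traceForm_nondegenerate Q K)).symm g
  refine ⟨x, fun a => ?_⟩
  have h1 : ∀ y, Algebra.trace Q K (x * y) = g y := fun y =>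
    LinearMap.BilinForm.apply_toDual_symm_apply (hB := traceForm_nondegenerate Q K) g y
  have h2 : (Algebra.linearMap S Q ∘ₗ f : A →ₗ[S] Q) =
      (g.restrictScalars S) ∘ₗ (IsScalarTower.toAlgHom S A K).toLinearMap := by
    refine b.ext fun i => ?_
    have h3 : algebraMap A K (b i) = b' i := (b.localizationLocalization_apply Q S⁰ K i).symm
    simp [h3, g]
  rw [h1]
  exact LinearMap.congr_fun h2 a

variable (Q) in
lemma exists_form_of_trace_mem {x : K}
    (hx : ∀ a : A, Algebra.trace Q K (x * algebraMap A K a) ∈ (algebraMap S Q).range) :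
    ∃ f : A →ₗ[S] S, ∀ a,
      algebraMap S Q (f a) = Algebra.trace Q K (x * algebraMap A K a) := by
  choose f hf using hx
  have hinj := IsFractionRing.injective S Q
  refine ⟨{ toFun := f, map_add' := fun a c => hinj ?_, map_smul' := fun s a => hinj ?_ }, hf⟩
  · rw [map_add, hf, hf, hf, map_add, mul_add, map_add]
  · rw [RingHom.id_apply, smul_eq_mul, map_mul (algebraMap S Q), hf, hf, Algebra.smul_def, map_mul (algebraMap A K),
      ← IsScalarTower.algebraMap_apply, IsScalarTower.algebraMap_apply S Q K, mul_left_comm,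
      ← Algebra.smul_def, map_smul, smul_eq_mul]

variable (Q K) in
include b in
lemma algebraMap_trace_eq (a : A) :
    algebraMap S Q (Algebra.trace S A a) = Algebra.trace Q K (algebraMap A K a) := by
  have := Module.Free.of_basis b
  have := Module.Finite.of_basis b
  exact (Algebra.trace_localization S S⁰ a).symm

variable (Q K) in
include Q K b in
-- The element of `K` representing `f` is a fraction `a / n`.
lemma exists_comp_mulLeft_eq_trace (f : A →ₗ[S] S) : ∃ n a : A, n ≠ 0 ∧
    f ∘ₗ LinearMap.mulLeft S n = Algebra.trace S A ∘ₗ LinearMap.mulLeft S a := by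
  obtain ⟨x, hx⟩ := exists_trace_mul_eq Q K b f
  have := (algebraMap A K).domain_nontrivial
  obtain ⟨⟨a, n⟩, h⟩ := IsLocalization.surj A⁰ x
  refine ⟨n, a, nonZeroDivisors.coe_ne_zero n, LinearMap.ext fun c => ?_⟩
  refine IsFractionRing.injective S Q ?_
  rw [LinearMap.comp_apply, LinearMap.comp_apply, LinearMap.mulLeft_apply, LinearMap.mulLeft_apply,
    hx, algebraMap_trace_eq Q K b, map_mul (algebraMap A K), map_mul (algebraMap A K), ← h, mul_assoc]

variable (Q K) in
include Q K b in
lemma eq_zero_of_trace_comp_mulLeft (e : A)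
    (he : Algebra.trace S A ∘ₗ LinearMap.mulLeft S e = 0) : e = 0 := by
  let b' : Module.Basis ι Q K := b.localizationLocalization Q S⁰ K
  refine (map_eq_zero_iff _ (IsFractionRing.injective A K)).1 ?_
  refine (traceForm_nondegenerate Q K).1 _ fun y => ?_
  have h : Algebra.traceForm Q K (algebraMap A K e) = 0 := by
    refine b'.ext fun i => ?_
    have h3 : b' i = algebraMap A K (b i) := b.localizationLocalization_apply Q S⁰ K i
    rw [h3, Algebra.traceForm_apply, ← map_mul, ← algebraMap_trace_eq Q K b]
    have := LinearMap.congr_fun he (b i)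
    simp only [LinearMap.comp_apply, LinearMap.mulLeft_apply] at this
    simp [this]
  rw [h]
  rfl

variable {I : Ideal A}

variable (Q K) in
include b in
-- The element `x` representing `f` lies in the dual of `A`, so `a x` lies in `A` and represents
-- `f(a ·)`.
lemma exists_comp_mulLeft_eq_trace_of_mem {a : A} (ha : ∀ x : K,
      (∀ y : A, Algebra.trace Q K (x * algebraMap A K y) ∈ (algebraMap S Q).range) →
      ∃ e : A, algebraMap A K e = algebraMap A K a * x) (f : A →ₗ[S] S) :
    ∃ e : A, f ∘ₗ LinearMap.mulLeft S a = Algebra.trace S A ∘ₗ LinearMap.mulLeft S e := by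
  obtain ⟨x, hx⟩ := exists_trace_mul_eq Q K b f
  obtain ⟨e, he⟩ := ha x fun y => ⟨f y, hx y⟩
  refine ⟨e, LinearMap.ext fun c => IsFractionRing.injective S Q ?_⟩
  rw [LinearMap.comp_apply, LinearMap.comp_apply, LinearMap.mulLeft_apply, LinearMap.mulLeft_apply,
    hx, algebraMap_trace_eq Q K b, map_mul (algebraMap A K), map_mul (algebraMap A K), he, mul_left_comm, mul_assoc]

variable (Q K) in
include b in
/-- The trace form lies in the product of the different with the dual of `A`. -/
lemma trace_mem_closure [IsIntegrallyClosed S] [IsDedekindDomain A] [IsIntegralClosure A S K]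
    (hI : ∀ a : A, (∀ x : K,
      (∀ y : A, Algebra.trace Q K (x * algebraMap A K y) ∈ (algebraMap S Q).range) →
      ∃ e : A, algebraMap A K e = algebraMap A K a * x) → a ∈ I) :
    Algebra.trace S A ∈ AddSubmonoid.closure
      {g : A →ₗ[S] S | ∃ a ∈ I, ∃ f : A →ₗ[S] S, g = f ∘ₗ LinearMap.mulLeft S a} := by
  let J : FractionalIdeal A⁰ K := FractionalIdeal.dual S Q 1
  have hJ : J ≠ 0 := FractionalIdeal.dual_ne_zero S Q one_ne_zero
  have hmem : ∀ x : K, x ∈ J ↔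
      ∀ y : A, Algebra.trace Q K (x * algebraMap A K y) ∈ (algebraMap S Q).range := fun x => by
    rw [FractionalIdeal.mem_dual (one_ne_zero (α := FractionalIdeal A⁰ K))]
    refine ⟨fun h y => h _ (FractionalIdeal.mem_one_iff _ |>.2 ⟨y, rfl⟩), fun h y hy => ?_⟩
    obtain ⟨y, rfl⟩ := (FractionalIdeal.mem_one_iff _).1 hy
    exact h y
  have hJ1 : (1 : K) ∈ J := (FractionalIdeal.one_le_dual_one S Q)
    ((FractionalIdeal.mem_one_iff _).2 ⟨1, map_one _⟩)
  have h1 : (1 : K) ∈ J⁻¹ * J := by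
    rw [inv_mul_cancel₀ hJ]
    exact (FractionalIdeal.mem_one_iff _).2 ⟨1, map_one _⟩
  -- In a Dedekind domain `1 ∈ J⁻¹ * J`. Writing it as a sum of products `i j` writes the trace as a
  -- sum of forms `Tr(j · i)`, with `i` in the different and `j` in the dual.
  have key : ∀ c ∈ J⁻¹ * J, ∃ g ∈ AddSubmonoid.closure
      {g : A →ₗ[S] S | ∃ a ∈ I, ∃ f : A →ₗ[S] S, g = f ∘ₗ LinearMap.mulLeft S a},
      ∀ y, algebraMap S Q (g y) = Algebra.trace Q K (c * algebraMap A K y) := fun c hc => by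
    refine FractionalIdeal.mul_induction_on hc (fun i hi j hj => ?_) fun x y hx hy => ?_
    · rw [FractionalIdeal.mem_inv_iff hJ] at hi
      -- Since `1` lies in the dual, an element of `J⁻¹` already lies in `A`.
      obtain ⟨a, ha⟩ := (FractionalIdeal.mem_one_iff _).1 (hi 1 hJ1)
      rw [mul_one] at ha
      obtain ⟨f, hf⟩ := exists_form_of_trace_mem Q ((hmem j).1 hj)
      refine ⟨f ∘ₗ LinearMap.mulLeft S a, AddSubmonoid.subset_closure ⟨a, hI a fun x hx => ?_, f,
        rfl⟩, fun y => ?_⟩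
      · rw [ha]
        exact (FractionalIdeal.mem_one_iff _).1 (hi x ((hmem x).2 hx))
      · rw [LinearMap.comp_apply, LinearMap.mulLeft_apply, hf, map_mul (algebraMap A K), ha, mul_left_comm,
          mul_assoc]
    · obtain ⟨f, hf, hf'⟩ := hx
      obtain ⟨g, hg, hg'⟩ := hy
      exact ⟨f + g, add_mem hf hg, fun z => by
        rw [LinearMap.add_apply, map_add, hf', hg', add_mul, map_add]⟩
  obtain ⟨g, hg, hg'⟩ := key 1 h1
  have h2 : Algebra.trace S A = g := LinearMap.ext fun y => IsFractionRing.injective S Q (by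
    rw [hg', one_mul, algebraMap_trace_eq Q K b])
  rw [h2]
  exact hg

end TraceDual

/-! ### Diagonal part and different for integral closures of principal ideal domains -/

section IntegralClosure

open nonZeroDivisors

variable (S A Q K : Type*) [CommRing S] [IsDomain S] [IsPrincipalIdealRing S] [CommRing A]
  [Field Q] [Field K] [Algebra S A] [Algebra S Q] [IsFractionRing S Q] [Algebra A K]
  [Algebra Q K] [Algebra S K] [IsScalarTower S Q K] [IsScalarTower S A K]
  [IsIntegralClosure A S K] [FiniteDimensional Q K] [Algebra.IsSeparable Q K]

include Q K in
-- Separability makes the integral closure finite, and torsion-free finite modules over a principal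
-- ideal domain are free.
lemma exists_basis_of_isIntegralClosure :
    ∃ (n : ℕ), Nonempty (Module.Basis (Fin n) S A) := by
  have : Module.IsTorsionFree S K := .trans_faithfulSMul S Q K
  have : Module.Free S A := IsIntegralClosure.module_free S Q K A
  have : Module.Finite S A := IsIntegralClosure.finite S Q K A
  exact ⟨_, ⟨Module.finBasis S A⟩⟩

variable {S A} {I : Ideal A} {M : Type*} [AddCommGroup M] [Module A M] [Module S M] [IsScalarTower S A M]

/-- The multiplication map is a bijection from the diagonal part of `A ⊗ M` onto the product of
`M` with the different, for torsion-free `M`. -/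
lemma bijOn_liftBaseChange
    (hI : ∀ a : A, a ∈ I ↔ ∀ x : K,
      (∀ y : A, Algebra.trace Q K (x * algebraMap A K y) ∈ (algebraMap S Q).range) →
      ∃ e : A, algebraMap A K e = algebraMap A K a * x)
    (htor : ∀ a : A, a ≠ 0 → ∀ m : M, a • m = 0 → m = 0) :
    Set.BijOn (LinearMap.liftBaseChange A (LinearMap.id : M →ₗ[S] M))
      {x : A ⊗[S] M | ∀ a : A, a • x =
        LinearMap.lTensor A ((LinearMap.lsmul A M a).restrictScalars S) x}
      (I • (⊤ : Submodule A M) : Submodule A M) := by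
  obtain ⟨n, ⟨b⟩⟩ := exists_basis_of_isIntegralClosure S A Q K
  have := (IsIntegralClosure.algebraMap_injective A S K).isDomain
  have : IsFractionRing A K := IsIntegralClosure.isFractionRing_of_finite_extension S Q K A
  have : IsLocalization (Algebra.algebraMapSubmonoid A S⁰) K :=
    IsIntegralClosure.isLocalization S Q K A
  have : IsDedekindDomain A := IsIntegralClosure.isDedekindDomain S Q K A
  refine ⟨fun x hx => ?_, fun x hx y hy hxy => ?_, fun m hm => ?_⟩
  · exact liftBaseChange_mem_smul_top b hx (trace_mem_closure Q K b fun a => (hI a).2)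
  · rw [← sub_eq_zero]
    refine eq_zero_of_liftBaseChange_eq_zero b (fun a => ?_) (fun f => ?_) ?_
    · rw [smul_sub, map_sub, hx a, hy a]
    · obtain ⟨n, a, hn, h⟩ := exists_comp_mulLeft_eq_trace Q K b f
      exact ⟨n, a, htor n hn, h⟩
    · rw [map_sub, hxy, sub_self]
  · induction hm using Submodule.smul_induction_on' with
    | smul a ha m _ =>
      exact exists_liftBaseChange_eq_smul b (eq_zero_of_trace_comp_mulLeft Q K b)
        (exists_comp_mulLeft_eq_trace_of_mem Q K b ((hI a).1 ha)) m
    | add m _ m' _ hm hm' =>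
      obtain ⟨x, hx, rfl⟩ := hm
      obtain ⟨y, hy, rfl⟩ := hm'
      exact ⟨x + y, fun a => by rw [smul_add, map_add, hx a, hy a], map_add _ _ _⟩

end IntegralClosure

/-! ### The ring of functions regular away from a point -/

section Curve

variable {𝔽 : Type w} {K : Type u} [Field 𝔽] [Field K] [Algebra 𝔽 K]

/-- An integrally closed subring is the intersection of the valuation rings above it. -/
lemma isIntegral_adjoin_of_forall_valuationSubring (s : Set K) {x : K}
    (hx : ∀ V : ValuationSubring K, (∀ c : 𝔽, algebraMap 𝔽 K c ∈ V) → s ⊆ V → x ∈ V) :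
    IsIntegral (Algebra.adjoin 𝔽 s) x := by
  by_contra h
  let R : Subring K := (integralClosure (Algebra.adjoin 𝔽 s) K).toSubring
  have hR : IsIntegrallyClosedIn R K :=
    inferInstanceAs (IsIntegrallyClosedIn (integralClosure (Algebra.adjoin 𝔽 s) K) K)
  obtain ⟨V, hV, hxV⟩ := R.exists_le_valuationSubring_of_isIntegrallyClosedIn (x := x) h
  have hle : ∀ y ∈ Algebra.adjoin 𝔽 s, y ∈ V := fun y hy =>
    hV (isIntegral_algebraMap (R := Algebra.adjoin 𝔽 s) (x := ⟨y, hy⟩))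
  exact hxV (hx V (fun c => hle _ (Subalgebra.algebraMap_mem _ c)) fun y hy =>
    hle y (Algebra.subset_adjoin hy))

variable {P : Place 𝔽 K}

lemma IsCurveFunctionField.not_isAlgebraic (hK : IsCurveFunctionField 𝔽 K) {u : K}
    (hu : IsSeparating 𝔽 u) : ¬ IsAlgebraic 𝔽 u := fun h => by
  have := hu.1
  have h1 : Algebra.IsAlgebraic 𝔽 (IntermediateField.adjoin 𝔽 {u}) :=
    IntermediateField.isAlgebraic_adjoin_simple h.isIntegral
  have h2 : Algebra.IsAlgebraic 𝔽 K :=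
    Algebra.IsAlgebraic.trans 𝔽 (IntermediateField.adjoin 𝔽 {u}) K
  exact zero_ne_one (trdeg_eq_zero.symm.trans hK.trdeg_eq_one)

/-- Without a pole at `P` the function would lie in every valuation ring over `𝔽`, hence be integral
over `𝔽`, that is, constant. -/
lemma Place.not_mem_localRing {u : K} (hu : u ∈ P.regularAway) (hu' : ¬ IsAlgebraic 𝔽 u) :
    u ∉ P.localRing := fun h => by
  have h1 : IsIntegral (Algebra.adjoin 𝔽 (∅ : Set K)) u :=
    isIntegral_adjoin_of_forall_valuationSubring ∅ fun V hV _ => by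
      by_cases hV' : V = ⊤
      · rw [hV']; trivial
      · by_cases hP : (⟨V, hV, hV'⟩ : Place 𝔽 K) = P
        · subst hP; exact h
        · exact hu ⟨V, hV, hV'⟩ hP
  rw [Algebra.adjoin_empty] at h1
  exact hu' (isIntegral_trans u h1).isAlgebraic

/-- Because `u` has its pole exactly at `P`, the proper valuation rings over `𝔽[u]` are those of the
places other than `P`. -/
lemma Place.mem_regularAway_iff {u : K} (hu : u ∈ P.regularAway) (hu' : u ∉ P.localRing) {x : K} :
    x ∈ P.regularAway ↔ IsIntegral (Algebra.adjoin 𝔽 {u}) x := by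
  refine ⟨fun hx => isIntegral_adjoin_of_forall_valuationSubring _ fun V hV hs => ?_,
    fun hx Q hQ => ?_⟩
  · by_cases hV' : V = ⊤
    · rw [hV']; trivial
    · refine hx ⟨V, hV, hV'⟩ fun h => hu' ?_
      subst h
      exact hs rfl
  · have hle : Algebra.adjoin 𝔽 {u} ≤
        { Q.localRing.toSubring with algebraMap_mem' := Q.algebraMap_mem } :=
      Algebra.adjoin_le (Set.singleton_subset_iff.2 (hu Q hQ))
    have h1 : IsIntegral Q.localRing x := by
      obtain ⟨p, hp, h0⟩ := hx
      refine ⟨p.map (Subring.inclusion (S := (Algebra.adjoin 𝔽 {u}).toSubring)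
        (T := Q.localRing.toSubring) hle), hp.map _, ?_⟩
      rw [Polynomial.eval₂_map]
      exact h0
    obtain ⟨y, hy⟩ := IsIntegrallyClosed.isIntegral_iff.1 h1
    rw [← hy]
    exact y.2

end Curve

/-! ### Integral closures of polynomial rings -/

section Adjoin

open nonZeroDivisors

variable {𝔽 : Type w} {A K : Type*} [Field 𝔽] [Field K] [Algebra 𝔽 K] [CommRing A] [Algebra 𝔽 A]
  [Algebra A K] [IsScalarTower 𝔽 A K] (u : A)

/-- The inclusion of `𝔽[u]` into `𝔽(u)`. -/
abbrev adjoinAlgebra (K : Type*) [Field K] [Algebra 𝔽 K] [Algebra A K] [IsScalarTower 𝔽 A K] :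
    Algebra (Algebra.adjoin 𝔽 {u}) (IntermediateField.adjoin 𝔽 {algebraMap A K u}) :=
  (((IsScalarTower.toAlgHom 𝔽 A K).comp (Algebra.adjoin 𝔽 {u}).val).codRestrict
    (IntermediateField.adjoin 𝔽 {algebraMap A K u}).toSubalgebra fun s => by
      have h : Algebra.adjoin 𝔽 {u} ≤ (IntermediateField.adjoin 𝔽
          {algebraMap A K u}).toSubalgebra.comap (IsScalarTower.toAlgHom 𝔽 A K) :=
        Algebra.adjoin_le (Set.singleton_subset_iff.2
          (IntermediateField.mem_adjoin_simple_self 𝔽 (algebraMap A K u)))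
      exact h s.2).toRingHom.toAlgebra

attribute [local instance] adjoinAlgebra

variable (K) in
lemma isScalarTower_adjoin :
    IsScalarTower (Algebra.adjoin 𝔽 {u}) (IntermediateField.adjoin 𝔽 {algebraMap A K u}) K :=
  IsScalarTower.of_algebraMap_eq fun _ => rfl

variable (K) in
lemma map_adjoin_singleton : (Algebra.adjoin 𝔽 {u}).map (IsScalarTower.toAlgHom 𝔽 A K) =
    Algebra.adjoin 𝔽 {algebraMap A K u} := by
  rw [AlgHom.map_adjoin, Set.image_singleton]
  rfl

lemma mem_adjoin_iff_mem_range (z : IntermediateField.adjoin 𝔽 {algebraMap A K u}) :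
    (z : K) ∈ Algebra.adjoin 𝔽 {algebraMap A K u} ↔ z ∈ (algebraMap (Algebra.adjoin 𝔽 {u})
      (IntermediateField.adjoin 𝔽 {algebraMap A K u})).range := by
  rw [← map_adjoin_singleton]
  exact ⟨fun ⟨s, hs, h⟩ => ⟨⟨s, hs⟩, Subtype.ext h⟩, fun ⟨s, h⟩ => ⟨s, s.2,
    congrArg (fun z : IntermediateField.adjoin 𝔽 {algebraMap A K u} => (z : K)) h⟩⟩

variable (hinj : Function.Injective (algebraMap A K))

include hinj in
lemma isFractionRing_adjoin :
    IsFractionRing (Algebra.adjoin 𝔽 {u}) (IntermediateField.adjoin 𝔽 {algebraMap A K u}) := by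
  have hinj : Function.Injective (algebraMap (Algebra.adjoin 𝔽 {u})
      (IntermediateField.adjoin 𝔽 {algebraMap A K u})) := fun x y h => Subtype.ext (hinj
    (congrArg (fun z : IntermediateField.adjoin 𝔽 {algebraMap A K u} => (z : K)) h))
  have := (faithfulSMul_iff_algebraMap_injective _ _).2 hinj
  refine .of_field _ _ fun ⟨z, hz⟩ => ?_
  obtain ⟨x, hx, y, hy, h⟩ := IntermediateField.mem_adjoin_iff_div.1 hz
  rw [← map_adjoin_singleton] at hx hy
  obtain ⟨x, hx, rfl⟩ := hx
  obtain ⟨y, hy, rfl⟩ := hy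
  exact ⟨⟨x, hx⟩, ⟨y, hy⟩, Subtype.ext h⟩

variable {u} (hA : ∀ x : K, x ∈ (algebraMap A K).range ↔
  IsIntegral (Algebra.adjoin 𝔽 {algebraMap A K u}) x)

include hinj hA in
-- `𝔽[u]` occurs both inside `A` and inside `K`; integrality is carried along the isomorphism `e`
-- between the two.
lemma isIntegralClosure_adjoin : IsIntegralClosure A (Algebra.adjoin 𝔽 {u}) K where
  algebraMap_injective := hinj
  isIntegral_iff {x} := by
    let e : Algebra.adjoin 𝔽 {u} ≃ₐ[𝔽] Algebra.adjoin 𝔽 {algebraMap A K u} :=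
      ((Algebra.adjoin 𝔽 {u}).equivMapOfInjective (IsScalarTower.toAlgHom 𝔽 A K) hinj).trans
        (Subalgebra.equivOfEq _ _ (map_adjoin_singleton K u))
    have he : (algebraMap (Algebra.adjoin 𝔽 {algebraMap A K u}) K).comp
        e.toRingEquiv.toRingHom = algebraMap (Algebra.adjoin 𝔽 {u}) K := rfl
    refine Iff.trans ?_ (hA x).symm
    refine ⟨fun h => h.map_of_comp_eq e.toRingEquiv.toRingHom (RingHom.id K) (by rw [he]; rfl),
      fun h => h.map_of_comp_eq e.symm.toRingEquiv.toRingHom (RingHom.id K) ?_⟩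
    refine RingHom.ext fun y => ?_
    obtain ⟨y, rfl⟩ := e.surjective y
    exact congrArg (algebraMap (Algebra.adjoin 𝔽 {u}) K) (e.symm_apply_apply y)

variable (htr : Transcendental 𝔽 u)

include htr in
lemma isPrincipalIdealRing_adjoin : IsPrincipalIdealRing (Algebra.adjoin 𝔽 {u}) :=
  let e := Polynomial.algEquivOfTranscendental 𝔽 u htr
  IsPrincipalIdealRing.of_surjective e.toRingEquiv.toRingHom e.surjective

include hinj in
lemma isDomain_adjoin : IsDomain (Algebra.adjoin 𝔽 {u}) :=
  have := hinj.isDomain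
  inferInstance

variable (hu : IsSeparating 𝔽 (algebraMap A K u))

include hinj hA htr hu in
lemma exists_basis_adjoin :
    ∃ (n : ℕ), Nonempty (Module.Basis (Fin n) (Algebra.adjoin 𝔽 {u}) A) :=
  have := hu.1
  have := hu.2
  have := isScalarTower_adjoin (𝔽 := 𝔽) K u
  have := isFractionRing_adjoin (𝔽 := 𝔽) u hinj
  have := isIntegralClosure_adjoin hinj hA
  have := isPrincipalIdealRing_adjoin htr
  have := isDomain_adjoin (𝔽 := 𝔽) (u := u) hinj
  exists_basis_of_isIntegralClosure (Algebra.adjoin 𝔽 {u}) A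
    (IntermediateField.adjoin 𝔽 {algebraMap A K u}) K

include hinj hA htr hu in
/-- `A` has an `𝔽`-basis on which multiplication by `u` is a shift. -/
lemma exists_basis_shift : ∃ (m : ℕ) (β : Module.Basis (ℕ × Fin m) 𝔽 A),
    ∀ n i, u * β (n, i) = β (n + 1, i) := by
  -- The basis consists of the products `u ^ n * b i`, for a basis `b` of `A` over `𝔽[u]`.
  obtain ⟨m, ⟨b⟩⟩ := exists_basis_adjoin hinj hA htr hu
  let e := Polynomial.algEquivOfTranscendental 𝔽 u htr
  let p : Module.Basis ℕ 𝔽 (Algebra.adjoin 𝔽 {u}) :=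
    (Polynomial.basisMonomials 𝔽).map e.toLinearEquiv
  have hp : ∀ n, (p n : A) = u ^ n := fun n => by
    simp [p, e]
  refine ⟨m, p.smulTower b, fun n i => ?_⟩
  rw [Module.Basis.smulTower_apply, Module.Basis.smulTower_apply, Subalgebra.smul_def,
    Subalgebra.smul_def, hp, hp, smul_eq_mul, smul_eq_mul, pow_succ', mul_assoc]

variable {I : Ideal A}
  (hI : ∀ a : A, a ∈ I ↔ ∀ x : K, (∀ y : A,
    ((Algebra.trace (IntermediateField.adjoin 𝔽 {algebraMap A K u}) K (x * algebraMap A K y) :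
      IntermediateField.adjoin 𝔽 {algebraMap A K u}) : K) ∈
      Algebra.adjoin 𝔽 {algebraMap A K u}) → algebraMap A K a * x ∈ (algebraMap A K).range)
  {M : Type*} [AddCommGroup M] [Module A M]

include hinj hA htr hu hI in
/-- The multiplication map is a bijection from the diagonal part of `A ⊗ M` onto the product of
`M` with the relative different of `A` over `𝔽[u]`, for torsion-free `M`. -/
lemma bijOn_liftBaseChange_adjoin (htor : ∀ a : A, a ≠ 0 → ∀ m : M, a • m = 0 → m = 0) :
    Set.BijOn (LinearMap.liftBaseChange A (LinearMap.id : M →ₗ[Algebra.adjoin 𝔽 {u}] M))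
      {x : A ⊗[Algebra.adjoin 𝔽 {u}] M | ∀ a : A, a • x =
        LinearMap.lTensor A ((LinearMap.lsmul A M a).restrictScalars (Algebra.adjoin 𝔽 {u})) x}
      (I • (⊤ : Submodule A M) : Submodule A M) :=
  have := hu.1
  have := hu.2
  have := isScalarTower_adjoin (𝔽 := 𝔽) K u
  have := isFractionRing_adjoin (𝔽 := 𝔽) u hinj
  have := isIntegralClosure_adjoin hinj hA
  have := isPrincipalIdealRing_adjoin htr
  have := isDomain_adjoin (𝔽 := 𝔽) (u := u) hinj
  bijOn_liftBaseChange (IntermediateField.adjoin 𝔽 {algebraMap A K u}) K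
    (fun a => (hI a).trans (forall_congr' fun _ => imp_congr_left (forall_congr' fun _ =>
      mem_adjoin_iff_mem_range u _))) htor

end Adjoin

/-! ### Assembling the isomorphism -/

namespace AndersonModule

variable {𝔽 : Type w} {A L : Type u} [Field 𝔽] [Finite 𝔽] [CommRing A] [Algebra 𝔽 A] [Field L]
  [Algebra 𝔽 L] [Algebra A L] {d : ℕ} (E : AndersonModule.{w, u} 𝔽 A L d)
  (κ : E.scheme ≅ gaPow 𝔽 L d) {C : Type u} [NormedField C] [Algebra L C]
  [IsUltrametricDist C] [CompleteSpace C]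

section

variable [Algebra 𝔽 C] [IsScalarTower 𝔽 L C]

lemma actCoeff_pow (a : A) (k : ℕ) :
    E.actCoeff C κ κ (a ^ k) 0 = E.actCoeff C κ κ a 0 ^ k := by
  refine Matrix.mulVec_injective (funext fun x => ?_)
  obtain ⟨x, rfl⟩ := lieCoords_surjective κ C x
  rw [← lieCoords_action_pow, ← lieCoords_action]

/-- A power of `a` acts on the Lie algebra as a power of the nonzero scalar `ℓ(a)`. This gives the
torsion-freeness of `Λ`. -/
lemma smul_eq_zero_of_ne_zero (hd : 0 < d) (hL : Function.Injective (algebraMap A L)) {a : A}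
    (ha : a ≠ 0) {x : E.LiePts κ C} (hx : a • x = 0) : x = 0 := by
  obtain ⟨k, hk, h⟩ := exists_actCoeff_pow_eq (C := C) E κ hd a
  have h1 : a ^ k • x = 0 := by
    obtain ⟨k, rfl⟩ := Nat.exists_eq_add_of_le' hk
    rw [pow_succ, mul_smul, hx, smul_zero]
  have h2 : (E.actCoeff C κ κ a 0 ^ k).mulVec (lieCoords κ C x) = 0 :=
    (E.lieCoords_action_pow κ a k x).symm.trans
      ((congrArg (lieCoords κ C) h1).trans (map_zero _))
  rw [h, Matrix.smul_mulVec, Matrix.one_mulVec, smul_eq_zero] at h2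
  refine lieCoords_injective κ ((h2.resolve_left (pow_ne_zero _ ?_)).trans (map_zero _).symm)
  rw [Ne, map_eq_zero_iff _ (algebraMap L C).injective, map_eq_zero_iff _ hL]
  exact ha

end

variable {K : Type*} [Field K] [Algebra 𝔽 K] [Algebra A K] [IsScalarTower 𝔽 A K] {u : A}
  {I : Ideal A}

/-- The geometry enters only through `A` being the integral closure of `𝔽[u]` in `K` and `u` having
absolute value above one. -/
lemma exists_special_function_isomorphism (hd : 0 < d) (hL : Function.Injective (algebraMap A L))
    (hnorm : 1 < ‖algebraMap L C (algebraMap A L u)‖)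
    (hinj : Function.Injective (algebraMap A K))
    (hA : ∀ x : K, x ∈ (algebraMap A K).range ↔
      IsIntegral (Algebra.adjoin 𝔽 {algebraMap A K u}) x)
    (htr : Transcendental 𝔽 u) (hu : IsSeparating 𝔽 (algebraMap A K u))
    (hI : ∀ a : A, a ∈ I ↔ ∀ x : K, (∀ y : A,
      ((Algebra.trace (IntermediateField.adjoin 𝔽 {algebraMap A K u}) K (x * algebraMap A K y) :
        IntermediateField.adjoin 𝔽 {algebraMap A K u}) : K) ∈
        Algebra.adjoin 𝔽 {algebraMap A K u}) → algebraMap A K a * x ∈ (algebraMap A K).range) :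
    ∃ (D : E.LieT κ C ≃ₗ[A] E.LieT κ C)
      (deltaTilde : A ⊗[Algebra.adjoin 𝔽 {u}] E.lattice κ C →ₗ[A] E.PtsT κ C)
      (delta : (I • E.lattice κ C : Submodule A (E.LiePts κ C)) ≃ₗ[A] E.specialFunctions κ C),
      (∀ y, D y = E.rightActLie κ C u y - u • y) ∧
      (∀ x : A ⊗[𝔽] E.lattice κ C, deltaTilde (E.relativeProj κ C (Algebra.adjoin 𝔽 {u}) x) =
        E.expT κ C (D.symm (E.latticeToLieT κ C x))) ∧
      (∀ a x, deltaTilde (E.rightActLattice κ C (Algebra.adjoin 𝔽 {u}) a x) =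
        E.rightAct κ C a (deltaTilde x)) ∧
      (∀ x, u • deltaTilde x = E.rightAct κ C u (deltaTilde x)) ∧
      Set.BijOn (fun x => (E.mulMap κ C (Algebra.adjoin 𝔽 {u}) x : E.LiePts κ C))
        (E.diagonalPart κ C (Algebra.adjoin 𝔽 {u}))
        (I • E.lattice κ C : Submodule A (E.LiePts κ C)) ∧
      (∀ x ∈ E.diagonalPart κ C (Algebra.adjoin 𝔽 {u}),
        ∀ h : (E.mulMap κ C (Algebra.adjoin 𝔽 {u}) x : E.LiePts κ C) ∈ I • E.lattice κ C,
        (delta ⟨_, h⟩ : E.PtsT κ C) = deltaTilde x) := by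
  let _ : Algebra 𝔽 C := ((algebraMap L C).comp (algebraMap 𝔽 L)).toAlgebra
  have _ : IsScalarTower 𝔽 L C := IsScalarTower.of_algebraMap_eq fun _ => rfl
  obtain ⟨k, hk, hpow⟩ := exists_actCoeff_pow_eq (C := C) E κ hd u
  have hϑ : 1 < ‖algebraMap L C (algebraMap A L u) ^ k‖ := by
    rw [norm_pow]
    exact one_lt_pow₀ hnorm hk.ne'
  -- `expLinear` defaults to zero, so existence must be shown. The scalar action required for it is
  -- that of `u ^ k`, not of `u`.
  have hexp : ∃ f, E.IsExponential C f :=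
    exists_isExponential E κ hϑ ((E.actCoeff_pow κ u k).trans hpow)
  obtain ⟨m, β, hβ⟩ := exists_basis_shift hinj hA htr hu
  let D : E.LieT κ C ≃ₗ[A] E.LieT κ C := LinearEquiv.ofBijective
    ((E.rightActLie κ C u : E.LieT κ C →ₗ[A] E.LieT κ C) - LinearMap.lsmul A _ u)
    (E.bijective_rightActLie_sub_smul κ β hϑ hpow)
  have hD : ∀ y, D y = E.rightActLie κ C u y - u • y := fun y => rfl
  have hbij : Set.BijOn (E.mulMap κ C (Algebra.adjoin 𝔽 {u}))
      (E.diagonalPart κ C (Algebra.adjoin 𝔽 {u}))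
      (I • (⊤ : Submodule A (E.lattice κ C)) : Submodule A (E.lattice κ C)) :=
    bijOn_liftBaseChange_adjoin hinj hA htr hu hI fun a ha x hx =>
      Subtype.ext (E.smul_eq_zero_of_ne_zero κ hd hL ha (congrArg Subtype.val hx))
  -- The product with the different, formed inside `Λ` by the algebra, has to be viewed inside the
  -- Lie algebra.
  have himage : (I • E.lattice κ C : Submodule A (E.LiePts κ C)) =
      (I • (⊤ : Submodule A (E.lattice κ C))).map (E.lattice κ C).subtype := by
    rw [Submodule.map_smul'', Submodule.map_subtype_top]
  have hbij' : Set.BijOn (fun x => (E.mulMap κ C (Algebra.adjoin 𝔽 {u}) x : E.LiePts κ C))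
      (E.diagonalPart κ C (Algebra.adjoin 𝔽 {u}))
      (I • E.lattice κ C : Submodule A (E.LiePts κ C)) := by
    rw [himage]
    exact (Set.InjOn.bijOn_image (Subtype.val_injective.injOn)).comp hbij
  let μ : E.diagonalSubmodule κ (C := C) (Algebra.adjoin 𝔽 {u}) ≃ₗ[A]
      (I • E.lattice κ C : Submodule A (E.LiePts κ C)) :=
    LinearEquiv.ofBijective (((E.lattice κ C).subtype ∘ₗ
      E.mulMap κ C (Algebra.adjoin 𝔽 {u})).restrict fun _ hx => hbij'.mapsTo hx) hbij'.bijective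
  refine ⟨D, E.deltaTilde κ hD, μ.symm.trans (diagonalEquiv κ hD β hβ hexp), hD,
    fun x => E.deltaTilde_relativeProj κ hD x, fun a x => E.deltaTilde_rightActLattice κ hD a x,
    fun x => E.smul_deltaTilde κ hD x, hbij', fun x hx h => ?_⟩
  have h1 : μ.symm ⟨_, h⟩ = ⟨x, hx⟩ := (LinearEquiv.symm_apply_eq μ).2 rfl
  rw [LinearEquiv.trans_apply, h1]
  rfl

end AndersonModule

/-! ### The ultrametric field of scalars -/

section Completion

variable {F : Type*} [Field F] {v : AbsoluteValue F ℝ}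

lemma isUltrametricDist_completion (hv : IsNonarchimedean v) : IsUltrametricDist v.Completion := by
  refine IsUltrametricDist.isUltrametricDist_of_isNonarchimedean_norm fun x y => ?_
  induction x, y using UniformSpace.Completion.induction_on₂ with
  | hp =>
    exact isClosed_le (by fun_prop) (by fun_prop)
  | ih x y =>
    rw [← UniformSpace.Completion.coe_add]
    simp only [UniformSpace.Completion.norm_coe]
    exact hv x.ofAbs y.ofAbs

end Completion

end AndersonModules

end

open AndersonModules in
theorem theorem3p9
    -- the curve (through its function field `K`) over the finite field `𝔽`, the point at
    -- infinity, and the ring `A` of functions regular away from it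
    {𝔽 : Type w} [Field 𝔽] [Finite 𝔽] {K : Type u} [Field K] [Algebra 𝔽 K]
    (hK : IsCurveFunctionField 𝔽 K) (infty : Place 𝔽 K)
    -- an algebraic closure of `K`, a place `v` of it above infinity; its completion is the
    -- field of scalars, and `L` is a field between `K` and this completion
    {Kbar : Type u} [Field Kbar] [Algebra K Kbar] [IsAlgClosure K Kbar]
    [Algebra 𝔽 Kbar] [IsScalarTower 𝔽 K Kbar]
    (v : AbsoluteValue Kbar ℝ) (hv : infty.IsAbove v)
    (L : IntermediateField K v.Completion)
    -- an Anderson module, with any coordinate system, and a separating element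
    {d : ℕ} (hd : 0 < d) (E : AndersonModule 𝔽 infty.regularAway L d)
    (κ : E.scheme ≅ gaPow 𝔽 L d)
    (u : infty.regularAway) (hu : IsSeparating 𝔽 (u : K)) :
    ∃ (D : E.LieT κ v.Completion ≃ₗ[infty.regularAway] E.LieT κ v.Completion)
      (deltaTilde : infty.regularAway ⊗[Algebra.adjoin 𝔽 {u}] E.lattice κ v.Completion
        →ₗ[infty.regularAway] E.PtsT κ v.Completion)
      (delta : (relativeDifferent infty.regularAway (u : K) • E.lattice κ v.Completion :
          Submodule infty.regularAway (E.LiePts κ v.Completion))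
        ≃ₗ[infty.regularAway] E.specialFunctions κ v.Completion),
      -- `1 ⊗ ∂u - u ⊗ 1` is invertible
      (∀ y, D y = E.rightActLie κ v.Completion u y - u • y) ∧
      -- the formula for `deltaTilde`, which is thus well defined
      (∀ x : infty.regularAway ⊗[𝔽] E.lattice κ v.Completion,
        deltaTilde (E.relativeProj κ v.Completion (Algebra.adjoin 𝔽 {u}) x) =
        E.expT κ v.Completion (D.symm (E.latticeToLieT κ v.Completion x))) ∧
      -- `deltaTilde` is linear for both actions, with values where the actions of `u` coincide
      (∀ a x, deltaTilde (E.rightActLattice κ v.Completion (Algebra.adjoin 𝔽 {u}) a x) =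
        E.rightAct κ v.Completion a (deltaTilde x)) ∧
      (∀ x, u • deltaTilde x = E.rightAct κ v.Completion u (deltaTilde x)) ∧
      -- the multiplication map restricts to a bijection from the part of the tensor product where
      -- the two actions coincide to the different times the lattice, and `delta` is `deltaTilde`
      -- on that part
      Set.BijOn (fun x => (E.mulMap κ v.Completion (Algebra.adjoin 𝔽 {u}) x :
          E.LiePts κ v.Completion))
        (E.diagonalPart κ v.Completion (Algebra.adjoin 𝔽 {u}))
        (relativeDifferent infty.regularAway (u : K) • E.lattice κ v.Completion :
          Submodule infty.regularAway (E.LiePts κ v.Completion)) ∧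
      (∀ x ∈ E.diagonalPart κ v.Completion (Algebra.adjoin 𝔽 {u}),
        ∀ h : (E.mulMap κ v.Completion (Algebra.adjoin 𝔽 {u}) x : E.LiePts κ v.Completion) ∈
          relativeDifferent infty.regularAway (u : K) • E.lattice κ v.Completion,
        (delta ⟨_, h⟩ : E.PtsT κ v.Completion) = deltaTilde x) := by
  have _ := isUltrametricDist_completion hv.nonarchimedean
  have htr : ¬ IsAlgebraic 𝔽 (u : K) := hK.not_isAlgebraic hu
  have huP : (u : K) ∉ infty.localRing := Place.not_mem_localRing u.2 htr
  refine E.exists_special_function_isomorphism κ (K := K) hd ?_ ?_ Subtype.val_injective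
    (fun x => ?_) ?_ hu fun a => ?_
  · exact (algebraMap K L).injective.comp Subtype.val_injective
  -- The pole at infinity gives `u` absolute value above one, and completion preserves absolute
  -- values.
  · refine lt_of_not_ge fun h => huP ((hv.le_one_iff u).1 ?_)
    refine Eq.trans_le ?_ h
    exact (UniformSpace.Completion.norm_coe (WithAbs.toAbs v (algebraMap K Kbar u))).symm
  · refine Iff.trans ?_ (Place.mem_regularAway_iff u.2 huP)
    exact ⟨fun ⟨y, hy⟩ => hy ▸ y.2, fun h => ⟨⟨x, h⟩, rfl⟩⟩
  · exact fun h => htr (h.algHom infty.regularAway.val)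
  · refine forall_congr' fun x => imp_congr_right fun _ => ?_
    exact ⟨fun h => ⟨⟨_, h⟩, rfl⟩, fun ⟨y, hy⟩ => hy ▸ y.2⟩
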